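/- Let $\Omega=G/K$ be a symmetric space of non-compact type: $\mathfrak g$ is a finite-dimensional real semisimple Lie algebra without nonzero compact ideals, $\theta$ a Cartan involution of $\mathfrak g$, $G$ a group of automorphisms of $\mathfrak g$ containing all inner automorphisms (such as the group of isometries of $\Omega$), and $K=\{g\in G: g\theta=\theta g\}$. Let $0=eK$, let $m_{x,y}$ be the geodesic midpoint of $x,y\in\Omega$, and let $\mu$ be a locally finite $G$-invariant Borel measure on $\Omega$. Let $G=NAK$ be an Iwasawa decomposition, given by a maximal abelian subspace $\mathfrak a$ of the $(-1)$-eigenspace of $\theta$ and a choice of positive restricted roots; let $\rho$ be half the sum of the positive restricted roots counted with multiplicities, $M$ the centralizer of $A$ in $K$, and $B=K/M=G/MAN$, on which $G$ acts by left translations. For $x=gK\in\Omega$ and $b=kM\in B$ ($k\in K$) let $A(x,b)\in\mathfrak a$ be the unique element with $k^{-1}g\in N\exp A(x,b)\,K$, and for $\lambda\in\mathfrak a^*$ let $e_{\lambda,b}(x)=e^{(i\lambda+\rho)(A(x,b))}$. On $\Omega^*=\mathfrak a^*\times B$ let $d\rho(\lambda,b)=|c(\lambda)|^{-2}\,db\,d\lambda$,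 where $db$ is the $K$-invariant probability measure on $B$, $d\lambda$ is Lebesgue measure on $\mathfrak a^*$ (with any normalization), and $c$ is the Harish-Chandra $c$-function. For a function $a(x;\lambda,b)$ on $\Omega\times\Omega^*$ for which the integral $$\widetilde a(y,z)=\int_{\Omega^*}a(m_{z,y};\lambda,b)\,e_{\lambda,b}(y)\,e_{-\lambda,b}(z)\,d\rho(\lambda,b)$$ converges absolutely for almost every $y\in\Omega$ and almost every $z\in\Omega$, let $\Psi_a$ be the Weyl pseudodifferential operator $$\Psi_a u(y)=\int_\Omega \widetilde a(y,z)\,u(z)\,d\mu(z)$$ in $L^2(\Omega,d\mu)$, with domain the set of all $u\in L^2(\Omega,d\mu)$ for which this integral converges absolutely for almost every $y$ and defines an element of $L^2(\Omega,d\mu)$. For $g\in G$ let $U_g f(z)=f(g^{-1}z)$, a unitary operator on $L^2(\Omega,d\mu)$, and let $a^g(x;\lambda,b)=a(gx;\lambda,gb)$. Theorem. For every such $a$ and every $g\in G$, the integral defining $\widetilde{a^g}(y,z)$ also converges absolutely for almost every $y$ and almost every $z$, and $$U_g^*\,\Psi_a\,U_g=\Psi_{a^g},$$ as an equality of partially defined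 operators (in particular, the domains agree). -/

import Mathlib

open MeasureTheory
open scoped Nat ENNReal

noncomputable section

/-! ## Integral operators and partially defined operators -/

section Operators

variable {α : Type*} [MeasurableSpace α] (μ : Measure α) (κ : α → α → ℂ)

theorem kernel_add_ae (u v : Lp ℂ 2 μ) (y : α) :
    (fun z => κ y z * (u + v : Lp ℂ 2 μ) z) =ᵐ[μ] fun z => κ y z * u z + κ y z * v z := by
  filter_upwards [Lp.coeFn_add u v] with z hz
  rw [hz, Pi.add_apply, mul_add]

theorem kernel_smul_ae (c : ℂ) (u : Lp ℂ 2 μ) (y : α) :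
    (fun z => κ y z * (c • u : Lp ℂ 2 μ) z) =ᵐ[μ] fun z => c * (κ y z * u z) := by
  filter_upwards [Lp.coeFn_smul c u] with z hz
  rw [hz, Pi.smul_apply, smul_eq_mul, mul_left_comm]

theorem kernel_zero_ae (y : α) :
    (fun z => κ y z * (0 : Lp ℂ 2 μ) z) =ᵐ[μ] fun _ => (0 : ℂ) := by
  filter_upwards [Lp.coeFn_zero ℂ 2 μ] with z hz
  rw [hz, Pi.zero_apply, mul_zero]

/-- The natural domain in `L²` of the integral operator with kernel `κ`: all `u ∈ L²` for which
`∫ κ(y,z) u(z) dμ(z)` converges absolutely for almost every `y` and is in `L²` as a function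
of `y`. -/
def kernelDomain : Submodule ℂ (Lp ℂ 2 μ) where
  carrier := {u | (∀ᵐ y ∂μ, Integrable (fun z => κ y z * u z) μ) ∧
    MemLp (fun y => ∫ z, κ y z * u z ∂μ) 2 μ}
  add_mem' := by
    rintro u v ⟨hu, hu'⟩ ⟨hv, hv'⟩
    refine ⟨?_, (memLp_congr_ae ?_).mpr (hu'.add hv')⟩
    · filter_upwards [hu, hv] with y h1 h2
      exact (h1.add h2).congr (kernel_add_ae μ κ u v y).symm
    · filter_upwards [hu, hv] with y h1 h2
      rw [Pi.add_apply, integral_congr_ae (kernel_add_ae μ κ u v y), integral_add h1 h2]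
  zero_mem' := by
    refine ⟨Filter.Eventually.of_forall fun y =>
      (integrable_zero _ _ _).congr (kernel_zero_ae μ κ y).symm, ?_⟩
    have h : (fun y => ∫ z, κ y z * (0 : Lp ℂ 2 μ) z ∂μ) = fun _ => 0 := by
      funext y
      rw [integral_congr_ae (kernel_zero_ae μ κ y), integral_zero]
    rw [h]
    exact MemLp.zero'
  smul_mem' := by
    rintro c u ⟨hu, hu'⟩
    refine ⟨?_, (memLp_congr_ae ?_).mpr (hu'.const_smul c)⟩
    · filter_upwards [hu] with y h1
      exact (h1.const_mul c).congr (kernel_smul_ae μ κ c u y).symm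
    · filter_upwards with y
      rw [Pi.smul_apply, integral_congr_ae (kernel_smul_ae μ κ c u y), integral_const_mul,
        smul_eq_mul]

/-- The integral operator `u ↦ ∫ κ(·,z) u(z) dμ(z)` in `L²` on its natural domain. -/
def kernelOp : Lp ℂ 2 μ →ₗ.[ℂ] Lp ℂ 2 μ where
  domain := kernelDomain μ κ
  toFun :=
    { toFun := fun u => MemLp.toLp (fun y => ∫ z, κ y z * (u : Lp ℂ 2 μ) z ∂μ) u.2.2
      map_add' := by
        intro u v
        rw [← MemLp.toLp_add, MemLp.toLp_eq_toLp_iff]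
        filter_upwards [u.2.1, v.2.1] with y h1 h2
        rw [Pi.add_apply, ← integral_add h1 h2]
        exact integral_congr_ae (kernel_add_ae μ κ u v y)
      map_smul' := by
        intro c u
        rw [RingHom.id_apply, ← MemLp.toLp_const_smul, MemLp.toLp_eq_toLp_iff]
        filter_upwards with y
        rw [Pi.smul_apply, smul_eq_mul, ← integral_const_mul]
        exact integral_congr_ae (kernel_smul_ae μ κ c u y) }

/-- The composition `T ∘ V` of a partially defined operator `T` with an everywhere defined linear
map `V`; its domain is `{u | V u ∈ dom T}`. -/
def precomp {E : Type*} [AddCommGroup E] [Module ℂ E] (T : E →ₗ.[ℂ] E) (V : E →ₗ[ℂ] E) :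
    E →ₗ.[ℂ] E where
  domain := T.domain.comap V
  toFun := T.toFun ∘ₗ V.restrict fun _ hu => hu

theorem compMeasurePreserving_comp_cancel (f g : α → α) (hf : MeasurePreserving f μ μ)
    (hg : MeasurePreserving g μ μ) (h : ∀ z, f (g z) = z) (u : Lp ℂ 2 μ) :
    Lp.compMeasurePreserving g hg (Lp.compMeasurePreserving f hf u) = u := by
  refine Lp.ext ?_
  have h1 := Lp.coeFn_compMeasurePreserving (Lp.compMeasurePreserving f hf u) hg
  have h2 := hg.quasiMeasurePreserving.ae (Lp.coeFn_compMeasurePreserving u hf)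
  filter_upwards [h1, h2] with z hz hz'
  rw [hz, Function.comp_apply, hz', Function.comp_apply, h]

end Operators

/-! ## Symmetric spaces of non-compact type

A Riemannian symmetric space of non-compact type is `Ω = G / K`, where `𝔤` is a finite-dimensional
real semisimple Lie algebra without compact ideals, `θ` is a Cartan involution of `𝔤`, `G` is a
group of automorphisms of `𝔤` that contains all inner automorphisms, and `K` is the subgroup of
the elements of `G` that commute with `θ`. The group of all isometries of `Ω` is of this form
(`G` acts on `𝔤`, the Lie algebra of the isometry group, by the faithful adjoint representation).

The finite-dimensional space `𝔤` carries its unique Hausdorff vector space topology. -/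

variable {𝔤 : Type*} [LieRing 𝔤] [LieAlgebra ℝ 𝔤]

/-- `IsExpAd X g` says that `g = exp (ad X) = ∑ (ad X)ⁿ / n!` (pointwise convergence). -/
def IsExpAd [TopologicalSpace 𝔤] (X : 𝔤) (g : 𝔤 ≃ₗ[ℝ] 𝔤) : Prop :=
  ∀ Y : 𝔤, HasSum (fun n : ℕ => ((n ! : ℝ)⁻¹) • ((LieAlgebra.ad ℝ 𝔤 X) ^ n) Y) (g Y)

/-- The joint eigenspace `𝔤_α = {X : [H, X] = α(H) X for all H ∈ 𝔞}`. -/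
def rootSpace (𝔞 : Submodule ℝ 𝔤) (α : Module.Dual ℝ 𝔞) : Submodule ℝ 𝔤 where
  carrier := {X | ∀ H : 𝔞, ⁅(H : 𝔤), X⁆ = α H • X}
  add_mem' := by
    intro X Y hX hY H
    rw [lie_add, hX H, hY H, smul_add]
  zero_mem' := by
    intro H
    simp
  smul_mem' := by
    intro c X hX H
    rw [lie_smul, hX H, smul_comm]

/-- The restricted roots: the nonzero `α ∈ 𝔞*` with `𝔤_α ≠ 0`. -/
def restrictedRoots (𝔞 : Submodule ℝ 𝔤) : Set (Module.Dual ℝ 𝔞) :=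
  {α | α ≠ 0 ∧ rootSpace 𝔞 α ≠ ⊥}

/-- A symmetric space of non-compact type, given by `(𝔤, θ, G)`, together with the choices that
determine the Iwasawa decomposition `G = NAK`: a maximal abelian subspace `𝔞` of the
`(-1)`-eigenspace of `θ`, and a positive system of restricted roots (given by a regular element
of `𝔞`, i.e. by a Weyl chamber). -/
structure NoncompactSymmetricSpace (𝔤 : Type*) [LieRing 𝔤] [LieAlgebra ℝ 𝔤]
    [TopologicalSpace 𝔤] where
  /-- The Cartan involution. -/
  θ : 𝔤 →ₗ⁅ℝ⁆ 𝔤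
  θ_involutive : ∀ X, θ (θ X) = X
  /-- `-B(X, θ X)` is positive definite, `B` the Killing form; in particular `𝔤` is semisimple. -/
  θ_cartan : ∀ X, X ≠ 0 → killingForm ℝ 𝔤 X (θ X) < 0
  /-- There is no nonzero ideal inside the fixed subalgebra of `θ`. -/
  no_compact_ideal : ∀ I : LieIdeal ℝ 𝔤, (∀ X ∈ I, θ X = X) → I = ⊥
  /-- The group of isometries. -/
  G : Subgroup (𝔤 ≃ₗ[ℝ] 𝔤)
  G_automorphism : ∀ g ∈ G, ∀ X Y : 𝔤, g ⁅X, Y⁆ = ⁅g X, g Y⁆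
  inner_mem_G : ∀ (X : 𝔤) (g : 𝔤 ≃ₗ[ℝ] 𝔤), IsExpAd X g → g ∈ G
  /-- The maximal abelian subspace. -/
  𝔞 : Submodule ℝ 𝔤
  𝔞_le : ∀ H ∈ 𝔞, θ H = -H
  𝔞_abelian : ∀ H ∈ 𝔞, ∀ H' ∈ 𝔞, ⁅H, H'⁆ = 0
  𝔞_maximal : ∀ X, θ X = -X → (∀ H ∈ 𝔞, ⁅H, X⁆ = 0) → X ∈ 𝔞
  /-- A regular element; the positive roots are those that are positive on it. -/
  H₀ : 𝔞
  H₀_regular : ∀ α ∈ restrictedRoots 𝔞, α H₀ ≠ 0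

namespace NoncompactSymmetricSpace

variable [TopologicalSpace 𝔤] (S : NoncompactSymmetricSpace 𝔤)

/-! ### Roots, `ρ`, and the Harish-Chandra `c`-function -/

/-- The positive restricted roots. -/
def posRoots : Set (Module.Dual ℝ S.𝔞) :=
  {α | α ∈ restrictedRoots S.𝔞 ∧ 0 < α S.H₀}

/-- The multiplicity `m_α = dim 𝔤_α` (it is `0` if `α ≠ 0` is not a root). -/
def mult (α : Module.Dual ℝ S.𝔞) : ℕ := Module.finrank ℝ (rootSpace S.𝔞 α)

/-- `ρ`, half the sum of the positive roots counted with multiplicity. -/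
def rho : Module.Dual ℝ S.𝔞 :=
  (1 / 2 : ℝ) • ∑ᶠ α ∈ S.posRoots, (S.mult α : ℝ) • α

/-- The vector `H_α ∈ 𝔞` that represents `α` with respect to the Killing form. -/
def rootVector (α : Module.Dual ℝ S.𝔞) : S.𝔞 :=
  Classical.epsilon fun T : S.𝔞 => ∀ H : S.𝔞, killingForm ℝ 𝔤 (T : 𝔤) (H : 𝔤) = α H

/-- `⟨ν, α⟩ / ⟨α, α⟩`, with the inner product on `𝔞*` dual to the Killing form. -/
def rootRatio (ν α : Module.Dual ℝ S.𝔞) : ℝ :=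
  ν (S.rootVector α) / α (S.rootVector α)

/-- The indivisible positive roots. -/
def indivisiblePosRoots : Set (Module.Dual ℝ S.𝔞) :=
  {α | α ∈ S.posRoots ∧ (1 / 2 : ℝ) • α ∉ restrictedRoots S.𝔞}

/-- The factor `2⁻ˢ Γ(s) / (Γ((m_α/2 + 1 + s)/2) Γ((m_α/2 + m_{2α} + s)/2))`. -/
def cFactor (α : Module.Dual ℝ S.𝔞) (s : ℂ) : ℂ :=
  (2 : ℂ) ^ (-s) * Complex.Gamma s /
    (Complex.Gamma (((S.mult α : ℂ) / 2 + 1 + s) / 2) *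
      Complex.Gamma (((S.mult α : ℂ) / 2 + (S.mult ((2 : ℝ) • α) : ℂ) + s) / 2))

/-- The space `𝔞*`. -/
abbrev DualA : Type _ := StrongDual ℝ S.𝔞

/-- The Harish-Chandra `c`-function at real `λ ∈ 𝔞*` in its Gindikin–Karpelevich product form,
normalized by `c(-iρ) = 1`. -/
def cFunction (l : S.DualA) : ℂ :=
  ∏ᶠ α ∈ S.indivisiblePosRoots,
    S.cFactor α (Complex.I * (S.rootRatio (l : S.𝔞 →ₗ[ℝ] ℝ) α : ℂ)) /
      S.cFactor α (S.rootRatio S.rho α : ℂ)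

instance : MeasurableSpace S.DualA := borel _

instance : BorelSpace S.DualA := ⟨rfl⟩

/-! ### The groups `K`, `A`, `N`, `M` and the spaces `Ω = G/K`, `B = K/M = G/MAN` -/

/-- The topology of pointwise convergence on `G` (its topology as a linear group). -/
instance : TopologicalSpace S.G :=
  TopologicalSpace.induced (fun (g : S.G) (X : 𝔤) => (g : 𝔤 ≃ₗ[ℝ] 𝔤) X) inferInstance

/-- `K`, the elements of `G` that commute with `θ`. -/
def K : Subgroup S.G where
  carrier := {g | ∀ X, (g : 𝔤 ≃ₗ[ℝ] 𝔤) (S.θ X) = S.θ ((g : 𝔤 ≃ₗ[ℝ] 𝔤) X)}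
  mul_mem' := by
    intro g h hg hh X
    change (g : 𝔤 ≃ₗ[ℝ] 𝔤) ((h : 𝔤 ≃ₗ[ℝ] 𝔤) (S.θ X)) =
      S.θ ((g : 𝔤 ≃ₗ[ℝ] 𝔤) ((h : 𝔤 ≃ₗ[ℝ] 𝔤) X))
    rw [hh X, hg]
  one_mem' := by
    intro X
    rfl
  inv_mem' := by
    intro g hg X
    change (g : 𝔤 ≃ₗ[ℝ] 𝔤).symm (S.θ X) = S.θ ((g : 𝔤 ≃ₗ[ℝ] 𝔤).symm X)
    rw [LinearEquiv.symm_apply_eq, hg, LinearEquiv.apply_symm_apply]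

/-- `A`, the analytic subgroup with Lie algebra `𝔞`. -/
def A : Subgroup S.G :=
  Subgroup.closure {h | ∃ H ∈ S.𝔞, IsExpAd H (h : 𝔤 ≃ₗ[ℝ] 𝔤)}

/-- `N`, the analytic subgroup whose Lie algebra is the sum of the positive root spaces. -/
def N : Subgroup S.G :=
  Subgroup.closure {h | ∃ X ∈ ⨆ α ∈ S.posRoots, rootSpace S.𝔞 α, IsExpAd X (h : 𝔤 ≃ₗ[ℝ] 𝔤)}

/-- `M`, the centralizer of `A` in `K`. -/
def M : Subgroup S.G := S.K ⊓ Subgroup.centralizer (S.A : Set S.G)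

/-- The group `MAN`. -/
def MAN : Subgroup S.G := S.M ⊔ S.A ⊔ S.N

/-- The symmetric space `Ω = G/K`. -/
def Omega : Type _ := S.G ⧸ S.K

/-- The boundary `B = G/MAN`, which is `K/M` as a `K`-space; `G` acts by left translations. -/
def Bdry : Type _ := S.G ⧸ S.MAN

instance : MulAction S.G S.Omega := inferInstanceAs (MulAction S.G (S.G ⧸ S.K))

instance : TopologicalSpace S.Omega := inferInstanceAs (TopologicalSpace (S.G ⧸ S.K))

instance : MeasurableSpace S.Omega := borel _

instance : BorelSpace S.Omega := ⟨rfl⟩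

instance : MulAction S.G S.Bdry := inferInstanceAs (MulAction S.G (S.G ⧸ S.MAN))

instance : TopologicalSpace S.Bdry := inferInstanceAs (TopologicalSpace (S.G ⧸ S.MAN))

instance : MeasurableSpace S.Bdry := borel _

instance : BorelSpace S.Bdry := ⟨rfl⟩

/-- The point `g0 = gK` of `Ω`. -/
def pt (g : S.G) : S.Omega := (QuotientGroup.mk g : S.G ⧸ S.K)

/-- The point `g MAN` of `B`. -/
def bpt (g : S.G) : S.Bdry := (QuotientGroup.mk g : S.G ⧸ S.MAN)

instance : Nonempty S.Omega := ⟨S.pt 1⟩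

/-! ### Plane waves and the Plancherel measure -/

/-- `H` is the Iwasawa projection `A(x,b)`: `b = kM`, `x = gK` and `k⁻¹ g ∈ N exp(H) K`. -/
def IsIwasawaProj (x : S.Omega) (b : S.Bdry) (H : S.𝔞) : Prop :=
  ∃ k ∈ S.K, ∃ g : S.G, b = S.bpt k ∧ x = S.pt g ∧
    ∃ n ∈ S.N, ∃ a : S.G, IsExpAd (H : 𝔤) (a : 𝔤 ≃ₗ[ℝ] 𝔤) ∧ ∃ k' ∈ S.K, k⁻¹ * g = n * a * k'

/-- The unique `A(x,b) ∈ 𝔞` with `k⁻¹ g ∈ N exp(A(x,b)) K` for `b = kM`, `x = gK`. -/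
def iwasawaProj (x : S.Omega) (b : S.Bdry) : S.𝔞 :=
  Classical.epsilon (S.IsIwasawaProj x b)

/-- The plane wave `e_{λ,b}(x) = exp((iλ + ρ)(A(x,b)))`. -/
def planeWave (l : S.DualA) (b : S.Bdry) (x : S.Omega) : ℂ :=
  Complex.exp (Complex.I * (l (S.iwasawaProj x b) : ℂ) + (S.rho (S.iwasawaProj x b) : ℂ))

/-- The measure `dρ(λ,b) = |c(λ)|⁻² db dλ` on `Ω* = 𝔞* × B`. -/
def plancherel (η : Measure S.DualA) (β : Measure S.Bdry) : Measure (S.DualA × S.Bdry) :=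
  (η.withDensity fun l => ENNReal.ofReal ((‖S.cFunction l‖ ^ 2)⁻¹)).prod β

/-! ### Geodesic midpoints -/

/-- `m` is the midpoint of a geodesic segment from `x` to `y`. The geodesics of `Ω` are the curves
`t ↦ g exp(tX) K` with `g ∈ G` and `θ X = -X`; here `x`, `m`, `y` are the points with parameters
`t = 0`, `1/2`, `1`. -/
def IsMidpoint (x y m : S.Omega) : Prop :=
  ∃ (g h h' : S.G) (X : 𝔤), S.θ X = -X ∧ IsExpAd X (h : 𝔤 ≃ₗ[ℝ] 𝔤) ∧
    IsExpAd ((1 / 2 : ℝ) • X) (h' : 𝔤 ≃ₗ[ℝ] 𝔤) ∧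
    x = S.pt g ∧ m = S.pt (g * h') ∧ y = S.pt (g * h)

/-- The geodesic midpoint `m_{x,y}`. -/
def midpt (x y : S.Omega) : S.Omega := Classical.epsilon (S.IsMidpoint x y)

/-! ### Weyl pseudodifferential operators -/

/-- A symbol: a function `a(x; λ, b)` on `Ω × Ω*`. -/
abbrev Sym : Type _ := S.Omega → S.DualA → S.Bdry → ℂ

/-- The symbol `a^g(x; λ, b) = a(gx; λ, gb)`. -/
def translate (g : S.G) (a : S.Sym) : S.Sym := fun x l b => a (g • x) l (g • b)

/-- The integrand `a(m_{z,y}; λ, b) e_{λ,b}(y) e_{-λ,b}(z)` of the integral kernel. -/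
def weylIntegrand (a : S.Sym) (y z : S.Omega) (p : S.DualA × S.Bdry) : ℂ :=
  a (S.midpt z y) p.1 p.2 * S.planeWave p.1 p.2 y * S.planeWave (-p.1) p.2 z

/-- The integral that defines the kernel converges absolutely for almost all `y`, `z`. -/
def KernelConverges (μ : Measure S.Omega) (η : Measure S.DualA) (β : Measure S.Bdry)
    (a : S.Sym) : Prop :=
  ∀ᵐ y ∂μ, ∀ᵐ z ∂μ, Integrable (S.weylIntegrand a y z) (S.plancherel η β)

/-- The integral kernel `ã(y,z) = ∫ a(m_{z,y}; λ, b) e_{λ,b}(y) e_{-λ,b}(z) dρ(λ,b)`. -/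
def weylKernel (η : Measure S.DualA) (β : Measure S.Bdry) (a : S.Sym) (y z : S.Omega) : ℂ :=
  ∫ p, S.weylIntegrand a y z p ∂(S.plancherel η β)

/-- The Weyl operator `Ψ_a u(y) = ∫ ã(y,z) u(z) dμ(z)` in `L²(Ω, dμ)`, on its natural domain. -/
def weylOp (μ : Measure S.Omega) (η : Measure S.DualA) (β : Measure S.Bdry) (a : S.Sym) :
    Lp ℂ 2 μ →ₗ.[ℂ] Lp ℂ 2 μ :=
  kernelOp μ (S.weylKernel η β a)

/-! ### The unitary operators `U_g` -/

section Unitary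

variable [IsTopologicalAddGroup 𝔤] [ContinuousSMul ℝ 𝔤] [T2Space 𝔤] [FiniteDimensional ℝ 𝔤]

theorem continuous_mul_left_G (g : S.G) : Continuous fun h : S.G => g * h := by
  rw [continuous_induced_rng]
  refine continuous_pi fun X => ?_
  have hg : Continuous fun Y : 𝔤 => (g : 𝔤 ≃ₗ[ℝ] 𝔤) Y :=
    LinearMap.continuous_of_finiteDimensional ((g : 𝔤 ≃ₗ[ℝ] 𝔤) : 𝔤 →ₗ[ℝ] 𝔤)
  have hX : Continuous fun h : S.G => (h : 𝔤 ≃ₗ[ℝ] 𝔤) X :=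
    (continuous_apply X).comp continuous_induced_dom
  exact hg.comp hX

theorem continuous_smul_Omega (g : S.G) : Continuous fun x : S.Omega => g • x := by
  refine (QuotientGroup.isQuotientMap_mk (N := S.K)).continuous_iff.mpr ?_
  exact QuotientGroup.continuous_mk.comp (S.continuous_mul_left_G g)

instance : MeasurableConstSMul S.G S.Omega :=
  ⟨fun g => (S.continuous_smul_Omega g).measurable⟩

/-- The unitary operator `U_g f(z) = f(g⁻¹ z)` on `L²(Ω, dμ)`, for a `G`-invariant measure `μ`. -/
def U (μ : Measure S.Omega) [SMulInvariantMeasure S.G S.Omega μ] (g : S.G) :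
    Lp ℂ 2 μ ≃ₗᵢ[ℂ] Lp ℂ 2 μ where
  toFun := Lp.compMeasurePreserving (fun z : S.Omega => g⁻¹ • z) (measurePreserving_smul g⁻¹ μ)
  invFun := Lp.compMeasurePreserving (fun z : S.Omega => g • z) (measurePreserving_smul g μ)
  map_add' := map_add _
  map_smul' := (Lp.compMeasurePreservingₗ ℂ (fun z : S.Omega => g⁻¹ • z)
    (measurePreserving_smul g⁻¹ μ)).map_smul
  left_inv := compMeasurePreserving_comp_cancel μ _ _ _ _ fun z => inv_smul_smul g z
  right_inv := compMeasurePreserving_comp_cancel μ _ _ _ _ fun z => smul_inv_smul g z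
  norm_map' := fun f => Lp.norm_compMeasurePreserving f _

end Unitary

end NoncompactSymmetricSpace

end

noncomputable section

set_option linter.unusedSectionVars false

/-! ## Linear algebra: joint diagonalization, exponentials, triangular operators -/

section LinearAlgebra

open InnerProductSpace

/-! The heart is the identity ã^g(y,z) = ã(gy,gz), obtained by substituting b ↦ gb in the kernel
integral. Midpoints commute with G. The Iwasawa projection is a cocycle, A(gx,gb) = A(x,b) +
A(g0,gb), so the product of the two plane waves at (gy,gz,gb) is the one at (y,z,b) times
exp(2ρ(A(g0,gb))): the λ-parts cancel because λ occurs with both signs. The boundary measure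
transforms with the Jacobian exp(-2ρ(A(g0,gb))), which cancels this factor
(`weylIntegrand_translate`, `measurePreserving_plancherel`). Since μ is invariant, conjugation by
U_g replaces any kernel κ(y,z) by κ(gy,gz), domains included (`adjoint_U_comp_kernelOp`).

The structure theory behind this is proved directly. In an orthonormal eigenbasis of ad 𝔞 ordered by
decreasing H₀-degree, K is orthogonal, A is positive diagonal and N is unipotent upper triangular.
Thus G = KAN is a QR decomposition, which gives its uniqueness and its smoothness through
Gram–Schmidt. Existence (`exists_iwasawa`) uses the polar decomposition (`exists_polar`) and the
fact that derivations are inner. Polar uniqueness also makes midpoints well defined.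

The Jacobian (`map_smul_withDensity_jac`) is derived from K-invariance of β alone. Call F covariant
if F(g m exp(H) n) = exp(-2ρ(H)) F(g). For such F the integral of F(gk) over K/M does not depend on
g: by the polar decomposition one may take g = exp(tX) with X in 𝔭 and differentiate. Decompose k⁻¹X
into parts in 𝔨, 𝔞 and 𝔫. The 𝔫-part annihilates F and the 𝔞-part H multiplies F by -2ρ(H). The
𝔨-part is a vector field on K/M of divergence 2ρ(H), by a trace computation (`trace_ad_comp_kPart`).
Hence the derivative of F along X is a total divergence along K (`sum_fderiv_fieldCoeff`) and
integrates to zero. Applying this to exp(-2ρ(H(g))) times characters of a vector space in which B is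
embedded identifies two measures by their characteristic functions. -/

theorem exists_orthonormal_joint_eigenbasis {V ι : Type*} [AddCommGroup V] [Module ℝ V]
    [FiniteDimensional ℝ V] (B : LinearMap.BilinForm ℝ V) (hsymm : ∀ x y, B x y = B y x)
    (hpos : ∀ x, x ≠ 0 → 0 < B x x) (T : ι → V →ₗ[ℝ] V)
    (hT : ∀ i x y, B (T i x) y = B x (T i y)) (hcomm : ∀ i j x, T i (T j x) = T j (T i x)) :
    ∃ (n : ℕ) (e : Module.Basis (Fin n) ℝ V) (w : Fin n → ι → ℝ),
      (∀ i j, B (e i) (e j) = if i = j then 1 else 0) ∧ ∀ i j, T j (e i) = w i j • e i := by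
  classical
  -- With `B` as inner product the `T i` are commuting symmetric operators, so `V` is the orthogonal
  -- sum of their joint eigenspaces.
  let core : InnerProductSpace.Core ℝ V :=
    { inner := fun x y => B x y
      conj_inner_symm := fun x y => by simp [hsymm x y]
      re_inner_nonneg := fun x => by
        by_cases hx : x = 0
        · simp [hx]
        · exact (hpos x hx).le
      add_left := fun x y z => by simp
      smul_left := fun x y r => by simp
      definite := fun x hx => by
        by_contra h
        exact (hpos x h).ne' hx }
  let _ : NormedAddCommGroup V := core.toNormedAddCommGroup
  let _ : InnerProductSpace ℝ V := InnerProductSpace.ofCore core.toCore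
  have hin : ∀ x y : V, inner ℝ x y = B x y := fun _ _ => rfl
  have hs : ∀ i, (T i : Module.End ℝ V).IsSymmetric := fun i x y => hT i x y
  have hint := LinearMap.IsSymmetric.directSum_isInternal_of_pairwise_commute (T := T) hs
    (fun i j _ => LinearMap.ext fun x => hcomm i j x)
  have horth := LinearMap.IsSymmetric.orthogonalFamily_iInf_eigenspaces (T := T) hs
  let b := hint.collectedBasis fun α =>
    (stdOrthonormalBasis ℝ (⨅ j, Module.End.eigenspace (T j) (α j) : Submodule ℝ V)).toBasis
  have hb : Orthonormal ℝ b := by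
    have := horth.orthonormal_sigma_orthonormal (v_family := fun α => stdOrthonormalBasis ℝ
      (⨅ j, Module.End.eigenspace (T j) (α j) : Submodule ℝ V)) (fun α => OrthonormalBasis.orthonormal _)
    convert this using 1
    funext a
    simp [b, DirectSum.IsInternal.collectedBasis_coe]
  have : Finite _ := Module.Finite.finite_basis b
  obtain ⟨n, ⟨eqv⟩⟩ := Finite.exists_equiv_fin (Σ α : ι → ℝ,
    Fin (Module.finrank ℝ (⨅ j, Module.End.eigenspace (T j) (α j) : Submodule ℝ V)))
  refine ⟨n, b.reindex eqv, fun i => (eqv.symm i).1, fun i j => ?_, fun i j => ?_⟩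
  · rw [← hin, Module.Basis.reindex_apply, Module.Basis.reindex_apply,
      orthonormal_iff_ite.mp hb]
    simp
  · have hm : b (eqv.symm i) ∈ (⨅ j, Module.End.eigenspace (T j) ((eqv.symm i).1 j) : Submodule ℝ V) :=
      hint.collectedBasis_mem _ _
    rw [Submodule.mem_iInf] at hm
    rw [Module.Basis.reindex_apply]
    exact Module.End.mem_eigenspace_iff.mp (hm j)

/-- If `D` acts by `p(l)` wherever the diagonalizable map `T` acts by `l`, this also holds for
every eigenvector of `T`. -/
theorem apply_eq_of_diagonal {V ι : Type*} [AddCommGroup V] [Module ℝ V] (f : Module.Basis ι ℝ V)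
    (T D : V →ₗ[ℝ] V) (l : ι → ℝ) (p : ℝ → ℝ) (hT : ∀ i, T (f i) = l i • f i)
    (hD : ∀ i, D (f i) = p (l i) • f i) {c : ℝ} {v : V} (h : T v = c • v) : D v = p c • v := by
  have key : ∀ (T : V →ₗ[ℝ] V) (l : ι → ℝ), (∀ i, T (f i) = l i • f i) → ∀ v i,
      f.repr (T v) i = l i * f.repr v i := by
    intro T l hT v i
    have : (Finsupp.lapply i ∘ₗ f.repr.toLinearMap ∘ₗ T) =
        l i • (Finsupp.lapply i ∘ₗ f.repr.toLinearMap) := by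
      refine f.ext fun j => ?_
      simp only [LinearMap.comp_apply, LinearMap.smul_apply, hT, map_smul]
      by_cases hij : j = i
      · simp [hij]
      · simp [hij]
    exact LinearMap.congr_fun this v
  refine f.ext_elem fun i => ?_
  rw [key D _ hD]
  have h1 := key T l hT v i
  rw [h] at h1
  simp only [map_smul, Finsupp.smul_apply, smul_eq_mul] at h1 ⊢
  -- A nonzero coordinate forces `l i = c`, so `D` multiplies it by `p c`.
  by_cases h0 : f.repr v i = 0
  · simp [h0]
  · rw [mul_right_cancel₀ h0 h1]

variable {E : Type*} [NormedAddCommGroup E] [InnerProductSpace ℝ E] [FiniteDimensional ℝ E]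

theorem exp_clm_hasSum (T : E →L[ℝ] E) (v : E) :
    HasSum (fun n : ℕ => ((n ! : ℝ)⁻¹) • (T ^ n) v) (NormedSpace.exp T v) := by
  have := (NormedSpace.exp_series_hasSum_exp' (𝕂 := ℝ) T).mapL (ContinuousLinearMap.apply ℝ E v)
  simpa using this

theorem exp_clm_add {S T : E →L[ℝ] E} (h : Commute S T) :
    NormedSpace.exp (S + T) = NormedSpace.exp S * NormedSpace.exp T := by
  let _ : NormedAlgebra ℚ (E →L[ℝ] E) := NormedAlgebra.restrictScalars ℚ ℝ _
  exact NormedSpace.exp_add_of_commute h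

theorem exp_clm_mul_neg (T : E →L[ℝ] E) : NormedSpace.exp T * NormedSpace.exp (-T) = 1 := by
  rw [← exp_clm_add (Commute.neg_right (Commute.refl T)), add_neg_cancel, NormedSpace.exp_zero]

theorem exp_clm_neg_mul (T : E →L[ℝ] E) : NormedSpace.exp (-T) * NormedSpace.exp T = 1 := by
  simpa using exp_clm_mul_neg (-T)

theorem exp_clm_apply_eigenvector {T : E →L[ℝ] E} {v : E} {c : ℝ} (h : T v = c • v) :
    NormedSpace.exp T v = Real.exp c • v := by
  have h1 := exp_clm_hasSum T v
  have hp : ∀ n : ℕ, (T ^ n) v = c ^ n • v := by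
    intro n
    induction n with
    | zero => simp
    | succ n ih => rw [pow_succ, mul_apply_eq_comp, h, map_smul, ih, smul_smul, pow_succ,
        mul_comm]
  have h2 : HasSum (fun n : ℕ => ((n ! : ℝ)⁻¹) • (c ^ n)) (Real.exp c) := by
    rw [Real.exp_eq_exp_ℝ]
    exact NormedSpace.exp_series_hasSum_exp' (𝕂 := ℝ) c
  have h3 := h2.smul_const v
  refine h1.unique ?_
  convert h3 using 2 with n
  rw [hp, smul_smul, smul_eq_mul]

/-- An eigenvector of the exponential of a symmetric operator is an eigenvector. -/
theorem apply_eq_of_exp_apply_eq {T : E →L[ℝ] E} (hT : (T : E →ₗ[ℝ] E).IsSymmetric) {v : E} {c : ℝ}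
    (h : NormedSpace.exp T v = Real.exp c • v) : T v = c • v := by
  have := apply_eq_of_diagonal (hT.eigenvectorBasis rfl).toBasis
    (NormedSpace.exp T : E →L[ℝ] E).toLinearMap T.toLinearMap
    (fun i => Real.exp (hT.eigenvalues rfl i)) Real.log
    (fun i => by
      rw [OrthonormalBasis.coe_toBasis]
      exact exp_clm_apply_eigenvector (hT.apply_eigenvectorBasis rfl i))
    (fun i => by
      rw [Real.log_exp, OrthonormalBasis.coe_toBasis]
      exact hT.apply_eigenvectorBasis rfl i)
    (v := v) (c := Real.exp c) h
  simpa using this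

/-- An eigenbasis of `T` diagonalizes `exp T = exp S`. As the real exponential is injective, `S`
acts on it with the same eigenvalues. -/
theorem exp_injOn_isSymmetric {S T : E →L[ℝ] E} (hS : (S : E →ₗ[ℝ] E).IsSymmetric)
    (hT : (T : E →ₗ[ℝ] E).IsSymmetric) (h : NormedSpace.exp S = NormedSpace.exp T) : S = T := by
  have : (S : E →ₗ[ℝ] E) = T := by
    refine (hT.eigenvectorBasis rfl).toBasis.ext fun i => ?_
    have h1 : T (hT.eigenvectorBasis rfl i) = hT.eigenvalues rfl i • hT.eigenvectorBasis rfl i :=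
      hT.apply_eigenvectorBasis rfl i
    have h2 := exp_clm_apply_eigenvector h1
    rw [← h] at h2
    have h3 := apply_eq_of_exp_apply_eq hS h2
    simpa [h1] using h3
  exact ContinuousLinearMap.coe_injective this

/-- The part of order at least `m` of the exponential series maps to an invariant subspace if
`Tᵐ` does. -/
theorem exp_sub_sum_mem {T : E →L[ℝ] E} (W : Submodule ℝ E) (hW : ∀ x ∈ W, T x ∈ W) {v : E} (m : ℕ)
    (hv : (T ^ m) v ∈ W) :
    NormedSpace.exp T v - ∑ n ∈ Finset.range m, ((n ! : ℝ)⁻¹) • (T ^ n) v ∈ W := by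
  have h1 := (hasSum_nat_add_iff' m).mpr (exp_clm_hasSum T v)
  have hc : IsClosed (W : Set E) := W.closed_of_finiteDimensional
  refine hc.mem_of_tendsto h1 (Filter.Eventually.of_forall fun s => ?_)
  refine W.sum_mem fun n hn => W.smul_mem _ ?_
  clear hn
  rw [pow_add]
  induction n with
  | zero => simpa using hv
  | succ n ih =>
    have h2 := hW _ ih
    rw [← mul_apply_eq_comp, ← mul_assoc, ← pow_succ'] at h2
    exact h2

/-! ### Triangular operators -/

variable {n : ℕ} (b : OrthonormalBasis (Fin n) ℝ E)

/-- The matrix coefficients of an operator. -/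
def coeff (T : E →L[ℝ] E) (j i : Fin n) : ℝ := inner ℝ (b j) (T (b i))

theorem coeff_mul (S T : E →L[ℝ] E) (j i : Fin n) :
    coeff b (S * T) j i = ∑ k, coeff b S j k * coeff b T k i := by
  unfold coeff
  conv_lhs => rw [mul_apply_eq_comp, ← b.sum_repr' (T (b i)), map_sum, inner_sum]
  refine Finset.sum_congr rfl fun k _ => ?_
  rw [map_smul, inner_smul_right, mul_comm]

theorem coeff_one (j i : Fin n) : coeff b (1 : E →L[ℝ] E) j i = if j = i then 1 else 0 :=
  orthonormal_iff_ite.mp b.orthonormal j i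

theorem coeff_add (S T : E →L[ℝ] E) (j i : Fin n) :
    coeff b (S + T) j i = coeff b S j i + coeff b T j i := by
  simp [coeff, inner_add_right]

theorem coeff_smul (c : ℝ) (T : E →L[ℝ] E) (j i : Fin n) :
    coeff b (c • T) j i = c * coeff b T j i := by
  simp [coeff, inner_smul_right]

theorem coeff_sub (S T : E →L[ℝ] E) (j i : Fin n) :
    coeff b (S - T) j i = coeff b S j i - coeff b T j i := by
  simp [coeff, inner_sub_right]

theorem apply_eq_sum_coeff (T : E →L[ℝ] E) (i : Fin n) : T (b i) = ∑ j, coeff b T j i • b j :=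
  (b.sum_repr' (T (b i))).symm

/-- The operators that strictly raise the degree `δ`. -/
def strictRaise (δ : Fin n → ℝ) : Submodule ℝ (E →L[ℝ] E) where
  carrier := {T | ∀ i j, δ j ≤ δ i → coeff b T j i = 0}
  add_mem' := fun {S T} hS hT i j h => by rw [coeff_add, hS i j h, hT i j h, add_zero]
  zero_mem' := fun i j _ => by simp [coeff]
  smul_mem' := fun c T hT i j h => by rw [coeff_smul, hT i j h, mul_zero]

variable {b} {δ : Fin n → ℝ}

theorem mul_mem_strictRaise {S T : E →L[ℝ] E} (hS : S ∈ strictRaise b δ)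
    (hT : T ∈ strictRaise b δ) : S * T ∈ strictRaise b δ := by
  intro i j h
  rw [coeff_mul]
  refine Finset.sum_eq_zero fun k _ => ?_
  by_cases hk : δ k ≤ δ i
  · rw [hT i k hk, mul_zero]
  · rw [hS k j (by linarith), zero_mul]

theorem isClosed_strictRaise : IsClosed (strictRaise b δ : Set (E →L[ℝ] E)) :=
  (strictRaise b δ).closed_of_finiteDimensional

theorem exp_sub_one_mem_strictRaise {T : E →L[ℝ] E} (hT : T ∈ strictRaise b δ) :
    NormedSpace.exp T - 1 ∈ strictRaise b δ := by
  have h1 := (hasSum_nat_add_iff' 1).mpr (NormedSpace.exp_series_hasSum_exp' (𝕂 := ℝ) T)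
  simp only [Finset.range_one, Finset.sum_singleton, Nat.factorial_zero, Nat.cast_one, inv_one,
    pow_zero, one_smul] at h1
  refine isClosed_strictRaise.mem_of_tendsto h1 (Filter.Eventually.of_forall fun s => ?_)
  refine Submodule.sum_mem _ fun k hk => Submodule.smul_mem _ _ ?_
  clear hk
  induction k with
  | zero => simpa using hT
  | succ k ih => rw [pow_succ]; exact mul_mem_strictRaise ih hT

/-- The operators that are unipotent and raise the degree `δ`. -/
def unipotentRaise (b : OrthonormalBasis (Fin n) ℝ E) (δ : Fin n → ℝ) : Submonoid (E →L[ℝ] E) where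
  carrier := {T | T - 1 ∈ strictRaise b δ}
  one_mem' := by
    change (1 : E →L[ℝ] E) - 1 ∈ strictRaise b δ
    simp
  mul_mem' := by
    intro S T hS hT
    have : S * T - 1 = (S - 1) * (T - 1) + (S - 1) + (T - 1) := by noncomm_ring
    change S * T - 1 ∈ strictRaise b δ
    rw [this]
    exact Submodule.add_mem _ (Submodule.add_mem _ (mul_mem_strictRaise hS hT) hS) hT

/-! ### Gram–Schmidt orthogonalization -/

/-- The Gram–Schmidt orthogonalization of the columns of an operator. -/
def gsVec (b : OrthonormalBasis (Fin n) ℝ E) (T : E →L[ℝ] E) (i : Fin n) : E :=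
  gramSchmidt ℝ (fun j => T (b j)) i

/-- The orthogonal factor of the QR decomposition. -/
def qrOrth (b : OrthonormalBasis (Fin n) ℝ E) (T : E →L[ℝ] E) : E →L[ℝ] E :=
  ∑ i, (innerSL ℝ (b i)).smulRight (‖gsVec b T i‖⁻¹ • gsVec b T i)

theorem qrOrth_apply (T : E →L[ℝ] E) (i : Fin n) :
    qrOrth b T (b i) = ‖gsVec b T i‖⁻¹ • gsVec b T i := by
  simp only [qrOrth, sum_apply, ContinuousLinearMap.smulRight_apply,
    innerSL_apply_apply]
  simp [orthonormal_iff_ite.mp b.orthonormal]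

theorem gsVec_eq_sub (T : E →L[ℝ] E) (i : Fin n) :
    gsVec b T i = T (b i) - ∑ j ∈ Finset.Iio i,
      (inner ℝ (gsVec b T j) (T (b i)) / ‖gsVec b T j‖ ^ 2) • gsVec b T j := by
  unfold gsVec
  rw [gramSchmidt_def]
  simp [Submodule.starProjection_singleton]

/-- Because `u` is upper triangular and `k` isometric, the projections removed in the i-th step are
exactly the off-diagonal terms of `k (u (b i))`. For positive `r`, normalizing then recovers `k`:
this is uniqueness in the QR decomposition. -/
theorem gsVec_mul {k u : E →L[ℝ] E} (hk : ∀ x y, inner ℝ (k x) (k y) = inner ℝ x y) {r : Fin n → ℝ}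
    (hr : ∀ i, r i ≠ 0) (hd : ∀ i, coeff b u i i = r i) (hu : ∀ i j, i < j → coeff b u j i = 0)
    (i : Fin n) : gsVec b (k * u) i = r i • k (b i) := by
  induction i using WellFoundedLT.induction with
  | ind i ih =>
    have hkb : ∀ j, ‖k (b j)‖ = 1 := fun j => by
      rw [norm_eq_sqrt_real_inner, hk, real_inner_self_eq_norm_sq]; simp
    have h1 : ∀ j ∈ Finset.Iio i, (inner ℝ (gsVec b (k * u) j) ((k * u) (b i)) /
        ‖gsVec b (k * u) j‖ ^ 2) • gsVec b (k * u) j = coeff b u j i • k (b j) := by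
      intro j hj
      rw [ih j (Finset.mem_Iio.mp hj), inner_smul_left, mul_apply_eq_comp, hk, norm_smul,
        hkb, smul_smul]
      congr 1
      have := hr j
      change r j * coeff b u j i / _ * _ = _
      simp only [Real.norm_eq_abs, mul_one, sq_abs]
      field_simp
    rw [gsVec_eq_sub, Finset.sum_congr rfl h1, mul_apply_eq_comp, apply_eq_sum_coeff b u i,
      map_sum, ← Finset.sum_subset (Finset.subset_univ (Finset.Iic i)) (fun j _ hj => by
        rw [hu i j (by simpa using hj), zero_smul, map_zero]),
      ← Finset.Iio_insert, Finset.sum_insert (by simp)]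
    simp [hd]

theorem norm_gsVec_mul {k u : E →L[ℝ] E} (hk : ∀ x y, inner ℝ (k x) (k y) = inner ℝ x y)
    {r : Fin n → ℝ} (hr : ∀ i, 0 < r i) (hd : ∀ i, coeff b u i i = r i)
    (hu : ∀ i j, i < j → coeff b u j i = 0) (i : Fin n) : ‖gsVec b (k * u) i‖ = r i := by
  rw [gsVec_mul hk (fun i => (hr i).ne') hd hu, norm_smul, norm_eq_sqrt_real_inner (k (b i)), hk,
    real_inner_self_eq_norm_sq]
  simp [abs_of_pos (hr i)]

theorem qrOrth_mul {k u : E →L[ℝ] E} (hk : ∀ x y, inner ℝ (k x) (k y) = inner ℝ x y)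
    {r : Fin n → ℝ} (hr : ∀ i, 0 < r i) (hd : ∀ i, coeff b u i i = r i)
    (hu : ∀ i j, i < j → coeff b u j i = 0) : qrOrth b (k * u) = k := by
  refine ContinuousLinearMap.coe_injective (b.toBasis.ext fun i => ?_)
  simp only [OrthonormalBasis.coe_toBasis, ContinuousLinearMap.coe_coe]
  rw [qrOrth_apply, norm_gsVec_mul hk hr hd hu, gsVec_mul hk (fun i => (hr i).ne') hd hu, smul_smul,
    inv_mul_cancel₀ (hr i).ne', one_smul]

theorem linearIndependent_apply_of_isUnit {T : E →L[ℝ] E} (hT : IsUnit T) :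
    LinearIndependent ℝ fun i => T (b i) := by
  obtain ⟨u, rfl⟩ := hT
  have h := b.toBasis.linearIndependent.map' (u : E →L[ℝ] E).toLinearMap
    (LinearMap.ker_eq_bot_of_inverse (g := (↑u⁻¹ : E →L[ℝ] E).toLinearMap)
      (LinearMap.ext fun x => by
        change ((↑u⁻¹ : E →L[ℝ] E) * u) x = x
        simp))
  simpa [Function.comp_def] using h

theorem gsVec_ne_zero {T : E →L[ℝ] E} (hT : IsUnit T) (i : Fin n) : gsVec b T i ≠ 0 :=
  gramSchmidt_ne_zero i (linearIndependent_apply_of_isUnit hT)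

/-- Gram–Schmidt divides only by squared norms, which do not vanish for invertible `T`. Regularity
of the Iwasawa components will come from here. -/
theorem contDiffAt_gsVec {T : E →L[ℝ] E} (hT : IsUnit T) (i : Fin n) :
    ContDiffAt ℝ 1 (fun T => gsVec b T i) T := by
  induction i using WellFoundedLT.induction with
  | ind i ih =>
    have h0 : ∀ j : Fin n, ContDiffAt ℝ 1 (fun T : E →L[ℝ] E => T (b j)) T := fun j =>
      (ContinuousLinearMap.apply ℝ E (b j)).contDiff.contDiffAt
    simp_rw [gsVec_eq_sub (b := b) _ i]
    refine (h0 i).sub (ContDiffAt.sum fun j hj => ?_)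
    have hj' := ih j (Finset.mem_Iio.mp hj)
    refine ContDiffAt.smul (ContDiffAt.div (hj'.inner ℝ (h0 i)) (hj'.norm_sq ℝ) ?_) hj'
    have := gsVec_ne_zero hT j (b := b)
    positivity

theorem contDiffAt_norm_gsVec {T : E →L[ℝ] E} (hT : IsUnit T) (i : Fin n) :
    ContDiffAt ℝ 1 (fun T => ‖gsVec b T i‖) T :=
  (contDiffAt_gsVec hT i).norm ℝ (gsVec_ne_zero hT i)

theorem contDiffAt_qrOrth {T : E →L[ℝ] E} (hT : IsUnit T) : ContDiffAt ℝ 1 (qrOrth b) T := by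
  unfold qrOrth
  refine ContDiffAt.sum fun i _ => ?_
  have h1 : ContDiffAt ℝ 1 (fun T => ‖gsVec b T i‖⁻¹ • gsVec b T i) T :=
    ((contDiffAt_norm_gsVec hT i).inv (norm_ne_zero_iff.mpr (gsVec_ne_zero hT i))).smul
      (contDiffAt_gsVec hT i)
  exact (ContinuousLinearMap.smulRightL ℝ E E (innerSL ℝ (b i))).contDiff.contDiffAt.comp T h1

end LinearAlgebra

theorem hasSum_congr_of_eq {M : Type*} [AddCommMonoid M] [TopologicalSpace M] {f g : ℕ → M} {a : M}
    (h : ∀ n, f n = g n) : HasSum f a ↔ HasSum g a := by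
  rw [funext h]

namespace NoncompactSymmetricSpace

variable {𝔤 : Type*} [LieRing 𝔤] [LieAlgebra ℝ 𝔤] [FiniteDimensional ℝ 𝔤] [TopologicalSpace 𝔤]
  [IsTopologicalAddGroup 𝔤] [ContinuousSMul ℝ 𝔤] [T2Space 𝔤] (S : NoncompactSymmetricSpace 𝔤)

/-! ### The inner product `-B(X, θY)` -/

/-- The inner product `-B(X, θY)`. -/
def ip : LinearMap.BilinForm ℝ 𝔤 := -(killingForm ℝ 𝔤).compl₂ S.θ.toLinearMap

theorem ip_apply (X Y : 𝔤) : S.ip X Y = -killingForm ℝ 𝔤 X (S.θ Y) := rfl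

theorem killingForm_theta (X Y : 𝔤) :
    killingForm ℝ 𝔤 (S.θ X) (S.θ Y) = killingForm ℝ 𝔤 X Y :=
  LieAlgebra.killingForm_of_equiv_apply
    { S.θ with
      invFun := S.θ
      left_inv := S.θ_involutive
      right_inv := S.θ_involutive } X Y

theorem killingForm_smul (g : S.G) (X Y : 𝔤) :
    killingForm ℝ 𝔤 (g.1 X) (g.1 Y) = killingForm ℝ 𝔤 X Y :=
  LieAlgebra.killingForm_of_equiv_apply
    { g.1 with map_lie' := fun {X Y} => S.G_automorphism g.1 g.2 X Y } X Y

theorem ip_symm (X Y : 𝔤) : S.ip X Y = S.ip Y X := by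
  rw [ip_apply, ip_apply, ← S.killingForm_theta, S.θ_involutive, LieModule.traceForm_comm]

theorem ip_pos (X : 𝔤) (hX : X ≠ 0) : 0 < S.ip X X := by
  rw [ip_apply]
  linarith [S.θ_cartan X hX]

theorem ip_ext {X Y : 𝔤} (h : ∀ Z, S.ip Z X = S.ip Z Y) : X = Y := by
  by_contra hne
  have := S.ip_pos (X - Y) (sub_ne_zero.mpr hne)
  rw [map_sub, h, sub_self] at this
  exact this.false

theorem ip_theta (X Y : 𝔤) : S.ip (S.θ X) (S.θ Y) = S.ip X Y := by
  rw [ip_apply, ip_apply, S.killingForm_theta]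

theorem ip_theta_left (X Y : 𝔤) : S.ip (S.θ X) Y = S.ip X (S.θ Y) := by
  rw [← S.ip_theta, S.θ_involutive]

theorem killingForm_lie (X Y Z : 𝔤) : killingForm ℝ 𝔤 ⁅X, Y⁆ Z = killingForm ℝ 𝔤 X ⁅Y, Z⁆ :=
  LieModule.traceForm_apply_lie_apply ℝ 𝔤 𝔤 X Y Z

/-- The adjoint of `ad Z` is `-ad (θZ)`. -/
theorem ip_lie_left (Z X Y : 𝔤) : S.ip ⁅Z, X⁆ Y = -S.ip X ⁅S.θ Z, Y⁆ := by
  rw [ip_apply, ip_apply, ← lie_skew, map_neg, LinearMap.neg_apply, killingForm_lie,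
    LieHom.map_lie, S.θ_involutive, neg_neg]

/-- The adjoint of `g ∈ G` is `θ g⁻¹ θ`. -/
theorem ip_smul_left (g : S.G) (X Y : 𝔤) : S.ip (g.1 X) Y = S.ip X (S.θ (g⁻¹.1 (S.θ Y))) := by
  rw [ip_apply, ip_apply, S.θ_involutive, ← S.killingForm_smul g X]
  congr 2
  exact (g.1.apply_symm_apply _).symm

theorem ad_injective (S : NoncompactSymmetricSpace 𝔤) {X Y : 𝔤}
    (h : LieAlgebra.ad ℝ 𝔤 X = LieAlgebra.ad ℝ 𝔤 Y) : X = Y := by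
  by_contra hne
  have h0 : LieAlgebra.ad ℝ 𝔤 (X - Y) = 0 := by rw [map_sub, h, sub_self]
  have := S.θ_cartan (X - Y) (sub_ne_zero.mpr hne)
  rw [killingForm_apply_apply, h0] at this
  simp at this

theorem isKilling (S : NoncompactSymmetricSpace 𝔤) : LieAlgebra.IsKilling ℝ 𝔤 where
  killingCompl_top_eq_bot := by
    rw [eq_bot_iff]
    intro X hX
    rw [LieIdeal.mem_killingCompl] at hX
    by_contra hne
    have := S.θ_cartan X hne
    rw [LieModule.traceForm_comm, hX _ trivial] at this
    exact this.false

/-- Derivations of `𝔤` are inner. -/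
theorem exists_ad_eq_of_derivation (S : NoncompactSymmetricSpace 𝔤) (D : 𝔤 →ₗ[ℝ] 𝔤)
    (hD : ∀ X Y, D ⁅X, Y⁆ = ⁅D X, Y⁆ + ⁅X, D Y⁆) :
    ∃ Z : 𝔤, LieAlgebra.ad ℝ 𝔤 Z = D := by
  have := S.isKilling
  let D' : LieDerivation ℝ 𝔤 𝔤 :=
    { D with
      leibniz' := fun X Y => by
        change D ⁅X, Y⁆ = ⁅X, D Y⁆ - ⁅Y, D X⁆
        rw [hD, ← lie_skew Y (D X)]
        abel }
  have hm : D' ∈ (LieDerivation.ad ℝ 𝔤).range := by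
    rw [LieDerivation.IsKilling.range_ad_eq_top]
    trivial
  obtain ⟨Z, hZ⟩ := hm
  refine ⟨Z, LinearMap.ext fun Y => ?_⟩
  have := congrArg (fun D : LieDerivation ℝ 𝔤 𝔤 => D Y) hZ
  simpa [D'] using this

/-- A symmetric derivation is `ad Z` with `θZ = -Z`. -/
theorem exists_ad_eq_of_symmetric_derivation (D : 𝔤 →ₗ[ℝ] 𝔤)
    (hD : ∀ X Y, D ⁅X, Y⁆ = ⁅D X, Y⁆ + ⁅X, D Y⁆) (hs : ∀ X Y, S.ip (D X) Y = S.ip X (D Y)) :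
    ∃ Z : 𝔤, S.θ Z = -Z ∧ LieAlgebra.ad ℝ 𝔤 Z = D := by
  obtain ⟨Z, hZ⟩ := S.exists_ad_eq_of_derivation D hD
  refine ⟨Z, S.ad_injective (LinearMap.ext fun Y => S.ip_ext fun X => ?_), hZ⟩
  have := S.ip_lie_left Z X Y
  have h2 := hs X Y
  rw [← hZ] at h2
  simp only [LieAlgebra.ad_apply] at h2
  rw [LieAlgebra.ad_apply, map_neg, LinearMap.neg_apply, LieAlgebra.ad_apply, map_neg, ← h2, this,
    neg_neg]

/-! ### An orthonormal basis adapted to `𝔞` -/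

/-- As θ is -1 on 𝔞, ad 𝔞 is a commuting family of symmetric operators. The order by decreasing
degree makes operators that raise the degree upper triangular. -/
theorem exists_adapted_basis : ∃ (n : ℕ) (e : Module.Basis (Fin n) ℝ 𝔤)
    (w : Fin n → Module.Dual ℝ S.𝔞), (∀ i j, S.ip (e i) (e j) = if i = j then 1 else 0) ∧
      (∀ i (H : S.𝔞), ⁅(H : 𝔤), e i⁆ = w i H • e i) ∧ Antitone fun i => w i S.H₀ := by
  obtain ⟨n, e, w, ho, hw⟩ := exists_orthonormal_joint_eigenbasis S.ip S.ip_symm S.ip_pos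
    (fun H : S.𝔞 => LieAlgebra.ad ℝ 𝔤 (H : 𝔤))
    (fun H X Y => by
      rw [LieAlgebra.ad_apply, LieAlgebra.ad_apply, S.ip_lie_left, S.𝔞_le _ H.2, neg_lie, map_neg,
        neg_neg])
    (fun H H' X => by
      simp only [LieAlgebra.ad_apply]
      rw [leibniz_lie (H : 𝔤) (H' : 𝔤) X, S.𝔞_abelian _ H.2 _ H'.2]
      simp)
  have hw' : ∀ i (H : S.𝔞), w i H = S.ip (e i) ⁅(H : 𝔤), e i⁆ := by
    intro i H
    have := hw i H
    rw [LieAlgebra.ad_apply] at this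
    rw [this, map_smul, ho]
    simp
  let w' : Fin n → Module.Dual ℝ S.𝔞 := fun i =>
    { toFun := w i
      map_add' := fun H H' => by simp [hw']
      map_smul' := fun c H => by simp [hw'] }
  let σ : Equiv.Perm (Fin n) := Tuple.sort fun i => -w i S.H₀
  refine ⟨n, e.reindex σ.symm, fun i => w' (σ i), fun i j => ?_, fun i H => ?_, fun i j hij => ?_⟩
  · simp [ho]
  · simpa [w'] using hw (σ i) H
  · have := Tuple.monotone_sort (fun i => -w i S.H₀) hij
    simpa [w', σ] using this

/-- The dimension of `𝔤`. -/
def dim : ℕ := S.exists_adapted_basis.choose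

/-- An orthonormal basis of joint eigenvectors of `ad 𝔞`, in the order of decreasing
`H₀`-eigenvalues. -/
def basis : Module.Basis (Fin S.dim) ℝ 𝔤 := S.exists_adapted_basis.choose_spec.choose

/-- The weights of the adapted basis. -/
def wt : Fin S.dim → Module.Dual ℝ S.𝔞 := S.exists_adapted_basis.choose_spec.choose_spec.choose

/-- The `H₀`-eigenvalues of the adapted basis. -/
def deg (i : Fin S.dim) : ℝ := S.wt i S.H₀

theorem ip_basis (i j : Fin S.dim) : S.ip (S.basis i) (S.basis j) = if i = j then 1 else 0 :=
  S.exists_adapted_basis.choose_spec.choose_spec.choose_spec.1 i j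

theorem lie_basis (H : S.𝔞) (i : Fin S.dim) : ⁅(H : 𝔤), S.basis i⁆ = S.wt i H • S.basis i :=
  S.exists_adapted_basis.choose_spec.choose_spec.choose_spec.2.1 i H

theorem antitone_deg : Antitone S.deg := S.exists_adapted_basis.choose_spec.choose_spec.choose_spec.2.2

theorem lt_of_deg_lt {i j : Fin S.dim} (h : S.deg i < S.deg j) : j < i := by
  by_contra hle
  exact absurd (S.antitone_deg (not_lt.mp hle)) (not_le.mpr h)

theorem lie_H₀_basis (i : Fin S.dim) : ⁅(S.H₀ : 𝔤), S.basis i⁆ = S.deg i • S.basis i :=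
  S.lie_basis S.H₀ i

theorem basis_repr (X : 𝔤) (i : Fin S.dim) : S.basis.repr X i = S.ip (S.basis i) X := by
  conv_rhs => rw [← S.basis.sum_repr X]
  simp only [map_sum, map_smul, ip_basis]
  simp

theorem sum_ip_basis (X : 𝔤) : ∑ i, S.ip (S.basis i) X • S.basis i = X := by
  simp_rw [← S.basis_repr]
  exact S.basis.sum_repr X

/-- Regularity of `H₀`: no restricted root vanishes on it. -/
theorem wt_eq_zero_of_deg_eq_zero {i : Fin S.dim} (h : S.deg i = 0) : S.wt i = 0 := by
  by_contra hne
  refine S.H₀_regular (S.wt i) ⟨hne, fun hbot => ?_⟩ h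
  have hm : S.basis i ∈ rootSpace S.𝔞 (S.wt i) := fun H => S.lie_basis H i
  rw [hbot, Submodule.mem_bot] at hm
  exact S.basis.ne_zero i hm

theorem symm_lie {H : 𝔤} (hH : S.θ H = -H) (X Y : 𝔤) : S.ip ⁅H, X⁆ Y = S.ip X ⁅H, Y⁆ := by
  rw [ip_lie_left, hH, neg_lie, map_neg, neg_neg]

theorem ip_basis_lie_a (H : S.𝔞) (X : 𝔤) (i : Fin S.dim) :
    S.ip (S.basis i) ⁅(H : 𝔤), X⁆ = S.wt i H * S.ip (S.basis i) X := by
  rw [← S.symm_lie (S.𝔞_le _ H.2), lie_basis, map_smul, LinearMap.smul_apply, smul_eq_mul]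

/-! ### Coordinates and exponentials -/

/-- The Euclidean space of coordinates. -/
abbrev Euc : Type := EuclideanSpace ℝ (Fin S.dim)

/-- The standard orthonormal basis of the space of coordinates. -/
abbrev ob : OrthonormalBasis (Fin S.dim) ℝ S.Euc := EuclideanSpace.basisFun (Fin S.dim) ℝ

/-- Coordinates with respect to the adapted basis. -/
def coord : 𝔤 ≃ₗ[ℝ] S.Euc := S.basis.equivFun ≪≫ₗ (WithLp.linearEquiv 2 ℝ (Fin S.dim → ℝ)).symm

theorem coord_apply (X : 𝔤) (i : Fin S.dim) : S.coord X i = S.ip (S.basis i) X := by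
  rw [← basis_repr]
  rfl

theorem coord_basis (i : Fin S.dim) : S.coord (S.basis i) = S.ob i := by
  ext j
  rw [coord_apply, ip_basis]
  simp [PiLp.single_apply]

theorem inner_coord (X Y : 𝔤) : inner ℝ (S.coord X) (S.coord Y) = S.ip X Y := by
  rw [PiLp.inner_apply]
  conv_rhs => rw [← S.sum_ip_basis X]
  simp only [coord_apply, map_sum, map_smul, LinearMap.sum_apply, LinearMap.smul_apply, smul_eq_mul]
  exact Finset.sum_congr rfl fun i _ => by simp [mul_comm]

theorem continuous_coord : Continuous S.coord :=
  LinearMap.continuous_of_finiteDimensional S.coord.toLinearMap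

theorem continuous_coord_symm : Continuous S.coord.symm :=
  LinearMap.continuous_of_finiteDimensional S.coord.symm.toLinearMap

/-- Linear maps in coordinates. -/
def rep : Module.End ℝ 𝔤 →ₐ[ℝ] (S.Euc →L[ℝ] S.Euc) :=
  (Module.End.toContinuousLinearMap S.Euc).toAlgHom.comp (S.coord.conjAlgEquiv ℝ).toAlgHom

theorem rep_apply (T : Module.End ℝ 𝔤) (x : S.Euc) : S.rep T x = S.coord (T (S.coord.symm x)) := rfl

theorem rep_coord (T : Module.End ℝ 𝔤) (X : 𝔤) : S.rep T (S.coord X) = S.coord (T X) := by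
  rw [rep_apply, LinearEquiv.symm_apply_apply]

theorem rep_injective : Function.Injective S.rep := fun T T' h => LinearMap.ext fun X => by
  have := congrArg (fun A : S.Euc →L[ℝ] S.Euc => A (S.coord X)) h
  simpa [rep_coord] using this

theorem ext_coord {T T' : S.Euc →L[ℝ] S.Euc} (h : ∀ X, T (S.coord X) = T' (S.coord X)) : T = T' :=
  ContinuousLinearMap.ext fun x => by simpa using h (S.coord.symm x)

/-- The elements of `G` in coordinates. -/
def repG : S.G →* (S.Euc →L[ℝ] S.Euc) where
  toFun g := S.rep (g.1 : 𝔤 →ₗ[ℝ] 𝔤)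
  map_one' := S.rep.map_one
  map_mul' g h := S.rep.map_mul (g.1 : 𝔤 →ₗ[ℝ] 𝔤) (h.1 : 𝔤 →ₗ[ℝ] 𝔤)

theorem repG_coord (g : S.G) (X : 𝔤) : S.repG g (S.coord X) = S.coord (g.1 X) :=
  S.rep_coord _ X

theorem repG_injective : Function.Injective S.repG := fun g h hgh => by
  have := S.rep_injective hgh
  exact Subtype.ext (LinearEquiv.ext fun X => LinearMap.congr_fun this X)

theorem isUnit_repG (g : S.G) : IsUnit (S.repG g) := (Group.isUnit g).map S.repG

/-- The adjoint representation in coordinates. -/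
def adE : 𝔤 →ₗ[ℝ] (S.Euc →L[ℝ] S.Euc) := S.rep.toLinearMap ∘ₗ (LieAlgebra.ad ℝ 𝔤 : 𝔤 →ₗ[ℝ] Module.End ℝ 𝔤)

theorem adE_coord (X Y : 𝔤) : S.adE X (S.coord Y) = S.coord ⁅X, Y⁆ := S.rep_coord _ Y

theorem adE_injective : Function.Injective S.adE := fun _ _ h => S.ad_injective (S.rep_injective h)

theorem coeff_adE (X : 𝔤) (j i : Fin S.dim) :
    coeff S.ob (S.adE X) j i = S.ip (S.basis j) ⁅X, S.basis i⁆ := by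
  rw [coeff, ← coord_basis, ← coord_basis, adE_coord, inner_coord]

theorem adE_pow_coord (X Y : 𝔤) (n : ℕ) :
    (S.adE X ^ n) (S.coord Y) = S.coord ((LieAlgebra.ad ℝ 𝔤 X ^ n) Y) := by
  change (S.rep (LieAlgebra.ad ℝ 𝔤 X) ^ n) _ = _
  rw [← map_pow, rep_coord]

/-- The space 𝔤 has only a vector space topology. Coordinates turn the pointwise series into the
exponential of a normed algebra. -/
theorem isExpAd_iff (X : 𝔤) (g : 𝔤 ≃ₗ[ℝ] 𝔤) :
    IsExpAd X g ↔ S.rep (g : 𝔤 →ₗ[ℝ] 𝔤) = NormedSpace.exp (S.adE X) := by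
  have key : ∀ Y, HasSum (fun n : ℕ => ((n ! : ℝ)⁻¹) • ((LieAlgebra.ad ℝ 𝔤 X) ^ n) Y)
      (S.coord.symm (NormedSpace.exp (S.adE X) (S.coord Y))) := by
    intro Y
    have := (exp_clm_hasSum (S.adE X) (S.coord Y)).mapL
      (⟨S.coord.symm.toLinearMap, S.continuous_coord_symm⟩ : S.Euc →L[ℝ] 𝔤)
    refine (hasSum_congr_of_eq fun n => ?_).mpr this
    rw [adE_pow_coord, ← map_smul S.coord]
    exact (S.coord.symm_apply_apply _).symm
  constructor
  · intro h
    refine S.ext_coord fun Y => ?_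
    have := (h Y).unique (key Y)
    rw [rep_coord]
    change S.coord (g Y) = _
    rw [this, LinearEquiv.apply_symm_apply]
  · intro h Y
    have := key Y
    rw [← h, rep_coord, LinearEquiv.symm_apply_apply] at this
    exact this

/-- The inner automorphism `exp (ad X)`. -/
def expLin (X : 𝔤) : 𝔤 ≃ₗ[ℝ] 𝔤 :=
  LinearEquiv.ofLinearMap
    (S.coord.symm.toLinearMap ∘ₗ (NormedSpace.exp (S.adE X) : S.Euc →L[ℝ] S.Euc).toLinearMap ∘ₗ
      S.coord.toLinearMap)
    (S.coord.symm.toLinearMap ∘ₗ (NormedSpace.exp (-S.adE X) : S.Euc →L[ℝ] S.Euc).toLinearMap ∘ₗ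
      S.coord.toLinearMap)
    (LinearMap.ext fun Y => by
      simp only [LinearMap.comp_apply, LinearEquiv.coe_coe, LinearEquiv.apply_symm_apply,
        ContinuousLinearMap.coe_coe, LinearMap.id_apply]
      rw [← mul_apply_eq_comp, exp_clm_mul_neg]
      simp)
    (LinearMap.ext fun Y => by
      simp only [LinearMap.comp_apply, LinearEquiv.coe_coe, LinearEquiv.apply_symm_apply,
        ContinuousLinearMap.coe_coe, LinearMap.id_apply]
      rw [← mul_apply_eq_comp, exp_clm_neg_mul]
      simp)

theorem isExpAd_expLin (X : 𝔤) : IsExpAd X (S.expLin X) := by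
  rw [S.isExpAd_iff]
  refine S.ext_coord fun Y => ?_
  rw [rep_coord]
  simp [expLin]

/-- `exp (ad X)` as an element of `G`. -/
def expG (X : 𝔤) : S.G := ⟨S.expLin X, S.inner_mem_G X _ (S.isExpAd_expLin X)⟩

theorem repG_expG (X : 𝔤) : S.repG (S.expG X) = NormedSpace.exp (S.adE X) :=
  (S.isExpAd_iff X _).mp (S.isExpAd_expLin X)

theorem isExpAd_iff_eq {X : 𝔤} {g : S.G} : IsExpAd X (g : 𝔤 ≃ₗ[ℝ] 𝔤) ↔ g = S.expG X := by
  rw [S.isExpAd_iff, ← repG_expG]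
  exact ⟨fun h => S.repG_injective h, fun h => h ▸ rfl⟩

theorem adE_commute {X Y : 𝔤} (h : ⁅X, Y⁆ = 0) : Commute (S.adE X) (S.adE Y) := by
  refine S.ext_coord fun Z => ?_
  rw [mul_apply_eq_comp, mul_apply_eq_comp, adE_coord, adE_coord, adE_coord, adE_coord, leibniz_lie,
    h, zero_lie, zero_add]

theorem expG_add {X Y : 𝔤} (h : ⁅X, Y⁆ = 0) : S.expG (X + Y) = S.expG X * S.expG Y := by
  refine S.repG_injective ?_
  rw [map_mul, repG_expG, repG_expG, repG_expG, map_add, exp_clm_add (S.adE_commute h)]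

theorem expG_zero : S.expG 0 = 1 := by
  refine S.repG_injective ?_
  rw [repG_expG, map_zero, NormedSpace.exp_zero, map_one]

theorem expG_neg (X : 𝔤) : S.expG (-X) = (S.expG X)⁻¹ := by
  rw [eq_inv_iff_mul_eq_one, ← S.expG_add (by simp), neg_add_cancel, expG_zero]

theorem expG_add_smul (X : 𝔤) (s t : ℝ) : S.expG ((s + t) • X) = S.expG (s • X) * S.expG (t • X) := by
  rw [add_smul, S.expG_add (by simp)]

theorem conj_expG (g : S.G) (X : 𝔤) : g * S.expG X * g⁻¹ = S.expG (g.1 X) := by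
  refine S.isExpAd_iff_eq.mp fun Y => ?_
  have h := (S.isExpAd_expLin X (g⁻¹.1 Y)).mapL
    (⟨(g.1 : 𝔤 →ₗ[ℝ] 𝔤), LinearMap.continuous_of_finiteDimensional _⟩ : 𝔤 →L[ℝ] 𝔤)
  have hp : ∀ n : ℕ, (LieAlgebra.ad ℝ 𝔤 (g.1 X) ^ n) Y =
      g.1 ((LieAlgebra.ad ℝ 𝔤 X ^ n) (g⁻¹.1 Y)) := by
    intro n
    induction n with
    | zero => exact (g.1.apply_symm_apply Y).symm
    | succ n ih => rw [pow_succ', pow_succ', Module.End.mul_apply, Module.End.mul_apply, ih,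
        LieAlgebra.ad_apply, LieAlgebra.ad_apply, S.G_automorphism g.1 g.2]
  refine (hasSum_congr_of_eq fun n => ?_).mpr h
  rw [hp]
  exact (map_smul g.1 _ _).symm

theorem isSymmetric_adE {X : 𝔤} (hX : S.θ X = -X) : (S.adE X : S.Euc →ₗ[ℝ] S.Euc).IsSymmetric := by
  intro x y
  obtain ⟨Y, rfl⟩ := S.coord.surjective x
  obtain ⟨Z, rfl⟩ := S.coord.surjective y
  change inner ℝ (S.adE X (S.coord Y)) (S.coord Z) = inner ℝ (S.coord Y) (S.adE X (S.coord Z))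
  rw [adE_coord, adE_coord, inner_coord, inner_coord, S.symm_lie hX]

theorem expG_injOn {X Y : 𝔤} (hX : S.θ X = -X) (hY : S.θ Y = -Y) (h : S.expG X = S.expG Y) :
    X = Y := by
  refine S.adE_injective (exp_injOn_isSymmetric (S.isSymmetric_adE hX) (S.isSymmetric_adE hY) ?_)
  rw [← repG_expG, ← repG_expG, h]

/-- If `θZ = -Z` and `exp (ad Z)` fixes `X`, then `[Z, X] = 0`. -/
theorem lie_eq_zero_of_expG_apply_eq {Z X : 𝔤} (hZ : S.θ Z = -Z) (h : (S.expG Z).1 X = X) :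
    ⁅Z, X⁆ = 0 := by
  have h1 : NormedSpace.exp (S.adE Z) (S.coord X) = Real.exp 0 • S.coord X := by
    rw [← repG_expG, repG_coord, h, Real.exp_zero, one_smul]
  have h2 := apply_eq_of_exp_apply_eq (S.isSymmetric_adE hZ) h1
  rw [adE_coord, zero_smul] at h2
  exact S.coord.map_eq_zero_iff.mp h2

theorem theta_expG_apply (X Y : 𝔤) : S.θ ((S.expG X).1 Y) = (S.expG (S.θ X)).1 (S.θ Y) := by
  have h := (S.isExpAd_expLin X Y).mapL
    (⟨S.θ.toLinearMap, LinearMap.continuous_of_finiteDimensional _⟩ : 𝔤 →L[ℝ] 𝔤)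
  have hp : ∀ n : ℕ, (LieAlgebra.ad ℝ 𝔤 (S.θ X) ^ n) (S.θ Y) = S.θ ((LieAlgebra.ad ℝ 𝔤 X ^ n) Y) := by
    intro n
    induction n with
    | zero => rfl
    | succ n ih => rw [pow_succ', pow_succ', Module.End.mul_apply, Module.End.mul_apply, ih,
        LieAlgebra.ad_apply, LieAlgebra.ad_apply, LieHom.map_lie]
  refine h.unique ((hasSum_congr_of_eq fun n => ?_).mp (S.isExpAd_expLin (S.θ X) (S.θ Y)))
  rw [hp]
  exact (map_smul S.θ.toLinearMap _ _).symm

/-! ### The group `K` and the polar decomposition -/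

theorem ip_K {k : S.G} (hk : k ∈ S.K) (X Y : 𝔤) : S.ip (k.1 X) (k.1 Y) = S.ip X Y := by
  rw [ip_apply, ip_apply, ← hk, S.killingForm_smul]

/-- The adjoint of `g` is θ g⁻¹ θ, so an orthogonal element of `G` commutes with θ. -/
theorem mem_K_of_ip {g : S.G} (hg : ∀ X Y, S.ip (g.1 X) (g.1 Y) = S.ip X Y) : g ∈ S.K := by
  intro X
  obtain ⟨Y, rfl⟩ : ∃ Y, S.θ (g⁻¹.1 (S.θ Y)) = X :=
    ⟨S.θ (g.1 (S.θ X)), by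
      rw [S.θ_involutive]
      exact (congrArg S.θ (g.1.symm_apply_apply _)).trans (S.θ_involutive X)⟩
  have h1 : g.1 (S.θ (g⁻¹.1 (S.θ Y))) = Y := by
    refine S.ip_ext fun Z => ?_
    obtain ⟨W, rfl⟩ := g.1.surjective Z
    rw [hg, ← S.ip_smul_left]
  rw [h1, S.θ_involutive]
  exact g.1.apply_symm_apply _

theorem inner_repG_K {k : S.G} (hk : k ∈ S.K) (x y : S.Euc) :
    inner ℝ (S.repG k x) (S.repG k y) = inner ℝ x y := by
  obtain ⟨X, rfl⟩ := S.coord.surjective x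
  obtain ⟨Y, rfl⟩ := S.coord.surjective y
  rw [repG_coord, repG_coord, inner_coord, inner_coord, S.ip_K hk]

theorem expG_mem_K {X : 𝔤} (hX : S.θ X = X) : S.expG X ∈ S.K := by
  intro Y
  rw [S.theta_expG_apply, hX]

theorem theta_smul_K {k : S.G} (hk : k ∈ S.K) {X : 𝔤} (hX : S.θ X = -X) :
    S.θ (k.1 X) = -k.1 X := by
  rw [← hk, hX, map_neg]

/-- The polar decomposition: `G = K exp 𝔭`. -/
theorem exists_polar (g : S.G) : ∃ k ∈ S.K, ∃ X : 𝔤, S.θ X = -X ∧ g = k * S.expG X := by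
  -- This is g*g, a positive symmetric automorphism; half of its logarithm will be `ad X`.
  let p : 𝔤 →ₗ[ℝ] 𝔤 := S.θ.toLinearMap ∘ₗ (g⁻¹.1 : 𝔤 →ₗ[ℝ] 𝔤) ∘ₗ S.θ.toLinearMap ∘ₗ
    (g.1 : 𝔤 →ₗ[ℝ] 𝔤)
  have hp : ∀ X Y, S.ip X (p Y) = S.ip (g.1 X) (g.1 Y) := fun X Y => (S.ip_smul_left g X _).symm
  have hps : ∀ X Y, S.ip (p X) Y = S.ip X (p Y) := fun X Y => by
    rw [S.ip_symm, hp, hp, S.ip_symm]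
  have hpl : ∀ X Y, p ⁅X, Y⁆ = ⁅p X, p Y⁆ := fun X Y => by
    change S.θ (g⁻¹.1 (S.θ (g.1 ⁅X, Y⁆))) = _
    rw [S.G_automorphism g.1 g.2, LieHom.map_lie, S.G_automorphism g⁻¹.1 g⁻¹.2, LieHom.map_lie]
    rfl
  obtain ⟨n, f, c, ho, hc⟩ := exists_orthonormal_joint_eigenbasis S.ip S.ip_symm S.ip_pos
    (fun _ : Unit => p) (fun _ => hps) (fun _ _ _ => rfl)
  have hf : ∀ i, p (f i) = c i () • f i := fun i => hc i ()
  have hcpos : ∀ i, 0 < c i () := by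
    intro i
    have h1 : S.ip (f i) (p (f i)) = c i () := by rw [hf, map_smul, ho]; simp
    rw [← h1, hp]
    exact S.ip_pos _ fun h => f.ne_zero i (g.1.map_eq_zero_iff.mp h)
  let D : 𝔤 →ₗ[ℝ] 𝔤 := f.constr ℝ fun i => (Real.log (c i ()) / 2) • f i
  have hDf : ∀ i, D (f i) = (Real.log (c i ()) / 2) • f i := fun i => f.constr_basis ℝ _ i
  have hDe : ∀ (a : ℝ) (v : 𝔤), p v = a • v → D v = (Real.log a / 2) • v := fun a v h =>
    apply_eq_of_diagonal f p D (fun i => c i ()) (fun a => Real.log a / 2) hf hDf h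
  have hDder : ∀ X Y, D ⁅X, Y⁆ = ⁅D X, Y⁆ + ⁅X, D Y⁆ := by
    intro X Y
    have key : ∀ i j, D ⁅f i, f j⁆ = ⁅D (f i), f j⁆ + ⁅f i, D (f j)⁆ := by
      intro i j
      -- Multiplicativity of eigenvalues under the bracket becomes the Leibniz rule after taking
      -- logarithms.
      have : p ⁅f i, f j⁆ = (c i () * c j ()) • ⁅f i, f j⁆ := by
        rw [hpl, hf, hf, smul_lie, lie_smul, smul_smul]
      rw [hDe _ _ this, hDf, hDf, smul_lie, lie_smul, ← add_smul,
        Real.log_mul (hcpos i).ne' (hcpos j).ne', add_div]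
    rw [← f.sum_repr X, ← f.sum_repr Y]
    simp only [map_sum, sum_lie, lie_sum, smul_lie, lie_smul, map_smul, key, smul_add,
      Finset.sum_add_distrib]
  have hDs : ∀ X Y, S.ip (D X) Y = S.ip X (D Y) := by
    intro X Y
    have key : ∀ i j, S.ip (D (f i)) (f j) = S.ip (f i) (D (f j)) := by
      intro i j
      rw [hDf, hDf, map_smul, map_smul, LinearMap.smul_apply, ho]
      by_cases h : i = j
      · rw [h]
      · simp [h]
    rw [← f.sum_repr X, ← f.sum_repr Y]
    simp only [map_sum, LinearMap.sum_apply, map_smul, LinearMap.smul_apply, key]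
  obtain ⟨X, hX, hXD⟩ := S.exists_ad_eq_of_symmetric_derivation D hDder hDs
  have hadf : ∀ i, S.adE X (S.coord (f i)) = (Real.log (c i ()) / 2) • S.coord (f i) := by
    intro i
    rw [adE_coord, ← map_smul, ← hDf, ← hXD, LieAlgebra.ad_apply]
  have hexp : ∀ Y, p Y = (S.expG X).1 ((S.expG X).1 Y) := by
    intro Y
    have : p = ((S.expG X * S.expG X).1 : 𝔤 →ₗ[ℝ] 𝔤) := by
      refine f.ext fun i => S.coord.injective ?_
      have h2 : S.coord ((S.expG X * S.expG X).1 (f i)) = S.coord (p (f i)) := by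
        rw [← repG_coord, map_mul, repG_expG, mul_apply_eq_comp,
          exp_clm_apply_eigenvector (hadf i), map_smul, exp_clm_apply_eigenvector (hadf i), smul_smul,
          ← Real.exp_add, add_halves, Real.exp_log (hcpos i), hf, map_smul]
      exact h2.symm
    rw [this]
    rfl
  -- The quotient is orthogonal because g*g = exp(2 ad X) and exp(ad X) is symmetric.
  refine ⟨g * (S.expG X)⁻¹, S.mem_K_of_ip fun Y Z => ?_, X, hX, by group⟩
  obtain ⟨Y, rfl⟩ := (S.expG X).1.surjective Y
  obtain ⟨Z, rfl⟩ := (S.expG X).1.surjective Z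
  have hcancel : ∀ Y, (g * (S.expG X)⁻¹).1 ((S.expG X).1 Y) = g.1 Y := fun Y =>
    congrArg g.1 ((S.expG X).1.symm_apply_apply Y)
  have hsym : ∀ Y Z, S.ip ((S.expG X).1 Y) Z = S.ip Y ((S.expG X).1 Z) := by
    intro Y Z
    rw [S.ip_smul_left, ← S.expG_neg, S.theta_expG_apply, S.θ_involutive, map_neg, hX, neg_neg]
  rw [hcancel, hcancel, ← hp, hexp, ← hsym]

/-- Uniqueness in the polar decomposition. -/
theorem polar_unique {k k' : S.G} (hk : k ∈ S.K) (hk' : k' ∈ S.K) {X X' : 𝔤} (hX : S.θ X = -X)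
    (hX' : S.θ X' = -X') (h : k * S.expG X = k' * S.expG X') : X = X' := by
  have hm : S.expG X * S.expG (-X') ∈ S.K := by
    have : S.expG X * S.expG (-X') = k⁻¹ * k' := by
      rw [expG_neg, eq_inv_mul_iff_mul_eq, ← mul_assoc, h, mul_inv_cancel_right]
    rw [this]
    exact S.K.mul_mem (S.K.inv_mem hk) hk'
  -- An element of `K` is unchanged by conjugation with θ, which turns exp X exp(-X') into exp(-X)
  -- exp X'.
  have hsq : S.expG (X + X) = S.expG (X' + X') := by
    rw [S.expG_add (by simp), S.expG_add (by simp)]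
    have h1 : S.expG X * S.expG (-X') = S.expG (-X) * S.expG X' := by
      refine Subtype.ext (LinearEquiv.ext fun Y => ?_)
      obtain ⟨Z, rfl⟩ : ∃ Z, S.θ Z = Y := ⟨S.θ Y, S.θ_involutive Y⟩
      refine (hm Z).trans ?_
      change S.θ ((S.expG X).1 ((S.expG (-X')).1 Z)) = (S.expG (-X)).1 ((S.expG X').1 (S.θ Z))
      rw [theta_expG_apply, theta_expG_apply, map_neg, hX, hX', neg_neg]
    rw [expG_neg, expG_neg, mul_inv_eq_iff_eq_mul, mul_assoc, eq_inv_mul_iff_mul_eq] at h1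
    exact h1
  have := S.expG_injOn (by rw [map_add, hX, neg_add]) (by rw [map_add, hX', neg_add]) hsq
  have h2 : (2 : ℝ) • X = (2 : ℝ) • X' := by rw [two_smul, two_smul, this]
  exact smul_right_injective 𝔤 (two_ne_zero (α := ℝ)) h2

/-! ### Geodesic midpoints -/

theorem pt_eq_pt {g h : S.G} : S.pt g = S.pt h ↔ g⁻¹ * h ∈ S.K := QuotientGroup.eq

theorem pt_mul_K (g : S.G) {k : S.G} (hk : k ∈ S.K) : S.pt (g * k) = S.pt g := by
  rw [pt_eq_pt]
  simpa using hk

theorem exists_pt_eq (x : S.Omega) : ∃ g, S.pt g = x := QuotientGroup.mk_surjective x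

theorem smul_pt (g h : S.G) : g • S.pt h = S.pt (g * h) := rfl

theorem mul_expG (g : S.G) (X : 𝔤) : g * S.expG X = S.expG (g.1 X) * g := by
  rw [← S.conj_expG, inv_mul_cancel_right]

/-- With k = exp(-X) exp Y in `K` one has exp Y = k exp(k⁻¹X), and polar uniqueness gives Y = k⁻¹X
and then k = 1. -/
theorem expG_pt_injective {X Y : 𝔤} (hX : S.θ X = -X) (hY : S.θ Y = -Y)
    (h : S.pt (S.expG X) = S.pt (S.expG Y)) : X = Y := by
  rw [pt_eq_pt] at h
  set k := (S.expG X)⁻¹ * S.expG Y with hk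
  have h1 : S.expG Y = k * S.expG (k⁻¹.1 X) := by
    rw [mul_expG]
    change _ = S.expG (k.1 (k.1.symm X)) * k
    rw [LinearEquiv.apply_symm_apply, hk, mul_inv_cancel_left]
  have h2 := S.polar_unique S.K.one_mem h hY (S.theta_smul_K (S.K.inv_mem h) hX)
    ((one_mul _).trans h1)
  rw [h2] at h1
  have h3 : k = 1 := by simpa using h1.symm
  rw [h2, h3]
  exact inv_one (G := S.G) ▸ rfl

theorem isMidpoint_iff {x y m : S.Omega} : S.IsMidpoint x y m ↔ ∃ (g : S.G) (X : 𝔤), S.θ X = -X ∧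
    x = S.pt g ∧ m = S.pt (g * S.expG ((1 / 2 : ℝ) • X)) ∧ y = S.pt (g * S.expG X) := by
  constructor
  · rintro ⟨g, h, h', X, hX, hh, hh', hx, hm, hy⟩
    rw [S.isExpAd_iff_eq] at hh hh'
    subst hh hh'
    exact ⟨g, X, hX, hx, hm, hy⟩
  · rintro ⟨g, X, hX, hx, hm, hy⟩
    exact ⟨g, _, _, X, hX, S.isExpAd_iff_eq.mpr rfl, S.isExpAd_iff_eq.mpr rfl, hx, hm, hy⟩

theorem exists_isMidpoint (x y : S.Omega) : ∃ m, S.IsMidpoint x y m := by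
  obtain ⟨g, rfl⟩ := S.exists_pt_eq x
  obtain ⟨h, rfl⟩ := S.exists_pt_eq y
  obtain ⟨k, hk, X, hX, hg⟩ := S.exists_polar (h⁻¹ * g)
  refine ⟨_, S.isMidpoint_iff.mpr ⟨g, -X, by rw [map_neg, hX], rfl, rfl, ?_⟩⟩
  rw [pt_eq_pt, ← mul_assoc, hg, expG_neg, mul_inv_cancel_right]
  exact hk

/-- Two base points over `x` differ by an element of `K`, which must carry one initial vector to the
other since 𝔭 → Ω is injective. Uniqueness is what makes the chosen midpoint equivariant. -/
theorem IsMidpoint.unique {x y m m' : S.Omega} (h : S.IsMidpoint x y m)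
    (h' : S.IsMidpoint x y m') : m = m' := by
  obtain ⟨g, X, hX, rfl, rfl, hy⟩ := S.isMidpoint_iff.mp h
  obtain ⟨g', X', hX', hg, rfl, hy'⟩ := S.isMidpoint_iff.mp h'
  have hk := S.pt_eq_pt.mp hg
  obtain ⟨k, rfl⟩ : ∃ k, g' = g * k := ⟨g⁻¹ * g', by group⟩
  rw [inv_mul_cancel_left] at hk
  have key : ∀ Z : 𝔤, S.pt (g * k * S.expG Z) = g • S.pt (S.expG (k.1 Z)) := fun Z => by
    rw [mul_assoc, mul_expG, ← mul_assoc, S.pt_mul_K _ hk, smul_pt]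
  rw [hy, key, ← smul_pt] at hy'
  have h1 := S.expG_pt_injective hX (S.theta_smul_K hk hX') (smul_left_cancel g hy')
  rw [key, map_smul, ← h1, smul_pt]

theorem IsMidpoint.smul {x y m : S.Omega} (h : S.IsMidpoint x y m) (g : S.G) :
    S.IsMidpoint (g • x) (g • y) (g • m) := by
  obtain ⟨g', X, hX, rfl, rfl, rfl⟩ := S.isMidpoint_iff.mp h
  exact S.isMidpoint_iff.mpr ⟨g * g', X, hX, rfl, by rw [smul_pt, mul_assoc],
    by rw [smul_pt, mul_assoc]⟩

theorem midpt_smul (g : S.G) (x y : S.Omega) : S.midpt (g • x) (g • y) = g • S.midpt x y :=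
  IsMidpoint.unique S (Classical.epsilon_spec (S.exists_isMidpoint _ _))
    (IsMidpoint.smul S (Classical.epsilon_spec (S.exists_isMidpoint x y)) g)

/-! ### The degree filtration -/

/-- `ad H₀` is a derivation, so degrees add under the bracket. -/
theorem ip_basis_lie_of_ne {j k l : Fin S.dim} (h : S.deg j ≠ S.deg k + S.deg l) :
    S.ip (S.basis j) ⁅S.basis k, S.basis l⁆ = 0 := by
  have h1 := S.ip_basis_lie_a S.H₀ ⁅S.basis k, S.basis l⁆ j
  rw [leibniz_lie, lie_H₀_basis, lie_H₀_basis, smul_lie, lie_smul, ← add_smul, map_smul,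
    smul_eq_mul] at h1
  change _ = S.deg j * _ at h1
  have h2 : (S.deg k + S.deg l - S.deg j) * S.ip (S.basis j) ⁅S.basis k, S.basis l⁆ = 0 := by
    linarith
  exact (mul_eq_zero.mp h2).resolve_left fun h0 => h (by linarith)

/-- θ maps `H₀` to `-H₀`, hence reverses degrees. -/
theorem ip_basis_theta_of_ne {j k : Fin S.dim} (h : S.deg j ≠ -S.deg k) :
    S.ip (S.basis j) (S.θ (S.basis k)) = 0 := by
  have h1 := S.ip_basis_lie_a S.H₀ (S.θ (S.basis k)) j
  have h2 : ⁅(S.H₀ : 𝔤), S.θ (S.basis k)⁆ = -(S.deg k • S.θ (S.basis k)) := by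
    rw [← S.θ_involutive (S.H₀ : 𝔤), ← LieHom.map_lie, S.𝔞_le _ S.H₀.2, neg_lie, lie_H₀_basis,
      map_neg, map_smul]
  rw [h2, map_neg, map_smul, smul_eq_mul] at h1
  change _ = S.deg j * _ at h1
  have h3 : (S.deg k + S.deg j) * S.ip (S.basis j) (S.θ (S.basis k)) = 0 := by linarith
  exact (mul_eq_zero.mp h3).resolve_left fun h0 => h (by linarith)

/-- The span of the basis vectors of degree at least `t`. -/
def filGe (t : ℝ) : Submodule ℝ 𝔤 where
  carrier := {X | ∀ j, S.deg j < t → S.ip (S.basis j) X = 0}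
  add_mem' := fun {X Y} hX hY j h => by rw [map_add, hX j h, hY j h, add_zero]
  zero_mem' := fun j _ => map_zero _
  smul_mem' := fun c X hX j h => by rw [map_smul, hX j h, smul_zero]

/-- The span of the basis vectors of degree larger than `t`. -/
def filGt (t : ℝ) : Submodule ℝ 𝔤 where
  carrier := {X | ∀ j, S.deg j ≤ t → S.ip (S.basis j) X = 0}
  add_mem' := fun {X Y} hX hY j h => by rw [map_add, hX j h, hY j h, add_zero]
  zero_mem' := fun j _ => map_zero _
  smul_mem' := fun c X hX j h => by rw [map_smul, hX j h, smul_zero]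

theorem basis_mem_filGe {i : Fin S.dim} {t : ℝ} (h : t ≤ S.deg i) : S.basis i ∈ S.filGe t := by
  intro j hj
  rw [ip_basis, if_neg]
  rintro rfl
  linarith

theorem filGt_mono {s t : ℝ} (h : s ≤ t) : S.filGt t ≤ S.filGt s :=
  fun _ hX j hj => hX j (by linarith)

theorem ip_basis_lie (j : Fin S.dim) (X Y : 𝔤) : S.ip (S.basis j) ⁅X, Y⁆ =
    ∑ k, ∑ l, S.ip (S.basis k) X * (S.ip (S.basis l) Y * S.ip (S.basis j) ⁅S.basis k, S.basis l⁆) := by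
  conv_lhs => rw [← S.sum_ip_basis X, ← S.sum_ip_basis Y]
  rw [sum_lie, map_sum]
  refine Finset.sum_congr rfl fun k _ => ?_
  rw [lie_sum, map_sum]
  refine Finset.sum_congr rfl fun l _ => ?_
  rw [smul_lie, lie_smul, map_smul, map_smul, smul_eq_mul, smul_eq_mul]

theorem lie_mem_filGe {s t : ℝ} {X Y : 𝔤} (hX : X ∈ S.filGe s) (hY : Y ∈ S.filGe t) :
    ⁅X, Y⁆ ∈ S.filGe (s + t) := by
  intro j hj
  rw [ip_basis_lie]
  refine Finset.sum_eq_zero fun k _ => Finset.sum_eq_zero fun l _ => ?_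
  by_cases hk : S.deg k < s
  · rw [hX k hk, zero_mul]
  · by_cases hl : S.deg l < t
    · rw [hY l hl, zero_mul, mul_zero]
    · rw [S.ip_basis_lie_of_ne (by linarith), mul_zero, mul_zero]

theorem lie_mem_filGt {s t : ℝ} {X Y : 𝔤} (hX : X ∈ S.filGe s) (hY : Y ∈ S.filGt t) :
    ⁅X, Y⁆ ∈ S.filGt (s + t) := by
  intro j hj
  rw [ip_basis_lie]
  refine Finset.sum_eq_zero fun k _ => Finset.sum_eq_zero fun l _ => ?_
  by_cases hk : S.deg k < s
  · rw [hX k hk, zero_mul]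
  · by_cases hl : S.deg l ≤ t
    · rw [hY l hl, zero_mul, mul_zero]
    · rw [S.ip_basis_lie_of_ne (by linarith), mul_zero, mul_zero]

theorem lie_mem_filGt_of_filGt {s t : ℝ} {X Y : 𝔤} (hX : X ∈ S.filGt s) (hY : Y ∈ S.filGe t) :
    ⁅X, Y⁆ ∈ S.filGt (s + t) := by
  rw [← lie_skew, add_comm]
  exact (S.filGt _).neg_mem (S.lie_mem_filGt hY hX)

theorem ip_basis_a_of_ne {j : Fin S.dim} (h : S.deg j ≠ 0) (H : S.𝔞) :
    S.ip (S.basis j) (H : 𝔤) = 0 := by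
  have h1 := S.ip_basis_lie_a S.H₀ (H : 𝔤) j
  rw [S.𝔞_abelian _ S.H₀.2 _ H.2, map_zero] at h1
  exact (mul_eq_zero.mp h1.symm).resolve_left h

/-! ### The groups `A`, `N`, `M` -/

/-- The Lie algebra of `N`. -/
def nil : Submodule ℝ 𝔤 := ⨆ α ∈ S.posRoots, rootSpace S.𝔞 α

theorem wt_mem_posRoots {i : Fin S.dim} (h : 0 < S.deg i) : S.wt i ∈ S.posRoots := by
  have hm : S.basis i ∈ rootSpace S.𝔞 (S.wt i) := fun H => S.lie_basis H i
  refine ⟨⟨fun h0 => ?_, fun hbot => ?_⟩, h⟩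
  · rw [deg, h0] at h
    exact h.false
  · rw [hbot, Submodule.mem_bot] at hm
    exact S.basis.ne_zero i hm

theorem basis_mem_nil {i : Fin S.dim} (h : 0 < S.deg i) : S.basis i ∈ S.nil :=
  Submodule.mem_iSup_of_mem _ (Submodule.mem_iSup_of_mem (S.wt_mem_posRoots h)
    fun H => S.lie_basis H i)

theorem ip_basis_of_mem_rootSpace {α : Module.Dual ℝ S.𝔞} {X : 𝔤} (hX : X ∈ rootSpace S.𝔞 α)
    {j : Fin S.dim} (h : S.wt j ≠ α) : S.ip (S.basis j) X = 0 := by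
  by_contra hne
  refine h (LinearMap.ext fun H => ?_)
  have h1 := S.ip_basis_lie_a H X j
  rw [hX H, map_smul, smul_eq_mul] at h1
  exact (mul_right_cancel₀ hne h1).symm

theorem nil_le_filGt : S.nil ≤ S.filGt 0 := by
  refine iSup₂_le fun α hα X hX j hj => S.ip_basis_of_mem_rootSpace hX ?_
  rintro rfl
  exact absurd hα.2 (not_lt.mpr hj)

theorem filGt_le_nil : S.filGt 0 ≤ S.nil := by
  intro X hX
  rw [← S.sum_ip_basis X]
  refine S.nil.sum_mem fun i _ => ?_
  by_cases h : S.deg i ≤ 0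
  · rw [hX i h, zero_smul]
    exact S.nil.zero_mem
  · exact S.nil.smul_mem _ (S.basis_mem_nil (not_le.mp h))

theorem adE_mem_strictRaise {X : 𝔤} (hX : X ∈ S.filGt 0) :
    S.adE X ∈ strictRaise S.ob S.deg := by
  intro i j hj
  rw [coeff_adE]
  have := S.lie_mem_filGt_of_filGt hX (S.basis_mem_filGe (le_refl (S.deg i)))
  exact this j (by linarith)

theorem expG_mem_N {X : 𝔤} (hX : X ∈ S.filGt 0) : S.expG X ∈ S.N :=
  Subgroup.subset_closure ⟨X, S.filGt_le_nil hX, S.isExpAd_expLin X⟩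

theorem repG_mem_unipotentRaise {n : S.G} (hn : n ∈ S.N) :
    S.repG n ∈ unipotentRaise S.ob S.deg := by
  -- The target is only a submonoid, so inverses are carried through the induction.
  suffices h : S.repG n ∈ unipotentRaise S.ob S.deg ∧ S.repG n⁻¹ ∈ unipotentRaise S.ob S.deg from h.1
  have key : ∀ X ∈ S.filGt 0, S.repG (S.expG X) ∈ unipotentRaise S.ob S.deg := fun X hX => by
    rw [repG_expG]
    exact exp_sub_one_mem_strictRaise (S.adE_mem_strictRaise hX)
  induction hn using Subgroup.closure_induction with
  | mem g hg =>
    obtain ⟨X, hX, hg⟩ := hg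
    rw [S.isExpAd_iff_eq] at hg
    rw [hg, ← expG_neg]
    have hX' := S.nil_le_filGt hX
    exact ⟨key X hX', key _ ((S.filGt 0).neg_mem hX')⟩
  | one => simp
  | mul g h _ _ hg hh =>
    rw [mul_inv_rev, map_mul, map_mul]
    exact ⟨Submonoid.mul_mem _ hg.1 hh.1, Submonoid.mul_mem _ hh.2 hg.2⟩
  | inv g _ hg => exact ⟨hg.2, by simpa using hg.1⟩

theorem mem_A_iff {a : S.G} : a ∈ S.A ↔ ∃ H : S.𝔞, a = S.expG H := by
  constructor
  · intro h
    induction h using Subgroup.closure_induction with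
    | mem g hg =>
      obtain ⟨H, hH, hg⟩ := hg
      exact ⟨⟨H, hH⟩, S.isExpAd_iff_eq.mp hg⟩
    | one => exact ⟨0, by simp [expG_zero]⟩
    | mul g h _ _ hg hh =>
      obtain ⟨H, rfl⟩ := hg
      obtain ⟨H', rfl⟩ := hh
      exact ⟨H + H', by rw [Submodule.coe_add, S.expG_add (S.𝔞_abelian _ H.2 _ H'.2)]⟩
    | inv g _ hg =>
      obtain ⟨H, rfl⟩ := hg
      exact ⟨-H, by rw [Submodule.coe_neg, expG_neg]⟩
  · rintro ⟨H, rfl⟩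
    exact Subgroup.subset_closure ⟨H, H.2, S.isExpAd_expLin _⟩

theorem expG_mem_A (H : S.𝔞) : S.expG H ∈ S.A := S.mem_A_iff.mpr ⟨H, rfl⟩

theorem M_apply {m : S.G} (hm : m ∈ S.M) (H : S.𝔞) : m.1 (H : 𝔤) = H := by
  have h := Subgroup.mem_centralizer_iff.mp hm.2 _ (S.expG_mem_A H)
  refine S.expG_injOn (S.theta_smul_K hm.1 (S.𝔞_le _ H.2)) (S.𝔞_le _ H.2) ?_
  rw [← conj_expG, ← h, mul_inv_cancel_right]

theorem mem_M_iff {m : S.G} : m ∈ S.M ↔ m ∈ S.K ∧ ∀ H : S.𝔞, m.1 (H : 𝔤) = H := by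
  refine ⟨fun h => ⟨h.1, S.M_apply h⟩, fun h => ⟨h.1, Subgroup.mem_centralizer_iff.mpr ?_⟩⟩
  intro a ha
  obtain ⟨H, rfl⟩ := S.mem_A_iff.mp ha
  rw [mul_expG, h.2]

/-- Elements that fix `𝔞` pointwise normalize `N`. -/
theorem conj_mem_N {m : S.G} (hm : ∀ H : S.𝔞, m.1 (H : 𝔤) = H) {n : S.G} (hn : n ∈ S.N) :
    m * n * m⁻¹ ∈ S.N := by
  have hroot : ∀ α X, X ∈ rootSpace S.𝔞 α → m.1 X ∈ rootSpace S.𝔞 α := by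
    intro α X hX H
    rw [← hm H, ← S.G_automorphism m.1 m.2, hX H, map_smul]
  have hnil : ∀ X ∈ S.nil, m.1 X ∈ S.nil := by
    have : S.nil ≤ S.nil.comap (m.1 : 𝔤 →ₗ[ℝ] 𝔤) := iSup₂_le fun α hα X hX =>
      Submodule.mem_iSup_of_mem α (Submodule.mem_iSup_of_mem hα (hroot α X hX))
    exact this
  induction hn using Subgroup.closure_induction with
  | mem g hg =>
    obtain ⟨X, hX, hg⟩ := hg
    rw [S.isExpAd_iff_eq] at hg
    rw [hg, conj_expG]
    exact Subgroup.subset_closure ⟨_, hnil X hX, S.isExpAd_expLin _⟩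
  | one => simp
  | mul g h _ _ hg hh =>
    have : m * (g * h) * m⁻¹ = (m * g * m⁻¹) * (m * h * m⁻¹) := by group
    rw [this]
    exact S.N.mul_mem hg hh
  | inv g _ hg =>
    have : m * g⁻¹ * m⁻¹ = (m * g * m⁻¹)⁻¹ := by group
    rw [this]
    exact S.N.inv_mem hg

theorem expG_a_apply (H H' : S.𝔞) : (S.expG H).1 (H' : 𝔤) = H' := by
  have h : S.adE H (S.coord H') = (0 : ℝ) • S.coord H' := by
    rw [adE_coord, S.𝔞_abelian _ H.2 _ H'.2, map_zero, zero_smul]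
  have h1 := exp_clm_apply_eigenvector h
  rw [← repG_expG, repG_coord, Real.exp_zero, one_smul] at h1
  exact S.coord.injective h1

/-- `M` commutes with `A`, and both fix 𝔞 pointwise and therefore normalize `N`; so the products
already form a subgroup. -/
theorem mem_MAN_iff {p : S.G} :
    p ∈ S.MAN ↔ ∃ m ∈ S.M, ∃ H : S.𝔞, ∃ n ∈ S.N, p = m * S.expG H * n := by
  constructor
  · intro h
    let P : Subgroup S.G :=
      { carrier := {p | ∃ m ∈ S.M, ∃ H : S.𝔞, ∃ n ∈ S.N, p = m * S.expG H * n}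
        one_mem' := ⟨1, S.M.one_mem, 0, 1, S.N.one_mem, by simp [expG_zero]⟩
        mul_mem' := by
          rintro _ _ ⟨m, hm, H, n, hn, rfl⟩ ⟨m', hm', H', n', hn', rfl⟩
          have hc : S.expG H * m' = m' * S.expG H :=
            Subgroup.mem_centralizer_iff.mp hm'.2 _ (S.expG_mem_A H)
          refine ⟨m * m', S.M.mul_mem hm hm', H + H',
            ((m' * S.expG H')⁻¹ * n * (m' * S.expG H')) * n', S.N.mul_mem ?_ hn', ?_⟩
          · have := S.conj_mem_N (m := (m' * S.expG H')⁻¹) (fun H'' => ?_) hn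
            · simpa using this
            · refine (LinearEquiv.symm_apply_eq _).mpr ?_
              change _ = m'.1 ((S.expG H').1 H'')
              rw [expG_a_apply, S.M_apply hm']
          · rw [Submodule.coe_add, S.expG_add (S.𝔞_abelian _ H.2 _ H'.2)]
            calc m * S.expG H * n * (m' * S.expG H' * n')
                = m * (S.expG H * m') * S.expG H' *
                    ((m' * S.expG H')⁻¹ * n * (m' * S.expG H')) * n' := by group
              _ = _ := by rw [hc]; group
        inv_mem' := by
          rintro _ ⟨m, hm, H, n, hn, rfl⟩
          have hc : S.expG H * m = m * S.expG H :=
            Subgroup.mem_centralizer_iff.mp hm.2 _ (S.expG_mem_A H)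
          refine ⟨m⁻¹, S.M.inv_mem hm, -H, (m * S.expG H) * n⁻¹ * (m * S.expG H)⁻¹,
            S.conj_mem_N (fun H'' => ?_) (S.N.inv_mem hn), ?_⟩
          · change m.1 ((S.expG H).1 H'') = _
            rw [expG_a_apply, S.M_apply hm]
          · rw [Submodule.coe_neg, expG_neg, ← hc]
            group }
    have hM : S.M ≤ P := fun m hm => ⟨m, hm, 0, 1, S.N.one_mem, by simp [expG_zero]⟩
    have hA : S.A ≤ P := fun a ha => by
      obtain ⟨H, rfl⟩ := S.mem_A_iff.mp ha
      exact ⟨1, S.M.one_mem, H, 1, S.N.one_mem, by simp⟩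
    have hN : S.N ≤ P := fun n hn => ⟨1, S.M.one_mem, 0, n, hn, by simp [expG_zero]⟩
    exact (sup_le (sup_le hM hA) hN : S.MAN ≤ P) h
  · rintro ⟨m, hm, H, n, hn, rfl⟩
    have hM : S.M ≤ S.MAN := le_sup_left.trans le_sup_left
    have hA : S.A ≤ S.MAN := le_sup_right.trans le_sup_left
    have hN : S.N ≤ S.MAN := le_sup_right
    exact S.MAN.mul_mem (S.MAN.mul_mem (hM hm) (hA (S.expG_mem_A H))) (hN hn)

/-! ### The Iwasawa decomposition -/

/-- Every element of `H₀ + 𝔫` is conjugate to `H₀` under `N`. -/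
theorem exists_N_apply_eq_H₀ {Y : 𝔤} (hY : Y ∈ S.filGt 0) :
    ∃ n ∈ S.N, n.1 ((S.H₀ : 𝔤) + Y) = S.H₀ := by
  suffices h : ∀ (m : ℕ) (Y : 𝔤), (∀ j : Fin S.dim, (S.deg j ≤ 0 ∨ m ≤ j) → S.ip (S.basis j) Y = 0) →
      ∃ n ∈ S.N, n.1 ((S.H₀ : 𝔤) + Y) = S.H₀ by
    refine h S.dim Y fun j hj => hj.elim (fun h => hY j h) fun h => ?_
    exact absurd j.2 (not_lt.mpr h)
  intro m
  induction m with
  | zero =>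
    intro Y hY
    have h0 : Y = 0 := by
      rw [← S.sum_ip_basis Y]
      exact Finset.sum_eq_zero fun j _ => by rw [hY j (Or.inr (Nat.zero_le _)), zero_smul]
    exact ⟨1, S.N.one_mem, by rw [h0, add_zero]; rfl⟩
  | succ m ih =>
    intro Y hY
    by_cases hm : ∃ i : Fin S.dim, (i : ℕ) = m ∧ 0 < S.deg i
    swap
    · refine ih Y fun j hj => hY j ?_
      rcases hj with hj | hj
      · exact Or.inl hj
      · rcases hj.eq_or_lt with h | h
        · exact Or.inl (not_lt.mp fun h' => hm ⟨j, h.symm, h'⟩)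
        · exact Or.inr h
    obtain ⟨i, rfl, hi⟩ := hm
    have hYgt : Y ∈ S.filGt 0 := fun j hj => hY j (Or.inl hj)
    have hei : S.basis i ∈ S.filGe (S.deg i) := S.basis_mem_filGe le_rfl
    set y := S.ip (S.basis i) Y with hy
    -- Index `i` is the last one that `Y` may involve, hence of least degree. With this `c` the term
    -- [c e_i, H₀] cancels y e_i, and all other new terms, including those of order at least two of
    -- the exponential, have degree above `deg i`.
    set c := y / S.deg i with hc
    have hlieH : ⁅c • S.basis i, (S.H₀ : 𝔤)⁆ = -(y • S.basis i) := by
      rw [← lie_skew, lie_smul, lie_H₀_basis, smul_smul, hc, div_mul_cancel₀ _ hi.ne']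
    have hlieY : ⁅S.basis i, Y⁆ ∈ S.filGt (S.deg i) := by
      simpa using S.lie_mem_filGt hei hYgt
    have hstab : ∀ Z ∈ S.filGt (S.deg i), ⁅c • S.basis i, Z⁆ ∈ S.filGt (S.deg i) := fun Z hZ => by
      rw [smul_lie]
      refine (S.filGt _).smul_mem _ (S.filGt_mono ?_ (S.lie_mem_filGt hei hZ))
      linarith
    have h2 : ⁅c • S.basis i, ⁅c • S.basis i, (S.H₀ : 𝔤) + Y⁆⁆ ∈ S.filGt (S.deg i) := by
      rw [lie_add, hlieH, lie_add, lie_neg, lie_smul, smul_lie, lie_self, smul_zero, smul_zero,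
        neg_zero, zero_add]
      refine hstab _ ?_
      rw [smul_lie]
      exact (S.filGt _).smul_mem _ hlieY
    have hexp := exp_sub_sum_mem (T := S.adE (c • S.basis i))
      ((S.filGt (S.deg i)).map S.coord.toLinearMap)
      (by
        rintro _ ⟨Z, hZ, rfl⟩
        exact ⟨_, hstab Z hZ, (S.adE_coord _ _).symm⟩) (v := S.coord ((S.H₀ : 𝔤) + Y)) 2
      (by
        rw [pow_two, mul_apply_eq_comp, adE_coord, adE_coord]
        exact ⟨_, h2, rfl⟩)
    obtain ⟨W, hW, hW'⟩ := hexp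
    have hWeq : (S.expG (c • S.basis i)).1 ((S.H₀ : 𝔤) + Y) =
        S.H₀ + (Y - y • S.basis i + c • ⁅S.basis i, Y⁆ + W) := by
      refine S.coord.injective ?_
      rw [← repG_coord, repG_expG]
      simp only [Finset.sum_range_succ, Finset.sum_range_zero, Nat.factorial, pow_zero, pow_one,
        one_apply_eq_self, adE_coord, lie_add, hlieH, smul_lie] at hW'
      rw [eq_sub_iff_add_eq] at hW'
      rw [← hW']
      simp only [LinearEquiv.coe_coe, map_add, map_sub, map_neg, map_smul]
      simp
      abel
    have hrest : c • ⁅S.basis i, Y⁆ + W ∈ S.filGt (S.deg i) :=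
      (S.filGt _).add_mem ((S.filGt _).smul_mem _ hlieY) hW
    obtain ⟨n, hn, hn'⟩ := ih (Y - y • S.basis i + c • ⁅S.basis i, Y⁆ + W) fun j hj => by
      rw [add_assoc, map_add, map_sub, map_smul, ip_basis]
      have hle : S.deg j ≤ S.deg i := hj.elim (fun h => h.trans hi.le) fun h => S.antitone_deg h
      rw [hrest j hle]
      by_cases hji : j = i
      · rw [hji, hy]
        simp
      · rw [if_neg hji, hY j (hj.imp id fun h => ?_)]
        · simp
        · exact Nat.succ_le_of_lt (lt_of_le_of_ne h fun h' => hji (Fin.ext h'.symm))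
    refine ⟨n * S.expG (c • S.basis i), S.N.mul_mem hn (S.expG_mem_N ?_), ?_⟩
    · exact (S.filGt 0).smul_mem _ (fun j hj => hei j (by linarith))
    · change n.1 ((S.expG (c • S.basis i)).1 _) = _
      rw [hWeq, hn']

/-- The elements of the `(-1)`-eigenspace of `θ` that commute with `H₀` are in `𝔞`. -/
theorem mem_a_of_lie_H₀ {Z : 𝔤} (hZ : S.θ Z = -Z) (h : ⁅Z, (S.H₀ : 𝔤)⁆ = 0) : Z ∈ S.𝔞 := by
  refine S.𝔞_maximal Z hZ fun H hH => ?_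
  rw [← S.sum_ip_basis Z, lie_sum]
  refine Finset.sum_eq_zero fun j _ => ?_
  rw [lie_smul]
  -- Components of degree zero have weight zero and commute with all of 𝔞; the others vanish because
  -- `Z` commutes with `H₀`.
  by_cases hj : S.deg j = 0
  · have := S.lie_basis ⟨H, hH⟩ j
    rw [S.wt_eq_zero_of_deg_eq_zero hj, LinearMap.zero_apply, zero_smul] at this
    rw [this, smul_zero]
  · have h1 := S.ip_basis_lie_a S.H₀ Z j
    rw [← lie_skew, h, neg_zero, map_zero] at h1
    rw [(mul_eq_zero.mp h1.symm).resolve_left hj, zero_smul]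

/-- An orthonormal basis obtained from `g(e_i)` by the Gram–Schmidt process. -/
theorem exists_triangular_basis (g : S.G) : ∃ q : Module.Basis (Fin S.dim) ℝ 𝔤,
    (∀ i j, S.ip (q i) (q j) = if i = j then 1 else 0) ∧
    (∀ i j, i < j → S.ip (q j) (g.1 (S.basis i)) = 0) ∧
    ∀ i j, i < j → S.ip (S.basis j) (g⁻¹.1 (q i)) = 0 := by
  have hfr : Module.finrank ℝ S.Euc = Fintype.card (Fin S.dim) := by simp
  set f : Fin S.dim → S.Euc := fun i => S.repG g (S.ob i) with hf
  have hli : LinearIndependent ℝ f := linearIndependent_apply_of_isUnit (S.isUnit_repG g)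
  let qb := InnerProductSpace.gramSchmidtOrthonormalBasis hfr f
  have hig : ∀ Y, g⁻¹.1 (g.1 Y) = Y := fun Y => g.1.symm_apply_apply Y
  have hqb : ∀ i, S.coord (S.coord.symm (qb i)) = qb i := fun i => LinearEquiv.apply_symm_apply _ _
  refine ⟨qb.toBasis.map S.coord.symm, fun i j => ?_, fun i j hij => ?_, fun i j hij => ?_⟩
  · rw [← inner_coord]
    simp only [Module.Basis.map_apply, OrthonormalBasis.coe_toBasis, hqb]
    exact orthonormal_iff_ite.mp qb.orthonormal i j
  · rw [← inner_coord, ← repG_coord, coord_basis]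
    simp only [Module.Basis.map_apply, OrthonormalBasis.coe_toBasis, hqb]
    exact InnerProductSpace.gramSchmidtOrthonormalBasis_inv_triangular hfr f hij
  · have hne : InnerProductSpace.gramSchmidtNormed ℝ f i ≠ 0 :=
      (InnerProductSpace.gramSchmidtNormed_linearIndependent hli).ne_zero i
    have hmem : qb i ∈ Submodule.span ℝ (f '' Set.Iic i) := by
      rw [InnerProductSpace.gramSchmidtOrthonormalBasis_apply hfr hne]
      exact Submodule.smul_mem _ _ (InnerProductSpace.gramSchmidt_mem_span ℝ f le_rfl)
    have hle : Submodule.span ℝ (f '' Set.Iic i) ≤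
        (LinearMap.ker (S.ip (S.basis j) ∘ₗ (g⁻¹.1 : 𝔤 →ₗ[ℝ] 𝔤) ∘ₗ S.coord.symm.toLinearMap)) := by
      rw [Submodule.span_le]
      rintro _ ⟨l, hl, rfl⟩
      simp only [SetLike.mem_coe, LinearMap.mem_ker, LinearMap.comp_apply, hf]
      rw [← coord_basis, repG_coord]
      simp only [LinearEquiv.coe_coe, LinearEquiv.symm_apply_apply]
      rw [hig, ip_basis, if_neg (lt_of_le_of_lt hl hij).ne']
    exact hle hmem

/-- Existence of the Iwasawa decomposition `G = KAN`. -/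
theorem exists_iwasawa (g : S.G) :
    ∃ k ∈ S.K, ∃ H : S.𝔞, ∃ n ∈ S.N, g = k * S.expG H * n := by
  -- The basis `q` spans the same flag as the vectors g(e_i). Letting `q i` have degree `deg i`
  -- defines a grading that turns out to be given by ad H' for some H' in 𝔭, the future k(H₀). The
  -- factors `n` and `k exp Z` are then extracted from H'.
  obtain ⟨q, ho, hq1, hq2⟩ := S.exists_triangular_basis g
  have hgi : ∀ Y, g.1 (g⁻¹.1 Y) = Y := fun Y => g.1.apply_symm_apply Y
  have hig : ∀ Y, g⁻¹.1 (g.1 Y) = Y := fun Y => g.1.symm_apply_apply Y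
  have hgilie : ∀ X Y, g⁻¹.1 ⁅X, Y⁆ = ⁅g⁻¹.1 X, g⁻¹.1 Y⁆ := S.G_automorphism g⁻¹.1 g⁻¹.2
  have hrepr : ∀ X, ∑ i, S.ip (q i) X • q i = X := by
    intro X
    have : ∀ i, S.ip (q i) X = q.repr X i := fun i => by
      conv_lhs => rw [← q.sum_repr X]
      simp only [map_sum, map_smul, ho]
      simp
    simp_rw [this]
    exact q.sum_repr X
  have hexpand : ∀ X, g.1 X = ∑ i, S.ip (S.basis i) X • g.1 (S.basis i) := fun X => by
    conv_lhs => rw [← S.sum_ip_basis X]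
    simp only [map_sum, map_smul]
  have hgeq : ∀ t X, X ∈ S.filGe t → ∀ j, S.deg j < t → S.ip (q j) (g.1 X) = 0 := by
    intro t X hX j hj
    rw [hexpand, map_sum]
    refine Finset.sum_eq_zero fun i _ => ?_
    rw [map_smul]
    by_cases hi : S.deg i < t
    · rw [hX i hi, zero_smul]
    · rw [hq1 i j (S.lt_of_deg_lt (by linarith)), smul_zero]
  have hgtq : ∀ t X, X ∈ S.filGt t → ∀ j, S.deg j ≤ t → S.ip (q j) (g.1 X) = 0 := by
    intro t X hX j hj
    rw [hexpand, map_sum]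
    refine Finset.sum_eq_zero fun i _ => ?_
    rw [map_smul]
    by_cases hi : S.deg i ≤ t
    · rw [hX i hi, zero_smul]
    · rw [hq1 i j (S.lt_of_deg_lt (by linarith)), smul_zero]
  have hqfil : ∀ i, g⁻¹.1 (q i) ∈ S.filGe (S.deg i) := fun i j hj => hq2 i j (S.lt_of_deg_lt hj)
  have hθfil : ∀ i, g⁻¹.1 (S.θ (q i)) ∈ S.filGe (-S.deg i) := by
    intro i j hj
    rw [← S.ip_theta, ← S.ip_smul_left, S.ip_symm]
    refine hgtq (S.deg i) _ (fun l hl => S.ip_basis_theta_of_ne ?_) i le_rfl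
    intro h
    linarith
  -- Too low degrees are excluded since g⁻¹ respects brackets and maps the flag to the degree
  -- filtration. Too high degrees are excluded by passing to the adjoint -ad(θ(q i)), as g⁻¹θ(q i)
  -- has degree at least `-deg i`.
  have hlieq : ∀ i j l, S.deg l ≠ S.deg i + S.deg j → S.ip (q l) ⁅q i, q j⁆ = 0 := by
    intro i j l hl
    rcases lt_or_gt_of_ne hl with h | h
    · rw [← hgi ⁅q i, q j⁆, hgilie]
      exact hgeq _ _ (S.lie_mem_filGe (hqfil i) (hqfil j)) l h
    · rw [S.ip_symm, S.ip_lie_left, ← hgi ⁅S.θ (q i), q l⁆, hgilie,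
        hgeq _ _ (S.lie_mem_filGe (hθfil i) (hqfil l)) j (by linarith), neg_zero]
  let D : 𝔤 →ₗ[ℝ] 𝔤 := q.constr ℝ fun i => S.deg i • q i
  have hDq : ∀ i, D (q i) = S.deg i • q i := fun i => q.constr_basis ℝ _ i
  have hDder : ∀ X Y, D ⁅X, Y⁆ = ⁅D X, Y⁆ + ⁅X, D Y⁆ := by
    have key : ∀ i j, D ⁅q i, q j⁆ = ⁅D (q i), q j⁆ + ⁅q i, D (q j)⁆ := by
      intro i j
      rw [hDq, hDq, smul_lie, lie_smul, ← add_smul, ← hrepr ⁅q i, q j⁆, map_sum, Finset.smul_sum]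
      refine Finset.sum_congr rfl fun l _ => ?_
      rw [map_smul, hDq, smul_comm]
      by_cases hl : S.deg l = S.deg i + S.deg j
      · rw [hl]
      · rw [hlieq i j l hl, zero_smul, smul_zero, smul_zero]
    intro X Y
    rw [← q.sum_repr X, ← q.sum_repr Y]
    simp only [map_sum, sum_lie, lie_sum, smul_lie, lie_smul, map_smul, key, smul_add,
      Finset.sum_add_distrib]
  have hDs : ∀ X Y, S.ip (D X) Y = S.ip X (D Y) := by
    have key : ∀ i j, S.ip (D (q i)) (q j) = S.ip (q i) (D (q j)) := by
      intro i j
      rw [hDq, hDq, map_smul, map_smul, LinearMap.smul_apply, ho]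
      by_cases h : i = j
      · rw [h]
      · simp [h]
    intro X Y
    rw [← q.sum_repr X, ← q.sum_repr Y]
    simp only [map_sum, LinearMap.sum_apply, map_smul, LinearMap.smul_apply, key]
  obtain ⟨H', hH', hH'D⟩ := S.exists_ad_eq_of_symmetric_derivation D hDder hDs
  have hH'lie : ∀ X, ⁅H', X⁆ = D X := fun X => by rw [← hH'D, LieAlgebra.ad_apply]
  set Y := g⁻¹.1 H' - S.H₀ with hYdef
  -- `ad Y` strictly raises the degree
  have hYq : ∀ i, ⁅Y, g⁻¹.1 (q i)⁆ ∈ S.filGt (S.deg i) := by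
    intro i j hj
    rw [hYdef, sub_lie, ← hgilie, hH'lie, hDq, map_smul, map_sub, ip_basis_lie_a, map_smul, smul_eq_mul]
    change S.deg i * _ - S.deg j * _ = _
    rcases hj.eq_or_lt with h | h
    · rw [h, sub_self]
    · rw [hqfil i j h, mul_zero, mul_zero, sub_zero]
  have hYfil : ∀ t X, X ∈ S.filGe t → ⁅Y, X⁆ ∈ S.filGt t := by
    intro t X hX
    have h1 : X = ∑ i, S.ip (q i) (g.1 X) • g⁻¹.1 (q i) := by
      conv_lhs => rw [← hig X, ← hrepr (g.1 X)]
      simp only [map_sum, map_smul]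
    rw [h1, lie_sum]
    refine (S.filGt t).sum_mem fun i _ => ?_
    rw [lie_smul]
    by_cases hi : S.deg i < t
    · rw [hgeq t X hX i hi, zero_smul]
      exact (S.filGt t).zero_mem
    · exact (S.filGt t).smul_mem _ (S.filGt_mono (not_lt.mp hi) (hYq i))
  have hYneg : ∀ j, S.deg j < 0 → S.ip (S.basis j) Y = 0 := by
    intro j hj
    have h1 := hYfil 0 S.H₀ (fun j hj => S.ip_basis_a_of_ne hj.ne S.H₀) j hj.le
    rw [← lie_skew, map_neg, ip_basis_lie_a, neg_eq_zero] at h1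
    exact (mul_eq_zero.mp h1).resolve_left hj.ne
  -- `ad Y0` preserves degrees but, like `ad Y` and `ad (Y - Y0)`, also strictly raises them. So it
  -- is zero, and `Y` lies in 𝔫.
  set Y0 := ∑ j, (if S.deg j = 0 then S.ip (S.basis j) Y else 0) • S.basis j with hY0
  have hY0c : ∀ j, S.ip (S.basis j) Y0 = if S.deg j = 0 then S.ip (S.basis j) Y else 0 := by
    intro j
    rw [hY0]
    simp only [map_sum, map_smul, ip_basis]
    simp
  have hYp : Y - Y0 ∈ S.filGt 0 := by
    intro j hj
    rw [map_sub, hY0c]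
    rcases hj.eq_or_lt with h | h
    · rw [if_pos h, sub_self]
    · rw [if_neg h.ne, hYneg j h, sub_zero]
  have hY0z : Y0 = 0 := by
    refine S.ad_injective ?_
    rw [map_zero]
    refine S.basis.ext fun i => ?_
    rw [LieAlgebra.ad_apply, LinearMap.zero_apply]
    have hge := S.basis_mem_filGe (le_refl (S.deg i))
    have h1 : ⁅Y0, S.basis i⁆ ∈ S.filGt (S.deg i) := by
      have : ⁅Y0, S.basis i⁆ = ⁅Y, S.basis i⁆ - ⁅Y - Y0, S.basis i⁆ := by
        rw [sub_lie Y Y0, sub_sub_cancel]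
      rw [this]
      refine (S.filGt _).sub_mem (hYfil _ _ hge) ?_
      simpa using S.lie_mem_filGt_of_filGt hYp hge
    rw [← S.sum_ip_basis ⁅Y0, S.basis i⁆]
    refine Finset.sum_eq_zero fun j _ => ?_
    by_cases hj : S.deg j ≤ S.deg i
    · rw [h1 j hj, zero_smul]
    · rw [ip_basis_lie, Finset.sum_eq_zero, zero_smul]
      refine fun k _ => Finset.sum_eq_zero fun l _ => ?_
      rw [hY0c, ip_basis]
      by_cases hk : S.deg k = 0
      · by_cases hl : l = i
        · rw [hl, S.ip_basis_lie_of_ne (by rw [hk]; linarith), mul_zero, mul_zero]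
        · rw [if_neg hl, zero_mul, mul_zero]
      · rw [if_neg hk, zero_mul]
  rw [hY0z, sub_zero] at hYp
  obtain ⟨n, hn, hnH⟩ := S.exists_N_apply_eq_H₀ hYp
  rw [hYdef, add_sub_cancel] at hnH
  -- Here g n⁻¹ maps `H₀` to H', both in 𝔭. Hence exp(Z)H₀ is in 𝔭, exp(2Z) fixes `H₀`, and `Z`
  -- commutes with `H₀`, which puts it in 𝔞.
  obtain ⟨k, hk, Z, hZ, hgn⟩ := S.exists_polar (g * n⁻¹)
  have hgnH : k.1 ((S.expG Z).1 (S.H₀ : 𝔤)) = H' := by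
    change (k * S.expG Z).1 (S.H₀ : 𝔤) = H'
    rw [← hgn, ← hnH]
    change g.1 (n.1.symm (n.1 (g⁻¹.1 H'))) = H'
    rw [LinearEquiv.symm_apply_apply, hgi]
  have hθ : S.θ ((S.expG Z).1 (S.H₀ : 𝔤)) = -(S.expG Z).1 (S.H₀ : 𝔤) := by
    refine k.1.injective ?_
    rw [hk, map_neg, hgnH, hH']
  rw [theta_expG_apply, hZ, S.𝔞_le _ S.H₀.2, map_neg, neg_inj, expG_neg] at hθ
  have h2 : (S.expG (Z + Z)).1 (S.H₀ : 𝔤) = S.H₀ := by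
    rw [S.expG_add (by simp)]
    change (S.expG Z).1 ((S.expG Z).1 (S.H₀ : 𝔤)) = S.H₀
    rw [← hθ]
    exact (S.expG Z).1.apply_symm_apply _
  have h3 := S.lie_eq_zero_of_expG_apply_eq (by rw [map_add, hZ, neg_add]) h2
  have h4 : ⁅Z, (S.H₀ : 𝔤)⁆ = 0 := by
    rw [add_lie, ← two_smul ℝ] at h3
    exact (smul_eq_zero.mp h3).resolve_left two_ne_zero
  exact ⟨k, hk, ⟨Z, S.mem_a_of_lie_H₀ hZ h4⟩, n, hn, by rw [← hgn]; group⟩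

theorem coeff_expG (H : S.𝔞) (j i : Fin S.dim) :
    coeff S.ob (S.repG (S.expG H)) j i = if j = i then Real.exp (S.wt i H) else 0 := by
  have h : S.adE H (S.ob i) = S.wt i H • S.ob i := by
    rw [← coord_basis, adE_coord, lie_basis, map_smul]
  rw [coeff, repG_expG, exp_clm_apply_eigenvector h, inner_smul_right,
    orthonormal_iff_ite.mp S.ob.orthonormal]
  simp

/-- AN is upper triangular with positive diagonal, so k·(an) is a QR decomposition. -/
theorem coeff_expG_mul_N (H : S.𝔞) {n : S.G} (hn : n ∈ S.N) {j i : Fin S.dim} (hij : i ≤ j) :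
    coeff S.ob (S.repG (S.expG H * n)) j i = if j = i then Real.exp (S.wt i H) else 0 := by
  have h1 : coeff S.ob (S.repG n) j i = if j = i then 1 else 0 := by
    have := S.repG_mem_unipotentRaise hn i j (S.antitone_deg hij)
    rw [coeff_sub, coeff_one] at this
    linarith
  rw [map_mul, coeff_mul, Finset.sum_eq_single j]
  · rw [coeff_expG, if_pos rfl, h1]
    by_cases h : j = i
    · simp [h]
    · simp [h]
  · intro l _ hl
    rw [coeff_expG, if_neg hl.symm, zero_mul]
  · simp

theorem qrOrth_repG {k n : S.G} (hk : k ∈ S.K) (H : S.𝔞) (hn : n ∈ S.N) :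
    qrOrth S.ob (S.repG (k * S.expG H * n)) = S.repG k := by
  rw [mul_assoc, map_mul]
  refine qrOrth_mul (S.inner_repG_K hk) (fun i => Real.exp_pos (S.wt i H)) (fun i => ?_)
    fun i j hij => ?_
  · rw [S.coeff_expG_mul_N H hn le_rfl, if_pos rfl]
  · rw [S.coeff_expG_mul_N H hn hij.le, if_neg hij.ne']

theorem norm_gsVec_repG {k n : S.G} (hk : k ∈ S.K) (H : S.𝔞) (hn : n ∈ S.N) (i : Fin S.dim) :
    ‖gsVec S.ob (S.repG (k * S.expG H * n)) i‖ = Real.exp (S.wt i H) := by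
  rw [mul_assoc, map_mul]
  refine norm_gsVec_mul (r := fun i => Real.exp (S.wt i H)) (S.inner_repG_K hk)
    (fun i => Real.exp_pos (S.wt i H)) (fun i => ?_) (fun i j hij => ?_) i
  · rw [S.coeff_expG_mul_N H hn le_rfl, if_pos rfl]
  · rw [S.coeff_expG_mul_N H hn hij.le, if_neg hij.ne']

theorem eq_of_wt_eq {H H' : S.𝔞} (h : ∀ i, S.wt i H = S.wt i H') : H = H' := by
  refine Subtype.ext (S.ad_injective (S.basis.ext fun i => ?_))
  rw [LieAlgebra.ad_apply, LieAlgebra.ad_apply, lie_basis, lie_basis, h]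

/-- Gram–Schmidt recovers `k`, and its norms exp(wt i H) determine `H` because the adjoint
representation is faithful. -/
theorem iwasawa_unique {k k' n n' : S.G} (hk : k ∈ S.K) (hk' : k' ∈ S.K) {H H' : S.𝔞} (hn : n ∈ S.N)
    (hn' : n' ∈ S.N) (h : k * S.expG H * n = k' * S.expG H' * n') : k = k' ∧ H = H' := by
  refine ⟨S.repG_injective ?_, S.eq_of_wt_eq fun i => Real.exp_injective ?_⟩
  · rw [← S.qrOrth_repG hk H hn, h, S.qrOrth_repG hk' H' hn']
  · rw [← S.norm_gsVec_repG hk H hn, h, S.norm_gsVec_repG hk' H' hn']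

/-- The `K`-component in `G = KAN`. -/
def kProj (g : S.G) : S.G := (S.exists_iwasawa g).choose

/-- The `𝔞`-component in `G = K exp(𝔞) N`. -/
def hProj (g : S.G) : S.𝔞 := (S.exists_iwasawa g).choose_spec.2.choose

theorem kProj_mem (g : S.G) : S.kProj g ∈ S.K := (S.exists_iwasawa g).choose_spec.1

theorem iwasawa_spec (g : S.G) : ∃ n ∈ S.N, g = S.kProj g * S.expG (S.hProj g) * n :=
  (S.exists_iwasawa g).choose_spec.2.choose_spec

theorem kProj_eq {k n : S.G} (hk : k ∈ S.K) (H : S.𝔞) (hn : n ∈ S.N) :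
    S.kProj (k * S.expG H * n) = k := by
  obtain ⟨n', hn', h⟩ := S.iwasawa_spec (k * S.expG H * n)
  exact (S.iwasawa_unique hk (S.kProj_mem _) hn hn' h).1.symm

theorem hProj_eq {k n : S.G} (hk : k ∈ S.K) (H : S.𝔞) (hn : n ∈ S.N) :
    S.hProj (k * S.expG H * n) = H := by
  obtain ⟨n', hn', h⟩ := S.iwasawa_spec (k * S.expG H * n)
  exact (S.iwasawa_unique hk (S.kProj_mem _) hn hn' h).2.symm

theorem qrOrth_repG_eq (g : S.G) : qrOrth S.ob (S.repG g) = S.repG (S.kProj g) := by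
  obtain ⟨n, hn, h⟩ := S.iwasawa_spec g
  conv_lhs => rw [h]
  exact S.qrOrth_repG (S.kProj_mem g) _ hn

theorem norm_gsVec_repG_eq (g : S.G) (i : Fin S.dim) :
    ‖gsVec S.ob (S.repG g) i‖ = Real.exp (S.wt i (S.hProj g)) := by
  obtain ⟨n, hn, h⟩ := S.iwasawa_spec g
  conv_lhs => rw [h]
  exact S.norm_gsVec_repG (S.kProj_mem g) _ hn i

theorem hProj_of_mem_K {k : S.G} (hk : k ∈ S.K) : S.hProj k = 0 := by
  have := S.hProj_eq hk 0 S.N.one_mem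
  simpa [expG_zero] using this

theorem kProj_of_mem_K {k : S.G} (hk : k ∈ S.K) : S.kProj k = k := by
  have := S.kProj_eq hk 0 S.N.one_mem
  simpa [expG_zero] using this

/-- Moving `m` and exp H to the left past the N-part of `g` only conjugates that part within `N`. -/
theorem exists_eq_mul_MAN (g : S.G) {m n : S.G} (hm : m ∈ S.M) (H : S.𝔞) (hn : n ∈ S.N) :
    ∃ n' ∈ S.N, g * (m * S.expG H * n) =
      S.kProj g * m * S.expG ((S.hProj g + H : S.𝔞) : 𝔤) * n' := by
  obtain ⟨n', hn', h⟩ := S.iwasawa_spec g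
  have hc : S.expG (S.hProj g) * m = m * S.expG (S.hProj g) :=
    Subgroup.mem_centralizer_iff.mp hm.2 _ (S.expG_mem_A _)
  refine ⟨((m * S.expG H)⁻¹ * n' * (m * S.expG H)) * n, S.N.mul_mem ?_ hn, ?_⟩
  · have := S.conj_mem_N (m := (m * S.expG H)⁻¹) (fun H'' => ?_) hn'
    · simpa using this
    · refine (LinearEquiv.symm_apply_eq _).mpr ?_
      change _ = m.1 ((S.expG H).1 H'')
      rw [expG_a_apply, S.M_apply hm]
  · rw [Submodule.coe_add, S.expG_add (S.𝔞_abelian _ (S.hProj g).2 _ H.2)]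
    calc g * (m * S.expG H * n)
        = S.kProj g * S.expG (S.hProj g) * n' * (m * S.expG H * n) := by rw [← h]
      _ = S.kProj g * (S.expG (S.hProj g) * m) * S.expG H *
            ((m * S.expG H)⁻¹ * n' * (m * S.expG H)) * n := by group
      _ = _ := by rw [hc]; group

theorem hProj_mul_MAN (g : S.G) {m n : S.G} (hm : m ∈ S.M) (H : S.𝔞) (hn : n ∈ S.N) :
    S.hProj (g * (m * S.expG H * n)) = S.hProj g + H := by
  obtain ⟨n', hn', h⟩ := S.exists_eq_mul_MAN g hm H hn
  rw [h, S.hProj_eq (S.K.mul_mem (S.kProj_mem g) hm.1) _ hn']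

theorem kProj_mul_MAN (g : S.G) {m n : S.G} (hm : m ∈ S.M) (H : S.𝔞) (hn : n ∈ S.N) :
    S.kProj (g * (m * S.expG H * n)) = S.kProj g * m := by
  obtain ⟨n', hn', h⟩ := S.exists_eq_mul_MAN g hm H hn
  rw [h, S.kProj_eq (S.K.mul_mem (S.kProj_mem g) hm.1) _ hn']

theorem bpt_eq_bpt {g h : S.G} : S.bpt g = S.bpt h ↔ g⁻¹ * h ∈ S.MAN := QuotientGroup.eq

theorem exists_bpt_eq (b : S.Bdry) : ∃ g, S.bpt g = b := QuotientGroup.mk_surjective b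

theorem smul_bpt (g h : S.G) : g • S.bpt h = S.bpt (g * h) := rfl

theorem bpt_kProj (g : S.G) : S.bpt (S.kProj g) = S.bpt g := by
  obtain ⟨n, hn, h⟩ := S.iwasawa_spec g
  rw [bpt_eq_bpt, S.mem_MAN_iff]
  refine ⟨1, S.M.one_mem, S.hProj g, n, hn, ?_⟩
  rw [inv_mul_eq_iff_eq_mul, one_mul, ← mul_assoc, ← h]

/-! ### The Iwasawa projection `A(x, b)` -/

/-- Inverting k⁻¹g = n exp(H) k' gives g⁻¹k the 𝔞-part -H, and passing from `k` to another
representative of the boundary point adds the same vector to both terms. The cocycle identity is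
then a cancellation. -/
theorem IsIwasawaProj.eq {g₁ g₂ : S.G} {H : S.𝔞} (h : S.IsIwasawaProj (S.pt g₁) (S.bpt g₂) H) :
    H = S.hProj g₂ - S.hProj (g₁⁻¹ * g₂) := by
  obtain ⟨k, hk, g, hb, hx, n, hn, a, ha, k', hk', hg⟩ := h
  rw [S.isExpAd_iff_eq] at ha
  subst ha
  obtain ⟨m, hm, H₂, n₂, hn₂, hp⟩ := S.mem_MAN_iff.mp (S.bpt_eq_bpt.mp hb.symm)
  have hk₁ := S.pt_eq_pt.mp hx
  have h2 : S.hProj g₂ = H₂ := by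
    have : g₂ = k * (m * S.expG H₂ * n₂) := by rw [← hp, mul_inv_cancel_left]
    rw [this, S.hProj_mul_MAN k hm H₂ hn₂, S.hProj_of_mem_K hk, zero_add]
  have h3 : g₁⁻¹ * g₂ = (g₁⁻¹ * g * k'⁻¹ * S.expG ((-H : S.𝔞) : 𝔤) * n⁻¹) *
      (m * S.expG H₂ * n₂) := by
    rw [← hp, Submodule.coe_neg, expG_neg]
    have : g = k * (n * S.expG H * k') := by rw [← hg, mul_inv_cancel_left]
    rw [this]
    group
  rw [h2, h3, S.hProj_mul_MAN _ hm H₂ hn₂,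
    S.hProj_eq (S.K.mul_mem hk₁ (S.K.inv_mem hk')) _ (S.N.inv_mem hn)]
  abel

theorem exists_isIwasawaProj (x : S.Omega) (b : S.Bdry) : ∃ H, S.IsIwasawaProj x b H := by
  obtain ⟨g₁, rfl⟩ := S.exists_pt_eq x
  obtain ⟨g₂, rfl⟩ := S.exists_bpt_eq b
  obtain ⟨k, hk, H, n, hn, h⟩ := S.exists_iwasawa (g₁⁻¹ * S.kProj g₂)
  refine ⟨-H, S.kProj g₂, S.kProj_mem g₂, g₁, (S.bpt_kProj g₂).symm, rfl, n⁻¹, S.N.inv_mem hn,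
    S.expG (-H : S.𝔞), S.isExpAd_iff_eq.mpr rfl, k⁻¹, S.K.inv_mem hk, ?_⟩
  rw [Submodule.coe_neg, expG_neg, ← mul_inv_rev, ← mul_inv_rev, ← mul_assoc, ← h, mul_inv_rev, inv_inv]

theorem iwasawaProj_pt_bpt (g₁ g₂ : S.G) :
    S.iwasawaProj (S.pt g₁) (S.bpt g₂) = S.hProj g₂ - S.hProj (g₁⁻¹ * g₂) :=
  IsIwasawaProj.eq S (Classical.epsilon_spec (S.exists_isIwasawaProj _ _))

theorem iwasawaProj_smul (g : S.G) (x : S.Omega) (b : S.Bdry) :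
    S.iwasawaProj (g • x) (g • b) = S.iwasawaProj x b + S.iwasawaProj (g • S.pt 1) (g • b) := by
  obtain ⟨g₁, rfl⟩ := S.exists_pt_eq x
  obtain ⟨g₂, rfl⟩ := S.exists_bpt_eq b
  simp only [smul_pt, smul_bpt, iwasawaProj_pt_bpt]
  rw [mul_one, inv_mul_cancel_left, mul_inv_rev, mul_assoc, inv_mul_cancel_left]
  abel

/-- The cocycle term is the same for `y` and `z`: its λ-parts cancel and its ρ-parts add. -/
theorem planeWave_mul_planeWave_smul (g : S.G) (l : S.DualA) (b : S.Bdry) (y z : S.Omega) :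
    S.planeWave l (g • b) (g • y) * S.planeWave (-l) (g • b) (g • z) =
      S.planeWave l b y * S.planeWave (-l) b z *
        (Real.exp (2 * S.rho (S.iwasawaProj (g • S.pt 1) (g • b))) : ℝ) := by
  simp only [planeWave, ← Complex.exp_add, Complex.ofReal_exp, S.iwasawaProj_smul g y,
    S.iwasawaProj_smul g z, map_add, Complex.ofReal_add]
  congr 1
  simp only [neg_apply, Complex.ofReal_neg, Complex.ofReal_mul,
    Complex.ofReal_ofNat]
  ring

/-! ### The half sum of the positive roots -/

theorem mult_eq_card (α : Module.Dual ℝ S.𝔞) [DecidablePred fun i => S.wt i = α] :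
    S.mult α = (Finset.univ.filter fun i => S.wt i = α).card := by
  have hspan : rootSpace S.𝔞 α =
      Submodule.span ℝ (Set.range (S.basis ∘ (Subtype.val : {i // S.wt i = α} → Fin S.dim))) := by
    refine le_antisymm (fun X hX => ?_) (Submodule.span_le.mpr ?_)
    · rw [← S.sum_ip_basis X]
      refine Submodule.sum_mem _ fun i _ => ?_
      by_cases hi : S.wt i = α
      · exact Submodule.smul_mem _ _ (Submodule.subset_span ⟨⟨i, hi⟩, rfl⟩)
      · rw [S.ip_basis_of_mem_rootSpace hX hi, zero_smul]
        exact Submodule.zero_mem _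
    · rintro _ ⟨⟨i, rfl⟩, rfl⟩
      exact fun H => S.lie_basis H i
  rw [mult, hspan, finrank_span_eq_card (S.basis.linearIndependent.comp _ Subtype.val_injective),
    Fintype.card_subtype]

/-- Each root is repeated as often as it occurs as a weight of the adapted basis. This makes
exp(2ρ(H(g))) a product of Gram–Schmidt norms, hence smooth. -/
theorem two_mul_rho (H : S.𝔞) :
    2 * S.rho H = ∑ i with 0 < S.deg i, S.wt i H := by
  classical
  have himg : ∀ α, α ∈ S.posRoots ↔ α ∈ (Finset.univ.filter fun i => 0 < S.deg i).image S.wt := by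
    intro α
    simp only [Finset.mem_image, Finset.mem_filter, Finset.mem_univ, true_and]
    constructor
    · intro hα
      by_contra! hne
      refine hα.1.2 (le_bot_iff.mp fun X hX => ?_)
      rw [Submodule.mem_bot, ← S.sum_ip_basis X]
      refine Finset.sum_eq_zero fun i _ => ?_
      rw [S.ip_basis_of_mem_rootSpace hX, zero_smul]
      rintro rfl
      exact hne i hα.2 rfl
    · rintro ⟨i, hi, rfl⟩
      exact S.wt_mem_posRoots hi
  have hsum : ∑ᶠ α ∈ S.posRoots, (S.mult α : ℝ) • α = ∑ i with 0 < S.deg i, S.wt i := by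
    rw [finsum_mem_congr (Set.ext himg) fun α _ => rfl]
    rw [finsum_mem_coe_finset, ← Finset.sum_fiberwise_of_maps_to (g := S.wt)
      (t := (Finset.univ.filter fun i => 0 < S.deg i).image S.wt)
      (fun i hi => Finset.mem_image_of_mem _ hi)]
    refine Finset.sum_congr rfl fun α hα => ?_
    have hα' := ((himg α).mpr hα).2
    have hf : (Finset.univ.filter fun i => 0 < S.deg i).filter (fun i => S.wt i = α) =
        Finset.univ.filter fun i => S.wt i = α := by
      ext i
      simp only [Finset.mem_filter, Finset.mem_univ, true_and, and_iff_right_iff_imp]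
      rintro rfl
      exact hα'
    rw [hf, mult_eq_card, Finset.sum_congr rfl (g := fun _ => α) (by simp), Finset.sum_const,
      Nat.cast_smul_eq_nsmul]
  rw [rho, hsum, LinearMap.smul_apply, LinearMap.sum_apply, smul_eq_mul]
  ring

/-- The product of the diagonal entries of the triangular factor that belong to `𝔫`. -/
def nilDet (T : S.Euc →L[ℝ] S.Euc) : ℝ := ∏ i with 0 < S.deg i, ‖gsVec S.ob T i‖

theorem nilDet_repG (g : S.G) : S.nilDet (S.repG g) = Real.exp (2 * S.rho (S.hProj g)) := by
  rw [two_mul_rho, Real.exp_sum, nilDet]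
  exact Finset.prod_congr rfl fun i _ => S.norm_gsVec_repG_eq g i

/-! ### Local factorization near the identity of a Banach algebra -/

/-- The strict derivative at the origin is (r, v) ↦ f r + g v, which is onto, so the map is open
there. -/
theorem map_nhds_exp_mul {R 𝔸 V : Type*} [NormedAddCommGroup R] [NormedSpace ℝ R] [CompleteSpace R]
    [NormedRing 𝔸] [NormedAlgebra ℝ 𝔸] [CompleteSpace 𝔸] [NormedAddCommGroup V] [NormedSpace ℝ V]
    [CompleteSpace V] (f : R →L[ℝ] 𝔸) (g : V →L[ℝ] 𝔸) (h : ∀ T, ∃ r v, f r + g v = T) :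
    Filter.map (fun p : R × V => NormedSpace.exp (f p.1) * (1 + g p.2)) (nhds 0) = nhds 1 := by
  have h1 : HasStrictFDerivAt (fun p : R × V => NormedSpace.exp (f p.1))
      (f.comp (ContinuousLinearMap.fst ℝ R V)) 0 := by
    have he : HasStrictFDerivAt (NormedSpace.exp : 𝔸 → 𝔸) (1 : 𝔸 →L[ℝ] 𝔸)
        (f.comp (ContinuousLinearMap.fst ℝ R V) 0) := by
      rw [map_zero]
      exact hasStrictFDerivAt_exp_zero
    exact he.comp (0 : R × V) (f.comp (ContinuousLinearMap.fst ℝ R V)).hasStrictFDerivAt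
  have h2 : HasStrictFDerivAt (fun p : R × V => 1 + g p.2)
      (g.comp (ContinuousLinearMap.snd ℝ R V)) 0 :=
    (g.comp (ContinuousLinearMap.snd ℝ R V)).hasStrictFDerivAt.const_add 1
  have h3 := h1.mul' h2
  have h4 := h3.map_nhds_eq_of_surj (LinearMap.range_eq_top.mpr fun T => by
    obtain ⟨r, v, hT⟩ := h T
    exact ⟨(r, v), by simpa [add_comm] using hT⟩)
  have h5 : Filter.map (fun p : R × V => NormedSpace.exp (f p.1) * (1 + g p.2)) (nhds 0) =
      nhds (NormedSpace.exp (f (0 : R × V).1) * (1 + g (0 : R × V).2)) := h4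
  simpa using h5

/-- Near `1`, every element is `exp(f r)(1 + v)` with `v` small and controlled by `D v`, if `D`
is a linear map whose kernel is contained in the range of `f`. -/
theorem eventually_eq_exp_mul {R 𝔸 W : Type*} [NormedAddCommGroup R] [NormedSpace ℝ R]
    [CompleteSpace R] [NormedRing 𝔸] [NormedAlgebra ℝ 𝔸] [FiniteDimensional ℝ 𝔸]
    [NormedAddCommGroup W] [NormedSpace ℝ W] (f : R →L[ℝ] 𝔸) (D : 𝔸 →ₗ[ℝ] W)
    (h : ∀ T, D T = 0 → ∃ r, f r = T) : ∃ C : ℝ, 0 < C ∧ ∀ ε > 0, ∀ᶠ T in nhds (1 : 𝔸),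
      ∃ r v, T = NormedSpace.exp (f r) * (1 + v) ∧ ‖v‖ < ε ∧ ‖v‖ ≤ C * ‖D v‖ := by
  have : CompleteSpace 𝔸 := FiniteDimensional.complete ℝ 𝔸
  -- `D` is injective on a complement of the range of `f`, hence bounded below there by finite
  -- dimension.
  obtain ⟨V, hV⟩ := Submodule.exists_isCompl (LinearMap.range (f : R →ₗ[ℝ] 𝔸))
  have hmap := map_nhds_exp_mul f V.subtypeL fun T => by
    obtain ⟨_, ⟨r, rfl⟩, v, hv, hT⟩ := Submodule.mem_sup.mp (hV.sup_eq_top ▸ Submodule.mem_top :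
      T ∈ LinearMap.range (f : R →ₗ[ℝ] 𝔸) ⊔ V)
    exact ⟨r, ⟨v, hv⟩, hT⟩
  have hker : LinearMap.ker (D ∘ₗ V.subtype) = ⊥ := by
    rw [LinearMap.ker_eq_bot']
    intro v hv
    obtain ⟨r, hr⟩ := h v hv
    exact Subtype.ext (Submodule.disjoint_def.mp hV.disjoint v ⟨r, hr⟩ v.2)
  obtain ⟨C, hC, hanti⟩ := LinearMap.exists_antilipschitzWith _ hker
  refine ⟨C, hC, fun ε hε => ?_⟩
  rw [← hmap, Filter.eventually_map]
  have hev : ∀ᶠ p : R × V in nhds 0, ‖p.2‖ < ε := by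
    have : Continuous fun p : R × V => ‖p.2‖ := by fun_prop
    refine this.continuousAt.eventually_lt_const ?_
    simpa using hε
  filter_upwards [hev] with p hp
  refine ⟨p.1, p.2, rfl, hp, ?_⟩
  have := hanti.le_mul_dist p.2 0
  simpa using this

/-! ### Topology: `G` is open in the automorphism group, and `K` is compact -/

theorem continuous_repG : Continuous S.repG := by
  refine continuous_clm_apply.mpr fun x => ?_
  obtain ⟨X, rfl⟩ := S.coord.surjective x
  simp_rw [repG_coord]
  exact S.continuous_coord.comp ((continuous_apply X).comp continuous_induced_dom)

theorem isInducing_repG : Topology.IsInducing S.repG := by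
  refine ⟨le_antisymm S.continuous_repG.le_induced ?_⟩
  have h : Continuous fun (T : S.Euc →L[ℝ] S.Euc) (X : 𝔤) => S.coord.symm (T (S.coord X)) :=
    continuous_pi fun X => S.continuous_coord_symm.comp
      (ContinuousLinearMap.apply ℝ S.Euc (S.coord X)).continuous
  have h2 : (fun (g : S.G) (X : 𝔤) => (g : 𝔤 ≃ₗ[ℝ] 𝔤) X) =
      (fun (T : S.Euc →L[ℝ] S.Euc) (X : 𝔤) => S.coord.symm (T (S.coord X))) ∘ S.repG := by
    funext g X
    simp only [Function.comp_apply, repG_coord, LinearEquiv.symm_apply_apply]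
  change _ ≤ TopologicalSpace.induced (fun (g : S.G) (X : 𝔤) => (g : 𝔤 ≃ₗ[ℝ] 𝔤) X) inferInstance
  rw [h2, ← induced_compose]
  exact induced_mono h.le_induced

/-- The adjoint representation as a continuous linear map on the space of coordinates. -/
def adC : S.Euc →L[ℝ] (S.Euc →L[ℝ] S.Euc) :=
  LinearMap.toContinuousLinearMap (S.adE ∘ₗ S.coord.symm.toLinearMap)

theorem adC_coord (X : 𝔤) : S.adC (S.coord X) = S.adE X := by
  simp [adC]

theorem adC_repG (g : S.G) (x y : S.Euc) :
    S.repG g (S.adC x y) = S.adC (S.repG g x) (S.repG g y) := by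
  obtain ⟨X, rfl⟩ := S.coord.surjective x
  obtain ⟨Y, rfl⟩ := S.coord.surjective y
  rw [repG_coord, repG_coord, adC_coord, adC_coord, adE_coord, adE_coord, repG_coord,
    S.G_automorphism g.1 g.2]

/-- The derivative of `T ↦ (T[x, y] - [Tx, Ty])` at `T = 1`, on basis vectors. -/
def defect : (S.Euc →L[ℝ] S.Euc) →ₗ[ℝ] (Fin S.dim → Fin S.dim → S.Euc) where
  toFun T := fun i j => T (S.adC (S.ob i) (S.ob j)) - S.adC (T (S.ob i)) (S.ob j) -
    S.adC (S.ob i) (T (S.ob j))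
  map_add' T T' := by
    funext i j
    simp only [add_apply, map_add, Pi.add_apply]
    abel
  map_smul' c T := by
    funext i j
    simp only [smul_apply, map_smul, Pi.smul_apply, smul_sub, RingHom.id_apply]

theorem exists_adE_eq_of_defect_eq_zero {T : S.Euc →L[ℝ] S.Euc} (hT : S.defect T = 0) :
    ∃ X, S.adE X = T := by
  have h0 : ∀ i j, T (S.adC (S.ob i) (S.ob j)) = S.adC (T (S.ob i)) (S.ob j) +
      S.adC (S.ob i) (T (S.ob j)) := fun i j => by
    have := congrFun (congrFun hT i) j
    change T (S.adC (S.ob i) (S.ob j)) - S.adC (T (S.ob i)) (S.ob j) -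
      S.adC (S.ob i) (T (S.ob j)) = 0 at this
    rw [sub_sub, sub_eq_zero] at this
    exact this
  let D : 𝔤 →ₗ[ℝ] 𝔤 := S.coord.symm.toLinearMap ∘ₗ T.toLinearMap ∘ₗ S.coord.toLinearMap
  have hD : ∀ X, S.coord (D X) = T (S.coord X) := fun X => S.coord.apply_symm_apply _
  have key : ∀ i j, D ⁅S.basis i, S.basis j⁆ = ⁅D (S.basis i), S.basis j⁆ + ⁅S.basis i, D (S.basis j)⁆ := by
    intro i j
    refine S.coord.injective ?_
    have := h0 i j
    rw [← coord_basis, ← coord_basis, adC_coord, adE_coord, ← hD, ← hD, ← hD, adC_coord, adE_coord,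
      adE_coord] at this
    rw [this, map_add]
  obtain ⟨X, hX⟩ := S.exists_ad_eq_of_derivation D fun X Y => by
    rw [← S.basis.sum_repr X, ← S.basis.sum_repr Y]
    simp only [map_sum, sum_lie, lie_sum, smul_lie, lie_smul, map_smul, key, smul_add,
      Finset.sum_add_distrib]
  refine ⟨X, S.ext_coord fun Y => ?_⟩
  rw [adE_coord, ← hD, ← hX, LieAlgebra.ad_apply]

/-- Automorphisms close to the identity are inner. -/
theorem eventually_exists_expG : ∀ᶠ T : S.Euc →L[ℝ] S.Euc in nhds 1,
    (∀ x y, T (S.adC x y) = S.adC (T x) (T y)) → ∃ X, T = S.repG (S.expG X) := by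
  obtain ⟨C, hC, hev⟩ := eventually_eq_exp_mul S.adC S.defect fun T hT => by
    obtain ⟨X, hX⟩ := S.exists_adE_eq_of_defect_eq_zero hT
    exact ⟨S.coord X, by rw [adC_coord, hX]⟩
  -- This radius gives C‖ad‖‖v‖ < 1. The factor 1 + v is again an automorphism, so its linear defect
  -- equals [v·, v·]; the quadratic bound then contradicts v ≠ 0.
  filter_upwards [hev (1 / (C * (‖S.adC‖ + 1))) (by positivity)] with T hp hT
  obtain ⟨r, v, hTv, hε, hle⟩ := hp
  obtain ⟨X, rfl⟩ := S.coord.surjective r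
  rw [adC_coord, ← repG_expG] at hTv
  have haut : ∀ x y, (1 + v) (S.adC x y) = S.adC ((1 + v) x) ((1 + v) y) := by
    intro x y
    have h1 := hT x y
    rw [hTv, mul_apply_eq_comp, mul_apply_eq_comp, mul_apply_eq_comp, ← adC_repG] at h1
    have h2 : ∀ z, S.repG (S.expG X)⁻¹ (S.repG (S.expG X) z) = z := fun z => by
      rw [← mul_apply_eq_comp, ← map_mul, inv_mul_cancel, map_one, one_apply_eq_self]
    have := congrArg (S.repG (S.expG X)⁻¹) h1
    rwa [h2, h2] at this
  have hdef : ∀ i j, S.defect v i j = S.adC (v (S.ob i)) (v (S.ob j)) := by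
    intro i j
    have := haut (S.ob i) (S.ob j)
    simp only [add_apply, one_apply_eq_self, map_add] at this
    change v (S.adC (S.ob i) (S.ob j)) - S.adC (v (S.ob i)) (S.ob j) -
      S.adC (S.ob i) (v (S.ob j)) = _
    rw [sub_sub, sub_eq_iff_eq_add]
    have h3 := add_left_cancel (a := S.adC (S.ob i) (S.ob j)) (this.trans (by rw [add_assoc]))
    rw [h3]
    abel
  have hbound : ‖S.defect v‖ ≤ ‖S.adC‖ * ‖v‖ * ‖v‖ := by
    refine (pi_norm_le_iff_of_nonneg (by positivity)).mpr fun i =>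
      (pi_norm_le_iff_of_nonneg (by positivity)).mpr fun j => ?_
    rw [hdef]
    have hob : ∀ i, ‖S.ob i‖ = 1 := fun i => S.ob.orthonormal.1 i
    have hle : ∀ i, ‖v (S.ob i)‖ ≤ ‖v‖ := fun i => by simpa [hob] using v.le_opNorm (S.ob i)
    calc ‖S.adC (v (S.ob i)) (v (S.ob j))‖ ≤ ‖S.adC‖ * ‖v (S.ob i)‖ * ‖v (S.ob j)‖ :=
          S.adC.le_opNorm₂ _ _
      _ ≤ _ := by gcongr <;> exact hle _
  have hv0 : v = 0 := by
    by_contra hne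
    have hpos : 0 < ‖v‖ := norm_pos_iff.mpr hne
    have h1 : ‖v‖ ≤ C * (‖S.adC‖ * ‖v‖ * ‖v‖) := hle.trans (by gcongr)
    rw [lt_div_iff₀ (by positivity)] at hε
    have h2 : 0 < C * ‖v‖ := by positivity
    nlinarith
  exact ⟨X, by rw [hTv, hv0, add_zero, mul_one]⟩

theorem norm_repG_K_apply {k : S.G} (hk : k ∈ S.K) (x : S.Euc) : ‖S.repG k x‖ = ‖x‖ := by
  rw [norm_eq_sqrt_real_inner, S.inner_repG_K hk, norm_eq_sqrt_real_inner]

/-- Closedness is the issue, since `G` need not be closed by definition. A limit of elements of `K`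
is an orthogonal automorphism; it differs from a nearby element of `K` by an automorphism close to
1, which is inner and so belongs to `G`. -/
theorem isCompact_K : IsCompact (S.K : Set S.G) := by
  rw [S.isInducing_repG.isCompact_iff]
  have : ProperSpace (S.Euc →L[ℝ] S.Euc) := FiniteDimensional.proper ℝ _
  refine Metric.isCompact_of_isClosed_isBounded (isClosed_of_closure_subset fun T hT => ?_) ?_
  · have haut : ∀ x y, T (S.adC x y) = S.adC (T x) (T y) := by
      intro x y
      have hc : IsClosed {T : S.Euc →L[ℝ] S.Euc | T (S.adC x y) = S.adC (T x) (T y)} :=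
        isClosed_eq (by fun_prop) (by fun_prop)
      refine closure_minimal ?_ hc hT
      rintro _ ⟨k, _, rfl⟩
      exact S.adC_repG k x y
    have hiso : ∀ x y, inner ℝ (T x) (T y) = inner ℝ x y := by
      intro x y
      have hc : IsClosed {T : S.Euc →L[ℝ] S.Euc | inner ℝ (T x) (T y) = inner ℝ x y} :=
        isClosed_eq (by fun_prop) (by fun_prop)
      refine closure_minimal ?_ hc hT
      rintro _ ⟨k, hk, rfl⟩
      exact S.inner_repG_K hk x y
    obtain ⟨ε, hε, hball⟩ := Metric.eventually_nhds_iff.mp S.eventually_exists_expG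
    obtain ⟨_, ⟨k, hk, rfl⟩, hdist⟩ := Metric.mem_closure_iff.mp hT ε hε
    have hki : k⁻¹ ∈ S.K := S.K.inv_mem hk
    obtain ⟨X, hX⟩ := hball (y := S.repG k⁻¹ * T) (by
      refine lt_of_le_of_lt ?_ hdist
      rw [dist_eq_norm, dist_eq_norm]
      have : S.repG k⁻¹ * T - 1 = S.repG k⁻¹ * (T - S.repG k) := by
        rw [mul_sub, ← map_mul, inv_mul_cancel, map_one]
      rw [this]
      refine ContinuousLinearMap.opNorm_le_bound _ (norm_nonneg _) fun x => ?_
      rw [mul_apply_eq_comp, S.norm_repG_K_apply hki]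
      exact ContinuousLinearMap.le_opNorm _ _) fun x y => by
        rw [mul_apply_eq_comp, mul_apply_eq_comp, mul_apply_eq_comp, haut, adC_repG]
    have hTeq : T = S.repG (k * S.expG X) := by
      rw [map_mul, ← hX, ← mul_assoc, ← map_mul, mul_inv_cancel, map_one, one_mul]
    refine ⟨k * S.expG X, S.mem_K_of_ip fun Y Z => ?_, hTeq.symm⟩
    rw [← inner_coord, ← repG_coord, ← repG_coord, ← hTeq, hiso, inner_coord]
  · refine isBounded_iff_forall_norm_le.mpr ⟨1, ?_⟩
    rintro _ ⟨k, hk, rfl⟩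
    refine ContinuousLinearMap.opNorm_le_bound _ zero_le_one fun x => ?_
    rw [S.norm_repG_K_apply hk, one_mul]

instance : CompactSpace S.K := isCompact_iff_compactSpace.mp S.isCompact_K

/-! ### A trace identity for the projection to `𝔨` along `𝔞 + 𝔫` -/

/-- The projection to the basis vectors of negative degree. -/
def negPart : 𝔤 →ₗ[ℝ] 𝔤 := ∑ j with S.deg j < 0, (S.ip (S.basis j)).smulRight (S.basis j)

/-- On the `(-1)`-eigenspace of `θ`, this is the projection to `𝔨` along `𝔞 + 𝔫`. -/
def kPart : 𝔤 →ₗ[ℝ] 𝔤 := S.negPart + S.θ.toLinearMap ∘ₗ S.negPart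

theorem negPart_apply (X : 𝔤) :
    S.negPart X = ∑ j with S.deg j < 0, S.ip (S.basis j) X • S.basis j := by
  simp [negPart]

theorem ip_basis_negPart (i : Fin S.dim) (X : 𝔤) :
    S.ip (S.basis i) (S.negPart X) = if S.deg i < 0 then S.ip (S.basis i) X else 0 := by
  rw [negPart_apply, map_sum]
  simp only [map_smul, ip_basis, smul_eq_mul, mul_ite, mul_one, mul_zero]
  rw [Finset.sum_ite_eq]
  simp

theorem kPart_apply (X : 𝔤) : S.kPart X = S.negPart X + S.θ (S.negPart X) := rfl

theorem theta_kPart (X : 𝔤) : S.θ (S.kPart X) = S.kPart X := by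
  rw [kPart_apply, map_add, S.θ_involutive, add_comm]

theorem theta_mem_filGt {X : 𝔤} (hX : ∀ j, 0 ≤ S.deg j → S.ip (S.basis j) X = 0) :
    S.θ X ∈ S.filGt 0 := by
  intro j hj
  rw [← S.sum_ip_basis X, map_sum, map_sum]
  refine Finset.sum_eq_zero fun k _ => ?_
  rw [map_smul, map_smul]
  by_cases hk : 0 ≤ S.deg k
  · rw [hX k hk, zero_smul]
  · rw [S.ip_basis_theta_of_ne (by linarith), smul_zero]

/-- The decomposition `Z = Y + H + X` with `Y ∈ 𝔨`, `H ∈ 𝔞`, `X ∈ 𝔫` if `θZ = -Z`. -/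
theorem exists_sub_kPart_eq {Z : 𝔤} (hZ : S.θ Z = -Z) :
    ∃ (H : S.𝔞) (X : 𝔤), X ∈ S.filGt 0 ∧ Z = S.kPart Z + H + X ∧
      ∀ i, S.ip (S.basis i) ⁅Z, S.basis i⁆ = S.wt i H := by
  -- The degree-zero part is θ-odd and commutes with `H₀`, so it lies in 𝔞. It alone contributes to
  -- the diagonal of `ad Z`.
  set Z0 := ∑ j with S.deg j = 0, S.ip (S.basis j) Z • S.basis j with hZ0
  have hZ0c : ∀ i, S.ip (S.basis i) Z0 = if S.deg i = 0 then S.ip (S.basis i) Z else 0 := by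
    intro i
    rw [hZ0, map_sum]
    simp only [map_smul, ip_basis, smul_eq_mul, mul_ite, mul_one, mul_zero]
    rw [Finset.sum_ite_eq]
    simp
  have hlie : ⁅Z0, (S.H₀ : 𝔤)⁆ = 0 := by
    rw [hZ0, sum_lie]
    refine Finset.sum_eq_zero fun j hj => ?_
    rw [smul_lie, ← lie_skew, lie_H₀_basis, (Finset.mem_filter.mp hj).2, zero_smul, neg_zero, smul_zero]
  have hθ : S.θ Z0 = -Z0 := by
    refine S.basis.ext_elem fun i => ?_
    rw [basis_repr, basis_repr, map_neg, hZ0c]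
    by_cases hi : S.deg i = 0
    · have hexp : ∀ W, S.ip (S.θ (S.basis i)) W =
          ∑ j, S.ip (S.basis j) W * S.ip (S.basis j) (S.θ (S.basis i)) := fun W => by
        conv_lhs => rw [← S.sum_ip_basis W]
        rw [map_sum]
        exact Finset.sum_congr rfl fun j _ => by rw [map_smul, smul_eq_mul, S.ip_symm (S.θ (S.basis i)) (S.basis j)]
      rw [if_pos hi, ← S.ip_theta_left, ← map_neg, ← hZ, ← S.ip_theta_left, hexp, hexp]
      refine Finset.sum_congr rfl fun j _ => ?_
      rw [hZ0c]
      split_ifs with hj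
      · rfl
      · rw [S.ip_basis_theta_of_ne (by rw [hi, neg_zero]; exact hj), mul_zero, mul_zero]
    · rw [if_neg hi, neg_zero, ← S.sum_ip_basis Z0, map_sum, map_sum]
      refine Finset.sum_eq_zero fun j _ => ?_
      rw [map_smul, map_smul, hZ0c]
      by_cases hj : S.deg j = 0
      · rw [S.ip_basis_theta_of_ne (by rw [hj, neg_zero]; exact hi), smul_zero]
      · rw [if_neg hj, zero_smul]
  have hmem := S.mem_a_of_lie_H₀ hθ hlie
  refine ⟨⟨Z0, hmem⟩, Z - S.kPart Z - Z0, fun j hj => ?_, by simp, fun i => ?_⟩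
  · have h1 : S.ip (S.basis j) (S.θ (S.negPart Z)) = 0 := S.theta_mem_filGt
      (fun j hj => by rw [ip_basis_negPart, if_neg (not_lt.mpr hj)]) j hj
    rw [kPart_apply, map_sub, map_sub, map_add, h1, hZ0c, ip_basis_negPart]
    rcases hj.eq_or_lt with h | h
    · simp [h]
    · simp [h, h.ne]
  · have h1 : S.wt i ⟨Z0, hmem⟩ = S.ip (S.basis i) ⁅Z0, S.basis i⁆ := by
      have := S.lie_basis ⟨Z0, hmem⟩ i
      rw [this, map_smul, ip_basis]
      simp
    rw [h1, ip_basis_lie, ip_basis_lie]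
    refine Finset.sum_congr rfl fun k _ => Finset.sum_congr rfl fun l _ => ?_
    rw [hZ0c]
    split_ifs with hk
    · rfl
    · by_cases hl : l = i
      · rw [hl, S.ip_basis_lie_of_ne (fun h => hk (by linarith)), mul_zero, mul_zero, mul_zero]
      · rw [ip_basis, if_neg hl, zero_mul, mul_zero, mul_zero]

theorem trace_eq_sum (T : 𝔤 →ₗ[ℝ] 𝔤) :
    LinearMap.trace ℝ 𝔤 T = ∑ i, S.ip (S.basis i) (T (S.basis i)) := by
  rw [LinearMap.trace_eq_matrix_trace ℝ S.basis, Matrix.trace]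
  refine Finset.sum_congr rfl fun i _ => ?_
  rw [Matrix.diag_apply, LinearMap.toMatrix_apply, basis_repr]

/-- θ conjugates `ad X` into its negative. -/
theorem trace_ad_eq_zero {X : 𝔤} (hX : S.θ X = -X) :
    LinearMap.trace ℝ 𝔤 (LieAlgebra.ad ℝ 𝔤 X) = 0 := by
  have h1 : LieAlgebra.ad ℝ 𝔤 (S.θ X) =
      S.θ.toLinearMap ∘ₗ (LieAlgebra.ad ℝ 𝔤 X ∘ₗ S.θ.toLinearMap) := by
    refine LinearMap.ext fun Y => ?_
    change ⁅S.θ X, Y⁆ = S.θ ⁅X, S.θ Y⁆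
    rw [LieHom.map_lie, S.θ_involutive]
  have h2 : (LieAlgebra.ad ℝ 𝔤 X ∘ₗ S.θ.toLinearMap) ∘ₗ S.θ.toLinearMap = LieAlgebra.ad ℝ 𝔤 X :=
    LinearMap.ext fun Y => congrArg (LieAlgebra.ad ℝ 𝔤 X) (S.θ_involutive Y)
  have h3 := LinearMap.trace_comp_comm' S.θ.toLinearMap (LieAlgebra.ad ℝ 𝔤 X ∘ₗ S.θ.toLinearMap)
  rw [h2, ← h1, hX, map_neg, map_neg] at h3
  linarith

/-- Only basis vectors of negative degree contribute, each with its weight at `H`; the terms with θ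
e_i vanish by skewness. Since tr(ad H) = 0, the negative weights sum to minus the positive ones. -/
theorem trace_ad_comp_kPart {Z : 𝔤} (hZ : S.θ Z = -Z) {H : S.𝔞}
    (hH : ∀ i, S.ip (S.basis i) ⁅Z, S.basis i⁆ = S.wt i H) :
    LinearMap.trace ℝ 𝔤 (LieAlgebra.ad ℝ 𝔤 Z ∘ₗ S.kPart) = -(2 * S.rho H) := by
  have hneg : ∀ i, S.negPart (S.basis i) = if S.deg i < 0 then S.basis i else 0 := by
    intro i
    rw [negPart_apply]
    simp only [ip_basis, ite_smul, one_smul, zero_smul]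
    rw [Finset.sum_ite_eq']
    simp
  have hz : ∀ i, S.ip (S.basis i) ⁅Z, S.θ (S.basis i)⁆ = 0 := by
    intro i
    have h1 : S.ip (S.basis i) ⁅Z, S.θ (S.basis i)⁆ = -S.ip (S.basis i) ⁅Z, S.θ (S.basis i)⁆ := by
      conv_lhs => rw [← S.symm_lie hZ, ← S.ip_theta_left, LieHom.map_lie, hZ, neg_lie, map_neg,
        LinearMap.neg_apply, S.ip_symm]
    linarith
  have h0 := S.trace_ad_eq_zero (S.𝔞_le _ H.2)
  rw [S.trace_eq_sum] at h0
  have hw : ∀ i, S.ip (S.basis i) (LieAlgebra.ad ℝ 𝔤 (H : 𝔤) (S.basis i)) = S.wt i H := by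
    intro i
    rw [LieAlgebra.ad_apply, lie_basis, map_smul, ip_basis]
    simp
  simp only [hw] at h0
  rw [S.trace_eq_sum, two_mul_rho, Finset.sum_filter, eq_neg_iff_add_eq_zero, ← Finset.sum_add_distrib]
  refine (Finset.sum_congr rfl fun i _ => ?_).trans h0
  rw [LinearMap.comp_apply, kPart_apply, hneg, LieAlgebra.ad_apply]
  rcases lt_trichotomy (S.deg i) 0 with h | h | h
  · rw [if_pos h, if_neg (not_lt.mpr h.le), lie_add, map_add, hz, hH, add_zero, add_zero]
  · rw [if_neg h.not_lt, if_neg h.symm.not_lt, S.wt_eq_zero_of_deg_eq_zero h]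
    simp
  · rw [if_neg (not_lt.mpr h.le), if_pos h]
    simp

/-- Elements that fix `𝔞` pointwise and commute with `θ` commute with `kPart`. -/
theorem kPart_M {m : S.G} (hm : m ∈ S.M) (X : 𝔤) : S.kPart (m.1 X) = m.1 (S.kPart X) := by
  have hdeg : ∀ i j, S.deg i ≠ S.deg j → S.ip (S.basis i) (m.1 (S.basis j)) = 0 := by
    intro i j hij
    have h1 := S.ip_basis_lie_a S.H₀ (m.1 (S.basis j)) i
    rw [← S.M_apply hm S.H₀, ← S.G_automorphism m.1 m.2, lie_H₀_basis, map_smul, map_smul,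
      smul_eq_mul] at h1
    change _ = S.deg i * _ at h1
    have h2 : (S.deg j - S.deg i) * S.ip (S.basis i) (m.1 (S.basis j)) = 0 := by linarith
    exact (mul_eq_zero.mp h2).resolve_left fun h0 => hij (by linarith)
  have hneg : S.negPart (m.1 X) = m.1 (S.negPart X) := by
    refine S.basis.ext_elem fun i => ?_
    rw [basis_repr, basis_repr, ip_basis_negPart]
    conv_lhs => rw [← S.sum_ip_basis X]
    rw [negPart_apply, Finset.sum_filter]
    simp only [map_sum, map_smul, apply_ite m.1, apply_ite (S.ip (S.basis i)), map_zero, smul_eq_mul]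
    by_cases hi : S.deg i < 0
    · rw [if_pos hi]
      refine Finset.sum_congr rfl fun j _ => ?_
      split_ifs with hj
      · rfl
      · rw [hdeg i j (by intro h; exact hj (h ▸ hi)), mul_zero]
    · rw [if_neg hi, eq_comm]
      refine Finset.sum_eq_zero fun j _ => ?_
      split_ifs with hj
      · rw [hdeg i j (by intro h; exact hi (h ▸ hj)), mul_zero]
      · rfl
  rw [kPart_apply, kPart_apply, hneg, map_add, hm.1]

/-- The vectors `(e_i + θ e_i)/2`. -/
def kFrame (i : Fin S.dim) : 𝔤 := (1 / 2 : ℝ) • (S.basis i + S.θ (S.basis i))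

theorem theta_kFrame (i : Fin S.dim) : S.θ (S.kFrame i) = S.kFrame i := by
  rw [kFrame, map_smul, map_add, S.θ_involutive, add_comm]

theorem sum_ip_smul_kFrame {Y : 𝔤} (hY : S.θ Y = Y) :
    ∑ i, S.ip (S.basis i) Y • S.kFrame i = Y := by
  have h1 : ∀ i, S.ip (S.basis i) Y • S.kFrame i = (1 / 2 : ℝ) •
      (S.ip (S.basis i) Y • S.basis i + S.θ (S.ip (S.basis i) Y • S.basis i)) := fun i => by
    rw [kFrame, map_smul, ← smul_add, smul_comm]
  rw [Finset.sum_congr rfl fun i _ => h1 i, ← Finset.smul_sum, Finset.sum_add_distrib, ← map_sum,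
    sum_ip_basis, hY, ← two_smul ℝ Y, smul_smul]
  norm_num

/-- For `Y` in 𝔨, `ad Y` is skew and commutes with θ, so both `ad Y` and `ad Y ∘ θ` have zero
diagonal. -/
theorem ip_lie_kFrame {Y : 𝔤} (hY : S.θ Y = Y) (i : Fin S.dim) :
    S.ip (S.basis i) ⁅S.kFrame i, Y⁆ = 0 := by
  have hsk : ∀ X W, S.ip X ⁅Y, W⁆ = -S.ip ⁅Y, X⁆ W := fun X W => by
    rw [S.ip_lie_left, hY, neg_neg]
  have h1 : S.ip (S.basis i) ⁅Y, S.basis i⁆ = 0 := by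
    have := hsk (S.basis i) (S.basis i)
    rw [S.ip_symm ⁅Y, S.basis i⁆] at this
    linarith
  have h2 : S.ip (S.basis i) ⁅Y, S.θ (S.basis i)⁆ = 0 := by
    have := hsk (S.basis i) (S.θ (S.basis i))
    rw [← S.ip_theta_left, LieHom.map_lie, hY, S.ip_symm ⁅Y, S.θ (S.basis i)⁆] at this
    linarith
  rw [← lie_skew, map_neg, kFrame, lie_smul, lie_add, map_smul, map_add, h1, h2]
  simp

/-- The divergence of the `𝔨`-component of a vector field. -/
theorem sum_ip_kPart_lie_kFrame {k : S.G} (hk : k ∈ S.K) {X : 𝔤} {H : S.𝔞}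
    (hX : S.θ X = -X) (hH : ∀ i, S.ip (S.basis i) ⁅k⁻¹.1 X, S.basis i⁆ = S.wt i H) :
    ∑ i, S.ip (S.basis i) (k.1 (S.kPart (k⁻¹.1 ⁅S.kFrame i, X⁆))) = 2 * S.rho H := by
  have hkk : ∀ Y, k.1 (k⁻¹.1 Y) = Y := fun Y => k.1.apply_symm_apply Y
  have hkk' : ∀ Y, k⁻¹.1 (k.1 Y) = Y := fun Y => k.1.symm_apply_apply Y
  let Pk : 𝔤 →ₗ[ℝ] 𝔤 := (1 / 2 : ℝ) • (LinearMap.id + S.θ.toLinearMap)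
  have hPk : ∀ Y, Pk Y = (1 / 2 : ℝ) • (Y + S.θ Y) := fun Y => rfl
  -- Up to sign the sum is tr(A B); cyclicity replaces it by tr(B A), the trace already computed for
  -- k⁻¹X.
  let A : 𝔤 →ₗ[ℝ] 𝔤 := (k.1 : 𝔤 →ₗ[ℝ] 𝔤) ∘ₗ S.kPart
  let B : 𝔤 →ₗ[ℝ] 𝔤 := (k⁻¹.1 : 𝔤 →ₗ[ℝ] 𝔤) ∘ₗ LieAlgebra.ad ℝ 𝔤 X ∘ₗ Pk
  have hBA : B ∘ₗ A = LieAlgebra.ad ℝ 𝔤 (k⁻¹.1 X) ∘ₗ S.kPart := by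
    refine LinearMap.ext fun Y => ?_
    change k⁻¹.1 ⁅X, Pk (k.1 (S.kPart Y))⁆ = ⁅k⁻¹.1 X, S.kPart Y⁆
    rw [hPk, ← hk, theta_kPart, ← two_smul ℝ (k.1 (S.kPart Y)), smul_smul,
      one_div_mul_cancel two_ne_zero, one_smul]
    exact (S.G_automorphism k⁻¹.1 k⁻¹.2 _ _).trans (by rw [hkk'])
  have htr := S.trace_ad_comp_kPart (S.theta_smul_K (S.K.inv_mem hk) hX) hH
  rw [← hBA, LinearMap.trace_comp_comm', S.trace_eq_sum] at htr
  rw [← neg_neg (2 * S.rho H), ← htr, ← Finset.sum_neg_distrib]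
  refine Finset.sum_congr rfl fun i _ => ?_
  change _ = -S.ip (S.basis i) (k.1 (S.kPart (k⁻¹.1 ⁅X, S.kFrame i⁆)))
  rw [← lie_skew X, map_neg, map_neg, map_neg, map_neg, neg_neg]

/-! ### The topology of the boundary -/

theorem continuous_kProj : Continuous S.kProj := by
  rw [S.isInducing_repG.continuous_iff]
  have h : S.repG ∘ S.kProj = qrOrth S.ob ∘ S.repG := funext fun g => (S.qrOrth_repG_eq g).symm
  rw [h, continuous_iff_continuousAt]
  exact fun g => ContinuousAt.comp (contDiffAt_qrOrth (b := S.ob) (S.isUnit_repG g)).continuousAt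
    S.continuous_repG.continuousAt

theorem inv_mul_mem_M {k k' : S.G} (hk : k ∈ S.K) (hk' : k' ∈ S.K) (h : S.bpt k = S.bpt k') :
    k⁻¹ * k' ∈ S.M := by
  obtain ⟨m, hm, H, n, hn, hp⟩ := S.mem_MAN_iff.mp (S.bpt_eq_bpt.mp h)
  have h1 := S.kProj_mul_MAN 1 hm H hn
  rw [← hp, one_mul, S.kProj_of_mem_K (S.K.mul_mem (S.K.inv_mem hk) hk'),
    S.kProj_of_mem_K S.K.one_mem, one_mul] at h1
  rwa [h1]

/-- A section of `K → B`. -/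
def sec (b : S.Bdry) : S.G := S.kProj (S.exists_bpt_eq b).choose

theorem sec_mem (b : S.Bdry) : S.sec b ∈ S.K := S.kProj_mem _

theorem bpt_sec (b : S.Bdry) : S.bpt (S.sec b) = b :=
  (S.bpt_kProj _).trans (S.exists_bpt_eq b).choose_spec

theorem exists_sec_bpt (g : S.G) : ∃ m ∈ S.M, S.sec (S.bpt g) = S.kProj g * m := by
  refine ⟨(S.kProj g)⁻¹ * S.sec (S.bpt g), S.inv_mul_mem_M (S.kProj_mem g) (S.sec_mem _) ?_,
    (mul_inv_cancel_left _ _).symm⟩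
  rw [bpt_kProj, bpt_sec]

theorem continuous_bdry {Y : Type*} [TopologicalSpace Y] {f : S.Bdry → Y}
    (h : Continuous fun g => f (S.bpt g)) : Continuous f :=
  (QuotientGroup.isQuotientMap_mk (N := S.MAN)).continuous_iff.mpr h

theorem continuous_bpt : Continuous S.bpt := QuotientGroup.continuous_mk (N := S.MAN)

/-- `sec` is an arbitrary section, but by right M-invariance `u ∘ sec` pulls back to `u ∘ kProj`
along the quotient map from `G`. -/
theorem continuous_comp_sec {Y : Type*} [TopologicalSpace Y] {u : S.G → Y}
    (hu : ContinuousOn u S.K) (hM : ∀ k ∈ S.K, ∀ m ∈ S.M, u (k * m) = u k) :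
    Continuous fun b => u (S.sec b) := by
  refine S.continuous_bdry ?_
  have h : (fun g => u (S.sec (S.bpt g))) = fun g => u (S.kProj g) := by
    funext g
    obtain ⟨m, hm, h⟩ := S.exists_sec_bpt g
    rw [h, hM _ (S.kProj_mem g) _ hm]
  rw [h]
  exact hu.comp_continuous S.continuous_kProj S.kProj_mem

theorem continuous_smul_Bdry (g : S.G) : Continuous fun b : S.Bdry => g • b :=
  S.continuous_bdry (S.continuous_bpt.comp (S.continuous_mul_left_G g))

instance : MeasurableConstSMul S.G S.Bdry := ⟨fun g => (S.continuous_smul_Bdry g).measurable⟩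

instance : CompactSpace S.Bdry := by
  have h : Set.range (fun k : S.K => S.bpt k) = Set.univ :=
    Set.range_eq_univ.mpr fun b => ⟨⟨S.sec b, S.sec_mem b⟩, S.bpt_sec b⟩
  exact ⟨h ▸ isCompact_range (S.continuous_bpt.comp continuous_subtype_val)⟩

/-- A projection to `𝔞`. -/
def projA : 𝔤 →ₗ[ℝ] S.𝔞 :=
  (LinearMap.exists_leftInverse_of_injective S.𝔞.subtype (LinearMap.ker_eq_bot.mpr
    S.𝔞.injective_subtype)).choose

theorem projA_apply (H : S.𝔞) : S.projA H = H :=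
  LinearMap.congr_fun (LinearMap.exists_leftInverse_of_injective S.𝔞.subtype
    (LinearMap.ker_eq_bot.mpr S.𝔞.injective_subtype)).choose_spec H

/-- The projection to `𝔞`, as an operator on the space of coordinates. -/
def projE : S.Euc →L[ℝ] S.Euc := S.rep (S.𝔞.subtype ∘ₗ S.projA)

theorem projE_coord (X : 𝔤) : S.projE (S.coord X) = S.coord (S.projA X : 𝔤) := S.rep_coord _ X

theorem repG_mul_projE_of_mem_M {m : S.G} (hm : m ∈ S.M) : S.repG m * S.projE = S.projE :=
  S.ext_coord fun X => by rw [mul_apply_eq_comp, projE_coord, repG_coord, S.M_apply hm]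

theorem mem_M_of_repG_mul_projE {k k' : S.G} (hk : k ∈ S.K) (hk' : k' ∈ S.K)
    (h : S.repG k * S.projE = S.repG k' * S.projE) : k⁻¹ * k' ∈ S.M := by
  refine S.mem_M_iff.mpr ⟨S.K.mul_mem (S.K.inv_mem hk) hk', fun H => ?_⟩
  have h1 := congrArg (fun T => T (S.coord H)) h
  simp only [mul_apply_eq_comp, projE_coord, projA_apply, repG_coord] at h1
  change k.1.symm (k'.1 H) = H
  rw [← S.coord.injective h1, LinearEquiv.symm_apply_apply]

/-- An embedding of `B = K/M` in a vector space. -/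
def bdryEmb (b : S.Bdry) : S.Euc →L[ℝ] S.Euc := S.repG (S.sec b) * S.projE

theorem bdryEmb_bpt (g : S.G) : S.bdryEmb (S.bpt g) = qrOrth S.ob (S.repG g) * S.projE := by
  obtain ⟨m, hm, h⟩ := S.exists_sec_bpt g
  rw [bdryEmb, h, map_mul, mul_assoc, S.repG_mul_projE_of_mem_M hm, qrOrth_repG_eq]

/-- A point kM is sent to the restriction of `k` to 𝔞, whose stabilizer in `K` is exactly `M`; then
compactness of `B` suffices. Measures on `B` can thus be compared in a vector space. -/
theorem isClosedEmbedding_bdryEmb : Topology.IsClosedEmbedding S.bdryEmb := by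
  refine Continuous.isClosedEmbedding ?_ fun b b' h => ?_
  · refine S.continuous_comp_sec (u := fun g => S.repG g * S.projE)
      (S.continuous_repG.mul continuous_const).continuousOn fun k _ m hm => ?_
    rw [map_mul, mul_assoc, S.repG_mul_projE_of_mem_M hm]
  · have := S.mem_M_of_repG_mul_projE (S.sec_mem b) (S.sec_mem b') h
    rw [← S.bpt_sec b, ← S.bpt_sec b', bpt_eq_bpt]
    exact S.mem_MAN_iff.mpr ⟨_, this, 0, 1, S.N.one_mem, by simp [expG_zero]⟩

/-! ### Derivatives of integrals over the boundary -/

theorem smul_sec {k : S.G} (hk : k ∈ S.K) (b : S.Bdry) : ∃ m ∈ S.M, S.sec (k • b) = k * S.sec b * m := by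
  have hkb := S.K.mul_mem hk (S.sec_mem b)
  refine ⟨(k * S.sec b)⁻¹ * S.sec (k • b), S.inv_mul_mem_M hkb (S.sec_mem _) ?_,
    (mul_inv_cancel_left _ _).symm⟩
  rw [← smul_bpt, bpt_sec, bpt_sec]

theorem integral_K_mul_sec {β : Measure S.Bdry} (hβ : ∀ k ∈ S.K, β.map (fun b => k • b) = β)
    {u : S.G → ℂ} (hM : ∀ g, ∀ m ∈ S.M, u (g * m) = u g) {k : S.G} (hk : k ∈ S.K) :
    ∫ b, u (k * S.sec b) ∂β = ∫ b, u (S.sec b) ∂β := by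
  conv_rhs => rw [← hβ k hk]
  refine Eq.trans ?_ ((MeasurableEquiv.smul k).measurableEmbedding.integral_map _).symm
  refine integral_congr_ae (Filter.Eventually.of_forall fun b => ?_)
  obtain ⟨m, hm, h⟩ := S.smul_sec hk b
  change _ = u (S.sec (k • b))
  rw [h, hM _ _ hm]

theorem hasDerivAt_repG_expG_mul (X : 𝔤) (T : S.Euc →L[ℝ] S.Euc) (t : ℝ) :
    HasDerivAt (fun s : ℝ => S.repG (S.expG (s • X)) * T)
      (S.adE X * (S.repG (S.expG (t • X)) * T)) t := by
  have h := (hasDerivAt_exp_smul_const' (𝕂 := ℝ) (S.adE X) t).mul_const T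
  simpa only [repG_expG, map_smul, mul_assoc] using h

theorem fderiv_apply_eq_deriv {h : (S.Euc →L[ℝ] S.Euc) → ℂ} (hh : ∀ T, IsUnit T → ContDiffAt ℝ 1 h T)
    (X : 𝔤) (g : S.G) (t : ℝ) : HasDerivAt (fun s : ℝ => h (S.repG (S.expG (s • X)) * S.repG g))
      (fderiv ℝ h (S.repG (S.expG (t • X)) * S.repG g)
        (S.adE X * (S.repG (S.expG (t • X)) * S.repG g))) t := by
  have h1 := (hh _ ((S.isUnit_repG (S.expG (t • X))).mul (S.isUnit_repG g))).differentiableAt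
    one_ne_zero
  exact h1.hasFDerivAt.comp_hasDerivAt t (S.hasDerivAt_repG_expG_mul X _ t)

/-- Differentiation under the integral: the derivative is continuous on the compact set [-1,1] × K,
hence bounded, and `hM` makes the integrands continuous on `B`. -/
theorem hasDerivAt_integral_expG_mul {β : Measure S.Bdry} [IsFiniteMeasure β]
    {h : (S.Euc →L[ℝ] S.Euc) → ℂ} (hh : ∀ T, IsUnit T → ContDiffAt ℝ 1 h T)
    (hM : ∀ g, ∀ m ∈ S.M, h (S.repG (g * m)) = h (S.repG g)) (X : 𝔤) :
    Integrable (fun b => fderiv ℝ h (S.repG (S.sec b)) (S.adE X * S.repG (S.sec b))) β ∧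
      HasDerivAt (fun s : ℝ => ∫ b, h (S.repG (S.expG (s • X)) * S.repG (S.sec b)) ∂β)
        (∫ b, fderiv ℝ h (S.repG (S.sec b)) (S.adE X * S.repG (S.sec b)) ∂β) 0 := by
  have hcont : ∀ s : ℝ, Continuous fun b => h (S.repG (S.expG (s • X)) * S.repG (S.sec b)) := by
    intro s
    refine S.continuous_comp_sec (u := fun g => h (S.repG (S.expG (s • X)) * S.repG g))
      (Continuous.continuousOn ?_) fun k _ m hm => ?_
    · refine continuous_iff_continuousAt.mpr fun g => ?_
      exact ContinuousAt.comp (g := h) (hh _ ((S.isUnit_repG _).mul (S.isUnit_repG g))).continuousAt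
        (continuous_const.mul S.continuous_repG).continuousAt
    · rw [← map_mul, ← map_mul, ← mul_assoc, hM _ m hm]
  have hexp : Continuous fun s : ℝ => S.repG (S.expG (s • X)) := by
    refine continuous_iff_continuousAt.mpr fun t => ?_
    simpa only [mul_one] using (S.hasDerivAt_repG_expG_mul X 1 t).continuousAt
  have hcurve : Continuous fun p : ℝ × S.G => S.repG (S.expG (p.1 • X)) * S.repG p.2 :=
    (hexp.comp continuous_fst).mul (S.continuous_repG.comp continuous_snd)
  have hder : Continuous fun p : ℝ × S.G => fderiv ℝ h (S.repG (S.expG (p.1 • X)) * S.repG p.2)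
      (S.adE X * (S.repG (S.expG (p.1 • X)) * S.repG p.2)) := by
    refine Continuous.clm_apply ?_ (continuous_const.mul hcurve)
    refine continuous_iff_continuousAt.mpr fun p => ?_
    exact ContinuousAt.comp (g := fderiv ℝ h)
      ((hh _ ((S.isUnit_repG _).mul (S.isUnit_repG p.2))).fderiv_right (m := 0) le_rfl).continuousAt
      hcurve.continuousAt
  have hzero : ∀ T : S.Euc →L[ℝ] S.Euc, S.repG (S.expG ((0 : ℝ) • X)) * T = T := fun T => by
    rw [zero_smul, expG_zero, map_one, one_mul]
  obtain ⟨C, hC⟩ := ((isCompact_Icc (a := (-1 : ℝ)) (b := 1)).prod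
    S.isCompact_K).exists_bound_of_continuousOn hder.continuousOn
  have hder0 : Continuous fun b =>
      fderiv ℝ h (S.repG (S.sec b)) (S.adE X * S.repG (S.sec b)) := by
    refine S.continuous_comp_sec
      (u := fun g => fderiv ℝ h (S.repG g) (S.adE X * S.repG g)) ?_ fun k _ m hm => ?_
    · refine Continuous.continuousOn ?_
      simpa only [Function.comp_def, hzero] using hder.comp (Continuous.prodMk_right (0 : ℝ))
    -- M-invariance passes to the derivative, since the curves through `k * m` and `k` give the same
    -- function of `s`.
    · have h1 := S.fderiv_apply_eq_deriv hh X (k * m) 0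
      have h2 := S.fderiv_apply_eq_deriv hh X k 0
      simp only [← map_mul, ← mul_assoc] at h1
      simp only [hM _ m hm] at h1
      simp only [map_mul, mul_assoc, hzero] at h1 h2 ⊢
      exact h1.unique h2
  have key := hasDerivAt_integral_of_dominated_loc_of_deriv_le (μ := β) (x₀ := (0 : ℝ))
    (s := Set.Icc (-1) 1) (bound := fun _ => C)
    (F := fun (s : ℝ) b => h (S.repG (S.expG (s • X)) * S.repG (S.sec b)))
    (F' := fun (s : ℝ) b => fderiv ℝ h (S.repG (S.expG (s • X)) * S.repG (S.sec b))
      (S.adE X * (S.repG (S.expG (s • X)) * S.repG (S.sec b))))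
    (Icc_mem_nhds (by norm_num) (by norm_num))
    (Filter.Eventually.of_forall fun s => (hcont s).aestronglyMeasurable)
    ((hcont 0).integrable_of_hasCompactSupport (HasCompactSupport.of_compactSpace _))
    (by simpa only [hzero] using hder0.aestronglyMeasurable)
    (Filter.Eventually.of_forall fun b s hs => hC (s, S.sec b) ⟨hs, S.sec_mem b⟩)
    (integrable_const C)
    (Filter.Eventually.of_forall fun b s _ => S.fderiv_apply_eq_deriv hh X (S.sec b) s)
  simpa only [hzero] using key

/-- exp(sX) stays in `K`, so the integral is constant in `s`. This is integration by parts along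
`K`. -/
theorem integral_fderiv_eq_zero {β : Measure S.Bdry} [IsFiniteMeasure β]
    (hβ : ∀ k ∈ S.K, β.map (fun b => k • b) = β)
    {h : (S.Euc →L[ℝ] S.Euc) → ℂ} (hh : ∀ T, IsUnit T → ContDiffAt ℝ 1 h T)
    (hM : ∀ g, ∀ m ∈ S.M, h (S.repG (g * m)) = h (S.repG g)) {X : 𝔤} (hX : S.θ X = X) :
    ∫ b, fderiv ℝ h (S.repG (S.sec b)) (S.adE X * S.repG (S.sec b)) ∂β = 0 := by
  have h1 := (S.hasDerivAt_integral_expG_mul (β := β) hh hM X).2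
  have h2 : (fun s : ℝ => ∫ b, h (S.repG (S.expG (s • X)) * S.repG (S.sec b)) ∂β) =
      fun _ => ∫ b, h (S.repG (S.sec b)) ∂β := by
    funext s
    have := S.integral_K_mul_sec hβ (u := fun g => h (S.repG g)) hM
      (S.expG_mem_K (X := s • X) (by rw [map_smul, hX]))
    simpa only [map_mul] using this
  rw [h2] at h1
  exact h1.unique (hasDerivAt_const _ _)

/-! ### Invariance of integrals of covariant functions -/

/-- `F` is `C¹` on the invertible operators, and on `G` it satisfies
`F(g m exp(H) n) = exp(-2ρ(H)) F(g)`. -/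
def IsCovariant (F : (S.Euc →L[ℝ] S.Euc) → ℂ) : Prop :=
  (∀ T, IsUnit T → ContDiffAt ℝ 1 F T) ∧
    ∀ g, ∀ m ∈ S.M, ∀ H : S.𝔞, ∀ n ∈ S.N, F (S.repG (g * (m * S.expG H * n))) =
      Real.exp (-(2 * S.rho H)) • F (S.repG g)

variable {S}

theorem IsCovariant.repG_mul_M {F : (S.Euc →L[ℝ] S.Euc) → ℂ} (hF : S.IsCovariant F) (g : S.G)
    {m : S.G} (hm : m ∈ S.M) : F (S.repG (g * m)) = F (S.repG g) := by
  have := hF.2 g m hm 0 1 S.N.one_mem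
  simpa [expG_zero] using this

theorem IsCovariant.comp_mul_left {F : (S.Euc →L[ℝ] S.Euc) → ℂ} (hF : S.IsCovariant F) (g : S.G) :
    S.IsCovariant fun T => F (S.repG g * T) := by
  refine ⟨fun T hT => ?_, fun g' m hm H n hn => ?_⟩
  · exact (hF.1 _ ((S.isUnit_repG g).mul hT)).comp T (contDiffAt_const.mul contDiffAt_id)
  · simp only [← map_mul]
    rw [← mul_assoc, hF.2 _ m hm H n hn]

/-- Right translation by exp(sX) is left translation by exp(s g(X)), so covariance on the right can
be read as a derivative from the left. -/
theorem IsCovariant.fderiv_mul_adE {F : (S.Euc →L[ℝ] S.Euc) → ℂ} (hF : S.IsCovariant F) (g : S.G)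
    (X : 𝔤) : HasDerivAt (fun s : ℝ => F (S.repG (g * S.expG (s • X))))
      (fderiv ℝ F (S.repG g) (S.adE (g.1 X) * S.repG g)) 0 := by
  have h := S.fderiv_apply_eq_deriv hF.1 (g.1 X) g 0
  simp only [← map_smul, ← map_mul, ← mul_expG] at h
  simpa [expG_zero] using h

theorem IsCovariant.fderiv_a {F : (S.Euc →L[ℝ] S.Euc) → ℂ} (hF : S.IsCovariant F) (g : S.G)
    (H : S.𝔞) : fderiv ℝ F (S.repG g) (S.adE (g.1 H) * S.repG g) =
      (-(2 * S.rho H) : ℝ) • F (S.repG g) := by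
  have h := hF.fderiv_mul_adE g H
  have h2 : (fun s : ℝ => F (S.repG (g * S.expG (s • (H : 𝔤))))) =
      fun s : ℝ => Real.exp (s * -(2 * S.rho H)) • F (S.repG g) := by
    funext s
    have := hF.2 g 1 S.M.one_mem (s • H) 1 S.N.one_mem
    rw [one_mul, mul_one, Submodule.coe_smul, map_smul, smul_eq_mul] at this
    rw [this]
    congr 2
    ring
  rw [h2] at h
  refine h.unique ?_
  have h3 := (((hasDerivAt_id (0 : ℝ)).mul_const (-(2 * S.rho H))).exp).smul_const (F (S.repG g))
  simpa using h3

theorem IsCovariant.fderiv_n {F : (S.Euc →L[ℝ] S.Euc) → ℂ} (hF : S.IsCovariant F) (g : S.G)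
    {X : 𝔤} (hX : X ∈ S.filGt 0) : fderiv ℝ F (S.repG g) (S.adE (g.1 X) * S.repG g) = 0 := by
  have h := hF.fderiv_mul_adE g X
  have h2 : (fun s : ℝ => F (S.repG (g * S.expG (s • X)))) = fun _ => F (S.repG g) := by
    funext s
    have := hF.2 g 1 S.M.one_mem 0 _ (S.expG_mem_N ((S.filGt 0).smul_mem s hX))
    simpa [expG_zero] using this
  rw [h2] at h
  exact h.unique (hasDerivAt_const _ _)

variable (S)

/-- On `K`, the coefficients of the vector field on `K` that `X` induces on `K/M`. -/
def fieldCoeff (X : 𝔤) (i : Fin S.dim) (T : S.Euc →L[ℝ] S.Euc) : ℝ :=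
  ∑ j, inner ℝ (S.coord X) (T (S.coord (S.basis j))) *
    inner ℝ (S.coord (S.basis i)) (T (S.coord (S.kPart (S.basis j))))

theorem hasFDerivAt_fieldCoeff (X : 𝔤) (i : Fin S.dim) (T : S.Euc →L[ℝ] S.Euc) :
    ∃ L : (S.Euc →L[ℝ] S.Euc) →L[ℝ] ℝ, HasFDerivAt (S.fieldCoeff X i) L T ∧ ∀ V, L V =
      ∑ j, (inner ℝ (S.coord X) (T (S.coord (S.basis j))) *
        inner ℝ (S.coord (S.basis i)) (V (S.coord (S.kPart (S.basis j)))) +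
      inner ℝ (S.coord X) (V (S.coord (S.basis j))) *
        inner ℝ (S.coord (S.basis i)) (T (S.coord (S.kPart (S.basis j))))) := by
  let P (x y : S.Euc) : (S.Euc →L[ℝ] S.Euc) →L[ℝ] ℝ :=
    (innerSL ℝ x).comp (ContinuousLinearMap.apply ℝ S.Euc y)
  have h := HasFDerivAt.fun_sum (u := Finset.univ) fun j _ =>
    ((P (S.coord X) (S.coord (S.basis j))).hasFDerivAt (x := T)).mul
      ((P (S.coord (S.basis i)) (S.coord (S.kPart (S.basis j)))).hasFDerivAt (x := T))
  refine ⟨_, h, fun V => ?_⟩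
  rw [sum_apply]
  refine Finset.sum_congr rfl fun j _ => ?_
  simp only [add_apply, smul_apply, smul_eq_mul]
  rw [mul_comm ((P (S.coord (S.basis i)) _) T)]
  rfl

theorem contDiff_fieldCoeff (X : 𝔤) (i : Fin S.dim) : ContDiff ℝ 1 (S.fieldCoeff X i) := by
  unfold fieldCoeff
  refine ContDiff.sum fun j _ => ContDiff.mul ?_ ?_ <;>
  exact contDiff_const.inner ℝ (contDiff_id.clm_apply contDiff_const)

theorem sum_ip_smul_kPart (k : S.G) (hk : k ∈ S.K) (X : 𝔤) :
    ∑ j, S.ip X (k.1 (S.basis j)) • k.1 (S.kPart (S.basis j)) = k.1 (S.kPart (k⁻¹.1 X)) := by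
  have h : ∀ j, S.ip X (k.1 (S.basis j)) = S.ip (S.basis j) (k⁻¹.1 X) := fun j => by
    rw [← S.ip_K hk (S.basis j), S.ip_symm X]
    congr 1
    exact (k.1.apply_symm_apply X).symm
  conv_rhs => rw [← S.sum_ip_basis (k⁻¹.1 X)]
  simp only [map_sum, map_smul, h]

theorem fieldCoeff_repG {k : S.G} (hk : k ∈ S.K) (X : 𝔤) (i : Fin S.dim) :
    S.fieldCoeff X i (S.repG k) = S.ip (S.basis i) (k.1 (S.kPart (k⁻¹.1 X))) := by
  rw [← S.sum_ip_smul_kPart k hk, map_sum]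
  simp only [fieldCoeff, repG_coord, inner_coord, map_smul, smul_eq_mul]

/-- `kPart` commutes with `m`, so `m` only replaces the orthonormal basis in the sum by another one.
-/
theorem fieldCoeff_repG_mul_M (X : 𝔤) (i : Fin S.dim) (g : S.G) {m : S.G} (hm : m ∈ S.M) :
    S.fieldCoeff X i (S.repG (g * m)) = S.fieldCoeff X i (S.repG g) := by
  have hmK := (S.mem_M_iff.mp hm).1
  have h : ∀ g : S.G, S.fieldCoeff X i (S.repG g) = ∑ j, S.ip X (g.1 (S.basis j)) *
      S.ip (S.basis i) (g.1 (S.kPart (S.basis j))) := fun g => by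
    simp only [fieldCoeff, repG_coord, inner_coord]
  have h2 : ∀ j, m.1 (S.basis j) = ∑ l, S.ip (S.basis l) (m.1 (S.basis j)) • S.basis l :=
    fun j => (S.sum_ip_basis _).symm
  have h3 : ∀ l, ∑ j, S.ip (S.basis l) (m.1 (S.basis j)) • m.1 (S.kPart (S.basis j)) =
      S.kPart (S.basis l) := fun l => by
    rw [S.sum_ip_smul_kPart m hmK, S.kPart_M (S.M.inv_mem hm)]
    exact m.1.apply_symm_apply _
  rw [h, h]
  calc _ = ∑ j, ∑ l, S.ip X (g.1 (S.basis l)) * S.ip (S.basis i)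
        (g.1 (S.ip (S.basis l) (m.1 (S.basis j)) • m.1 (S.kPart (S.basis j)))) := by
        refine Finset.sum_congr rfl fun j _ => ?_
        change S.ip X (g.1 (m.1 (S.basis j))) * S.ip (S.basis i) (g.1 (m.1 (S.kPart (S.basis j)))) = _
        conv_lhs => enter [1]; rw [h2 j]
        simp only [map_sum, map_smul, smul_eq_mul, Finset.sum_mul]
        exact Finset.sum_congr rfl fun l _ => by ring
    _ = _ := by
        rw [Finset.sum_comm]
        refine Finset.sum_congr rfl fun l _ => ?_
        rw [← Finset.mul_sum, ← map_sum, ← map_sum, h3]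

theorem adE_smul_mul (c : ℝ) (X : 𝔤) (T : S.Euc →L[ℝ] S.Euc) :
    S.adE (c • X) * T = c • (S.adE X * T) := by
  ext1 x
  simp only [map_smul, mul_apply_eq_comp, smul_apply]

/-- The divergence formula on `K/M`. -/
theorem sum_fderiv_fieldCoeff {F : (S.Euc →L[ℝ] S.Euc) → ℂ} (hF : S.IsCovariant F) {k : S.G}
    (hk : k ∈ S.K) {X : 𝔤} (hX : S.θ X = -X) :
    ∑ i, fderiv ℝ (fun T => S.fieldCoeff X i T • F T) (S.repG k)
      (S.adE (S.kFrame i) * S.repG k) = fderiv ℝ F (S.repG k) (S.adE X * S.repG k) := by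
  obtain ⟨H, N, hN, hdec, hH⟩ := S.exists_sub_kPart_eq (S.theta_smul_K (S.K.inv_mem hk) hX)
  set Y := k.1 (S.kPart (k⁻¹.1 X)) with hY
  have hθY : S.θ Y = Y := by rw [hY, ← hk, theta_kPart]
  have hdF : DifferentiableAt ℝ F (S.repG k) :=
    (hF.1 _ (S.isUnit_repG k)).differentiableAt one_ne_zero
  -- Product rule. Of the two factors of the quadratic coefficient, differentiating the one paired
  -- with e_i gives zero by `ip_lie_kFrame`; the other one moves the bracket onto `X` with a minus
  -- sign.
  have hterm : ∀ i, fderiv ℝ (fun T => S.fieldCoeff X i T • F T) (S.repG k)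
      (S.adE (S.kFrame i) * S.repG k) = fderiv ℝ F (S.repG k)
        (S.adE (S.ip (S.basis i) Y • S.kFrame i) * S.repG k) -
      S.ip (S.basis i) (k.1 (S.kPart (k⁻¹.1 ⁅S.kFrame i, X⁆))) • F (S.repG k) := by
    intro i
    obtain ⟨L, hL, hLV⟩ := S.hasFDerivAt_fieldCoeff X i (S.repG k)
    rw [(hL.fun_smul hdF.hasFDerivAt).fderiv, add_apply, smul_apply,
      ContinuousLinearMap.smulRight_apply, hLV, fieldCoeff_repG _ hk, ← hY, adE_smul_mul,
      map_smul, sub_eq_add_neg, ← neg_smul]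
    congr 2
    simp only [mul_apply_eq_comp, repG_coord, adE_coord, inner_coord]
    rw [Finset.sum_add_distrib]
    have h1 : ∀ j, S.ip X ⁅S.kFrame i, k.1 (S.basis j)⁆ =
        -S.ip ⁅S.kFrame i, X⁆ (k.1 (S.basis j)) := fun j => by
      rw [S.ip_lie_left, theta_kFrame, neg_neg]
    have h2 : ∑ j, S.ip X (k.1 (S.basis j)) * S.ip (S.basis i)
        ⁅S.kFrame i, k.1 (S.kPart (S.basis j))⁆ = 0 := by
      rw [← S.ip_lie_kFrame hθY i, hY, ← S.sum_ip_smul_kPart k hk, lie_sum, map_sum]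
      simp only [lie_smul, map_smul, smul_eq_mul]
    rw [h2, zero_add, ← S.sum_ip_smul_kPart k hk, map_sum, ← Finset.sum_neg_distrib]
    refine Finset.sum_congr rfl fun j _ => ?_
    rw [h1, map_smul, smul_eq_mul, neg_mul]
  have hXdec : X = Y + k.1 H + k.1 N := by
    rw [hY, ← map_add, ← map_add, ← hdec]
    exact (k.1.apply_symm_apply X).symm
  -- The divergence contributes -2ρ(H)F, which is exactly the derivative of `F` along k(H); along
  -- k(N) the derivative is zero.
  rw [Finset.sum_congr rfl fun i _ => hterm i, Finset.sum_sub_distrib, ← Finset.sum_smul,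
    S.sum_ip_kPart_lie_kFrame hk hX hH, ← map_sum, ← Finset.sum_mul, ← map_sum,
    S.sum_ip_smul_kFrame hθY]
  conv_rhs => rw [hXdec, map_add, map_add, add_mul, add_mul, map_add, map_add, hF.fderiv_a,
    hF.fderiv_n _ hN, add_zero, neg_smul, ← sub_eq_add_neg]

theorem integral_fderiv_covariant {β : Measure S.Bdry} [IsFiniteMeasure β]
    (hβ : ∀ k ∈ S.K, β.map (fun b => k • b) = β) {F : (S.Euc →L[ℝ] S.Euc) → ℂ}
    (hF : S.IsCovariant F) {X : 𝔤} (hX : S.θ X = -X) :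
    ∫ b, fderiv ℝ F (S.repG (S.sec b)) (S.adE X * S.repG (S.sec b)) ∂β = 0 := by
  have hC : ∀ i, ∀ T, IsUnit T → ContDiffAt ℝ 1 (fun T => S.fieldCoeff X i T • F T) T :=
    fun i T hT => (S.contDiff_fieldCoeff X i).contDiffAt.smul (hF.1 T hT)
  have hM : ∀ i, ∀ g, ∀ m ∈ S.M, S.fieldCoeff X i (S.repG (g * m)) • F (S.repG (g * m)) =
      S.fieldCoeff X i (S.repG g) • F (S.repG g) := fun i g m hm => by
    rw [S.fieldCoeff_repG_mul_M X i g hm, hF.repG_mul_M g hm]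
  rw [← integral_congr_ae (Filter.Eventually.of_forall fun b =>
    S.sum_fderiv_fieldCoeff hF (S.sec_mem b) hX), integral_finsetSum]
  · exact Finset.sum_eq_zero fun i _ =>
      S.integral_fderiv_eq_zero hβ (hC i) (hM i) (S.theta_kFrame i)
  · exact fun i _ => (S.hasDerivAt_integral_expG_mul (hC i) (hM i) (S.kFrame i)).1

/-- Left translates of covariant functions are covariant, so the vanishing derivative at 0 gives a
vanishing derivative at every `t`. -/
theorem integral_expG_mul {β : Measure S.Bdry} [IsFiniteMeasure β]
    (hβ : ∀ k ∈ S.K, β.map (fun b => k • b) = β) {F : (S.Euc →L[ℝ] S.Euc) → ℂ}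
    (hF : S.IsCovariant F) {X : 𝔤} (hX : S.θ X = -X) :
    ∫ b, F (S.repG (S.expG X * S.sec b)) ∂β = ∫ b, F (S.repG (S.sec b)) ∂β := by
  have hd : ∀ t : ℝ, HasDerivAt (fun t : ℝ => ∫ b, F (S.repG (S.expG (t • X) * S.sec b)) ∂β) 0 t := by
    intro t
    have hFt := hF.comp_mul_left (S.expG (t • X))
    have h := (S.hasDerivAt_integral_expG_mul (β := β) hFt.1 (fun g m hm => hFt.repG_mul_M g hm) X).2
    rw [S.integral_fderiv_covariant hβ hFt hX] at h
    have h2 := HasDerivAt.comp_sub_const (x := t) (a := t) (by rwa [sub_self])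
    refine h2.congr_of_eventuallyEq (Filter.Eventually.of_forall fun s => ?_)
    simp only [← map_mul, ← mul_assoc, ← expG_add_smul, add_sub_cancel]
  have h := is_const_of_deriv_eq_zero (fun t => (hd t).differentiableAt) (fun t => (hd t).deriv) 1 0
  simpa [expG_zero] using h

theorem integral_mul_sec {β : Measure S.Bdry} [IsFiniteMeasure β]
    (hβ : ∀ k ∈ S.K, β.map (fun b => k • b) = β) {F : (S.Euc →L[ℝ] S.Euc) → ℂ}
    (hF : S.IsCovariant F) (g : S.G) :
    ∫ b, F (S.repG (g * S.sec b)) ∂β = ∫ b, F (S.repG (S.sec b)) ∂β := by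
  obtain ⟨k, hk, X, hX, rfl⟩ := S.exists_polar g
  have h := S.integral_expG_mul hβ (hF.comp_mul_left k) hX
  simp only [← map_mul, ← mul_assoc] at h
  rw [h]
  exact S.integral_K_mul_sec hβ (u := fun g => F (S.repG g)) (fun g m hm => hF.repG_mul_M g hm) hk

/-! ### The transformation of the invariant measure on the boundary under `G` -/

theorem contDiffAt_nilDet {T : S.Euc →L[ℝ] S.Euc} (hT : IsUnit T) : ContDiffAt ℝ 1 S.nilDet T :=
  contDiffAt_prod fun i _ => contDiffAt_norm_gsVec hT i

theorem nilDet_ne_zero {T : S.Euc →L[ℝ] S.Euc} (hT : IsUnit T) : S.nilDet T ≠ 0 :=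
  Finset.prod_ne_zero_iff.mpr fun i _ => norm_ne_zero_iff.mpr (gsVec_ne_zero hT i)

/-- `nilDet` supplies the factor exp(-2ρ(H)), while on `G` the exponential depends only on the
boundary point. As `L` varies these test functions separate finite measures on `B`. -/
theorem isCovariant_exp (L : StrongDual ℝ (S.Euc →L[ℝ] S.Euc)) : S.IsCovariant fun T =>
    (S.nilDet T)⁻¹ • Complex.exp ((L (qrOrth S.ob T * S.projE) : ℝ) * Complex.I) := by
  refine ⟨fun T hT => ?_, fun g m hm H n hn => ?_⟩
  · refine ((S.contDiffAt_nilDet hT).inv (S.nilDet_ne_zero hT)).smul (ContDiffAt.cexp ?_)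
    refine ContDiffAt.mul ?_ contDiffAt_const
    exact Complex.ofRealCLM.contDiff.contDiffAt.comp T (L.contDiff.contDiffAt.comp T
      ((contDiffAt_qrOrth hT).mul contDiffAt_const))
  · simp only [← bdryEmb_bpt]
    rw [nilDet_repG, nilDet_repG, S.hProj_mul_MAN g hm H hn, smul_smul]
    congr 2
    · rw [← Real.exp_neg, ← Real.exp_neg, ← Real.exp_add, map_add]
      congr 1
      ring
    · rw [show S.bpt (g * (m * S.expG H * n)) = S.bpt g from (S.bpt_eq_bpt.mpr (by
        rw [inv_mul_cancel_left]
        exact S.mem_MAN_iff.mpr ⟨m, hm, H, n, hn, rfl⟩)).symm]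

/-- The density `exp(-2ρ(A(g0, gb)))`. -/
def jac (g : S.G) (b : S.Bdry) : ℝ := Real.exp (-(2 * S.rho (S.iwasawaProj (g • S.pt 1) (g • b))))

theorem jac_eq (g : S.G) (b : S.Bdry) : S.jac g b = (S.nilDet (S.repG (g * S.sec b)))⁻¹ := by
  rw [nilDet_repG, ← Real.exp_neg, jac]
  conv_lhs => rw [← S.bpt_sec b]
  rw [smul_pt, smul_bpt, iwasawaProj_pt_bpt, mul_one, inv_mul_cancel_left,
    S.hProj_of_mem_K (S.sec_mem b), sub_zero]

theorem toNNReal_jac_smul (g : S.G) (b : S.Bdry) (z : ℂ) :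
    (S.jac g b).toNNReal • z = (S.jac g b : ℂ) * z := by
  rw [NNReal.smul_def, Real.coe_toNNReal (S.jac g b) (Real.exp_pos _).le, Complex.real_smul]

theorem continuous_jac (g : S.G) : Continuous (S.jac g) := by
  rw [funext (S.jac_eq g)]
  refine S.continuous_comp_sec (u := fun k => (S.nilDet (S.repG (g * k)))⁻¹)
    (Continuous.continuousOn ?_) fun k _ m hm => ?_
  · refine Continuous.inv₀ (continuous_iff_continuousAt.mpr fun k => ?_) fun k =>
      S.nilDet_ne_zero (S.isUnit_repG _)
    exact ContinuousAt.comp (g := S.nilDet) (S.contDiffAt_nilDet (S.isUnit_repG _)).continuousAt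
      (S.continuous_repG.comp (S.continuous_mul_left_G g)).continuousAt
  · have := S.hProj_mul_MAN (g * k) hm 0 S.N.one_mem
    rw [Submodule.coe_zero, expG_zero, mul_one, mul_one, add_zero] at this
    rw [nilDet_repG, nilDet_repG, ← mul_assoc, this]

theorem integrable_jac (β : Measure S.Bdry) [IsFiniteMeasure β] (g : S.G) : Integrable (S.jac g) β :=
  (S.continuous_jac g).integrable_of_hasCompactSupport (HasCompactSupport.of_compactSpace _)

/-- The measure `exp(-2ρ(A(g0, gb))) db` is mapped to `db` by `g`. -/
theorem map_smul_withDensity_jac {β : Measure S.Bdry} [IsFiniteMeasure β]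
    (hβ : ∀ k ∈ S.K, β.map (fun b => k • b) = β) (g : S.G) :
    (β.withDensity fun b => (S.jac g b).toNNReal).map (fun b => g • b) = β := by
  have : IsFiniteMeasure (β.withDensity fun b => ((S.jac g b).toNNReal : ℝ≥0∞)) :=
    isFiniteMeasure_withDensity_ofReal (S.integrable_jac β g).2
  have hemb := S.isClosedEmbedding_bdryEmb.measurableEmbedding
  have hg : MeasurableEmbedding fun b : S.Bdry => g • b :=
    (MeasurableEquiv.smul g).measurableEmbedding
  have hjac : Measurable fun b => (S.jac g b).toNNReal :=
    (S.continuous_jac g).measurable.real_toNNReal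
  -- Both characteristic functions at `L` are integrals of the same covariant function, over g·K/M
  -- and over K/M; on `K` the factor `nilDet` is 1.
  have key : ((β.withDensity fun b => ((S.jac g b).toNNReal : ℝ≥0∞)).map (fun b => g • b)).map
      S.bdryEmb = β.map S.bdryEmb := by
    refine Measure.ext_of_charFunDual (funext fun L => ?_)
    rw [charFunDual_apply, charFunDual_apply, hemb.integral_map, hemb.integral_map,
      hg.integral_map, integral_withDensity_eq_integral_smul hjac]
    have h := S.integral_mul_sec hβ (S.isCovariant_exp L) g
    simp only [← bdryEmb_bpt, ← smul_bpt, bpt_sec, ← jac_eq] at h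
    simp only [nilDet_repG, S.hProj_of_mem_K (S.sec_mem _), map_zero, mul_zero, Real.exp_zero,
      inv_one, one_smul] at h
    rw [← h]
    refine integral_congr_ae (Filter.Eventually.of_forall fun b => ?_)
    exact (S.toNNReal_jac_smul g b _).trans (Complex.real_smul).symm
  have h2 := congrArg (Measure.comap S.bdryEmb) key
  rwa [hemb.comap_map, hemb.comap_map] at h2

/-! ### The symbol calculus is equivariant -/

theorem weylIntegrand_translate (g : S.G) (a : S.Sym) (y z : S.Omega) (p : S.DualA × S.Bdry) :
    S.weylIntegrand (S.translate g a) y z p =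
      (S.jac g p.2).toNNReal • S.weylIntegrand a (g • y) (g • z) (p.1, g • p.2) := by
  have h := S.planeWave_mul_planeWave_smul g p.1 p.2 y z
  rw [toNNReal_jac_smul, weylIntegrand, weylIntegrand, translate, midpt_smul, mul_assoc, mul_assoc,
    h, jac, Real.exp_neg]
  have h0 : ((Real.exp (2 * S.rho (S.iwasawaProj (g • S.pt 1) (g • p.2))) : ℝ) : ℂ) ≠ 0 :=
    Complex.ofReal_ne_zero.mpr (Real.exp_pos _).ne'
  rw [Complex.ofReal_inv]
  field_simp

/-- The action is trivial on 𝔞*, so the density |c(λ)|⁻² is untouched and only the boundary Jacobian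
enters. -/
theorem measurePreserving_plancherel (η : Measure S.DualA) [SFinite η] {β : Measure S.Bdry}
    [IsFiniteMeasure β] (hβ : ∀ k ∈ S.K, β.map (fun b => k • b) = β) (g : S.G) :
    MeasurePreserving (Prod.map id fun b : S.Bdry => g • b)
      ((S.plancherel η β).withDensity fun p => ((S.jac g p.2).toNNReal : ℝ≥0∞))
      (S.plancherel η β) := by
  have hjac : Measurable fun b => ((S.jac g b).toNNReal : ℝ≥0∞) :=
    (S.continuous_jac g).measurable.real_toNNReal.coe_nnreal_ennreal
  rw [plancherel, ← prod_withDensity_right hjac]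
  exact (MeasurePreserving.id _).prod ⟨measurable_const_smul g, S.map_smul_withDensity_jac hβ g⟩

theorem measurableEmbedding_prodMap_smul (g : S.G) :
    MeasurableEmbedding (Prod.map (id : S.DualA → S.DualA) fun b : S.Bdry => g • b) :=
  ((MeasurableEquiv.refl S.DualA).prodCongr (MeasurableEquiv.smul g)).measurableEmbedding

theorem measurable_jac_snd (g : S.G) :
    Measurable fun p : S.DualA × S.Bdry => (S.jac g p.2).toNNReal :=
  ((S.continuous_jac g).measurable.comp measurable_snd).real_toNNReal

theorem integrable_weylIntegrand_translate (η : Measure S.DualA) [SFinite η] {β : Measure S.Bdry}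
    [IsFiniteMeasure β] (hβ : ∀ k ∈ S.K, β.map (fun b => k • b) = β) (g : S.G) (a : S.Sym)
    (y z : S.Omega) : Integrable (S.weylIntegrand (S.translate g a) y z) (S.plancherel η β) ↔
      Integrable (S.weylIntegrand a (g • y) (g • z)) (S.plancherel η β) := by
  refine Iff.trans ?_ ((S.measurePreserving_plancherel η hβ g).integrable_comp_emb
    (S.measurableEmbedding_prodMap_smul g))
  rw [integrable_withDensity_iff_integrable_smul (S.measurable_jac_snd g),
    funext (S.weylIntegrand_translate g a y z)]
  rfl

theorem weylKernel_translate (η : Measure S.DualA) [SFinite η] {β : Measure S.Bdry}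
    [IsFiniteMeasure β] (hβ : ∀ k ∈ S.K, β.map (fun b => k • b) = β) (g : S.G) (a : S.Sym)
    (y z : S.Omega) :
    S.weylKernel η β (S.translate g a) y z = S.weylKernel η β a (g • y) (g • z) := by
  refine Eq.trans ?_ ((S.measurePreserving_plancherel η hβ g).integral_comp
    (S.measurableEmbedding_prodMap_smul g) _)
  rw [integral_withDensity_eq_integral_smul (S.measurable_jac_snd g), weylKernel,
    funext (S.weylIntegrand_translate g a y z)]
  rfl

theorem KernelConverges.translate {μ : Measure S.Omega} [SMulInvariantMeasure S.G S.Omega μ]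
    (η : Measure S.DualA) [SFinite η] {β : Measure S.Bdry} [IsFiniteMeasure β]
    (hβ : ∀ k ∈ S.K, β.map (fun b => k • b) = β) {a : S.Sym} (ha : S.KernelConverges μ η β a)
    (g : S.G) : S.KernelConverges μ η β (S.translate g a) := by
  have hq := (measurePreserving_smul g μ).quasiMeasurePreserving
  filter_upwards [hq.ae ha] with y hy
  filter_upwards [hq.ae hy] with z hz
  exact (S.integrable_weylIntegrand_translate η hβ g a y z).mpr hz

/-! ### Conjugation of integral operators -/

section Conjugation

variable (μ : Measure S.Omega) [SMulInvariantMeasure S.G S.Omega μ] (g : S.G)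

theorem U_smul_ae (u : Lp ℂ 2 μ) : (fun z => S.U μ g u (g • z)) =ᵐ[μ] u := by
  have h := (measurePreserving_smul g μ).quasiMeasurePreserving.ae
    (Lp.coeFn_compMeasurePreserving u (measurePreserving_smul g⁻¹ μ))
  filter_upwards [h] with z hz
  refine hz.trans ?_
  rw [Function.comp_apply, inv_smul_smul]

theorem kernel_U_ae (κ : S.Omega → S.Omega → ℂ) (u : Lp ℂ 2 μ) (y : S.Omega) :
    (fun z => κ (g • y) (g • z) * S.U μ g u (g • z)) =ᵐ[μ] fun z => κ (g • y) (g • z) * u z := by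
  filter_upwards [S.U_smul_ae μ g u] with z hz
  rw [hz]

theorem integrable_kernel_U (κ : S.Omega → S.Omega → ℂ) (u : Lp ℂ 2 μ) (y : S.Omega) :
    Integrable (fun z => κ (g • y) z * S.U μ g u z) μ ↔
      Integrable (fun z => κ (g • y) (g • z) * u z) μ := by
  rw [← integrable_congr (S.kernel_U_ae μ g κ u y)]
  exact ((measurePreserving_smul g μ).integrable_comp_emb
    (MeasurableEquiv.smul g).measurableEmbedding).symm

theorem integral_kernel_U (κ : S.Omega → S.Omega → ℂ) (u : Lp ℂ 2 μ) (y : S.Omega) :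
    ∫ z, κ (g • y) z * S.U μ g u z ∂μ = ∫ z, κ (g • y) (g • z) * u z ∂μ := by
  rw [← integral_congr_ae (S.kernel_U_ae μ g κ u y)]
  exact ((measurePreserving_smul g μ).integral_comp
    (MeasurableEquiv.smul g).measurableEmbedding _).symm

theorem ae_smul_iff {p : S.Omega → Prop} : (∀ᵐ y ∂μ, p (g • y)) ↔ ∀ᵐ y ∂μ, p y := by
  refine ⟨fun h => ?_, fun h => (measurePreserving_smul g μ).quasiMeasurePreserving.ae h⟩
  have := (measurePreserving_smul g⁻¹ μ).quasiMeasurePreserving.ae h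
  simpa only [smul_inv_smul] using this

theorem memLp_smul_iff {f : S.Omega → ℂ} :
    MemLp (fun y => f (g • y)) 2 μ ↔ MemLp f 2 μ := by
  have h := (MeasurableEquiv.smul g).measurableEmbedding.memLp_map_measure_iff (μ := μ) (g := f)
    (p := 2)
  have h2 : μ.map (MeasurableEquiv.smul g) = μ := (measurePreserving_smul g μ).map_eq
  rw [h2] at h
  exact h.symm

/-- Translating `z` changes the inner integral and translating `y` the outer conditions. Both
translations are invertible and preserve μ, so the domains coincide. -/
theorem U_mem_kernelDomain (κ : S.Omega → S.Omega → ℂ) (u : Lp ℂ 2 μ) :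
    S.U μ g u ∈ kernelDomain μ κ ↔ u ∈ kernelDomain μ fun y z => κ (g • y) (g • z) := by
  refine and_congr ?_ ?_
  · rw [← S.ae_smul_iff μ g]
    simp only [S.integrable_kernel_U]
  · rw [← S.memLp_smul_iff μ g]
    simp only [S.integral_kernel_U]

theorem adjoint_U_comp_kernelOp (κ : S.Omega → S.Omega → ℂ) :
    LinearMap.compPMap (ContinuousLinearMap.adjoint
        ((S.U μ g).toContinuousLinearEquiv : Lp ℂ 2 μ →L[ℂ] Lp ℂ 2 μ)).toLinearMap
        (precomp (kernelOp μ κ) (S.U μ g).toLinearEquiv.toLinearMap) =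
      kernelOp μ fun y z => κ (g • y) (g • z) := by
  refine LinearPMap.ext (Submodule.ext (S.U_mem_kernelDomain μ g κ)) fun u hu hu' => ?_
  -- The adjoint of the unitary `U` is its inverse, composition with the translation by `g`.
  have h : (S.U μ g).symm (MemLp.toLp _ hu.2) = MemLp.toLp _ hu'.2 := by
    refine (Lp.toLp_compMeasurePreserving hu.2 (measurePreserving_smul g μ)).trans ?_
    congr 1
    exact funext fun y => S.integral_kernel_U μ g κ u y
  refine Eq.trans ?_ h
  change ContinuousLinearMap.adjoint
    ((S.U μ g).toContinuousLinearEquiv : Lp ℂ 2 μ →L[ℂ] Lp ℂ 2 μ) (MemLp.toLp _ hu.2) = _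
  rw [LinearIsometryEquiv.adjoint_eq_symm]
  rfl

end Conjugation

/-- Needed for the product with β: 𝔞* is finite-dimensional, hence σ-compact, and Haar measure is
finite on compact sets. -/
theorem sigmaFinite_dualA (η : Measure S.DualA) [η.IsAddHaarMeasure] : SigmaFinite η := by
  have hinj : Function.Injective (ContinuousLinearMap.coeLM ℝ : S.DualA →ₗ[ℝ] (S.𝔞 →ₗ[ℝ] ℝ)) :=
    ContinuousLinearMap.coe_injective
  have : FiniteDimensional ℝ S.DualA := FiniteDimensional.of_injective _ hinj
  let e : S.DualA ≃L[ℝ] (Fin (Module.finrank ℝ S.DualA) → ℝ) :=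
    ContinuousLinearEquiv.ofFinrankEq (by simp)
  have : SigmaCompactSpace S.DualA := e.toHomeomorph.isClosedEmbedding.sigmaCompactSpace
  infer_instance

end NoncompactSymmetricSpace

end

theorem mainTheorem7 {𝔤 : Type*} [LieRing 𝔤] [LieAlgebra ℝ 𝔤] [FiniteDimensional ℝ 𝔤]
    [TopologicalSpace 𝔤] [IsTopologicalAddGroup 𝔤] [ContinuousSMul ℝ 𝔤] [T2Space 𝔤]
    (S : NoncompactSymmetricSpace 𝔤)
    (μ : MeasureTheory.Measure S.Omega) [MeasureTheory.IsLocallyFiniteMeasure μ]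
    [MeasureTheory.SMulInvariantMeasure S.G S.Omega μ]
    (η : MeasureTheory.Measure S.DualA) [η.IsAddHaarMeasure]
    (β : MeasureTheory.Measure S.Bdry) [MeasureTheory.IsProbabilityMeasure β]
    (hβ : ∀ k ∈ S.K, MeasureTheory.Measure.map (fun b : S.Bdry => k • b) β = β)
    (a : S.Sym) (ha : S.KernelConverges μ η β a) (g : S.G) :
    S.KernelConverges μ η β (S.translate g a) ∧
      LinearMap.compPMap
          (ContinuousLinearMap.adjoint
            ((S.U μ g).toContinuousLinearEquiv :
              MeasureTheory.Lp ℂ 2 μ →L[ℂ] MeasureTheory.Lp ℂ 2 μ)).toLinearMap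
          (precomp (S.weylOp μ η β a)
            (S.U μ g).toLinearEquiv.toLinearMap) =
        S.weylOp μ η β (S.translate g a) := by
  have := S.sigmaFinite_dualA η
  have hker : S.weylKernel η β (S.translate g a) =
      fun y z => S.weylKernel η β a (g • y) (g • z) :=
    funext fun y => funext fun z => S.weylKernel_translate η hβ g a y z
  refine ⟨NoncompactSymmetricSpace.KernelConverges.translate S η hβ ha g, ?_⟩
  rw [NoncompactSymmetricSpace.weylOp, NoncompactSymmetricSpace.weylOp, hker]
  exact S.adjoint_U_comp_kernelOp μ g (S.weylKernel η β a)
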